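/- **Setting.** Let $a<-1$ and $b\ne 0$ be real, put $\sigma(x,y)=\left(1-x+\frac xy,\,1-y+\frac yx\right)$, $\tau(x,y)=(x,\,bx+a+1-y)$, $f=\tau\circ\sigma$, so that $f^{-1}=\sigma\circ\tau$, and let $\rho\approx 2.1479$ be the largest real root of $x^3-x^2-2x-1$. Let $\mathcal X_R$ be the compact real surface obtained from the real projective plane $\{[x:y:z]\}\supset\mathbf R^2=\{z\neq0\}$ by blowing up the points $[1:0:0]$, $[1:b:0]$, $[0:1:0]$, and then the point of the exceptional fibre over $[0:1:0]$ that corresponds to the line $x=1$. Let $V_0$ be the line at infinity, $V_1=\{x=0\}$, and let $V_2,V_3,V_4,V_5$ be the exceptional curves over $[0:1:0]$, over the infinitely near point, over $[1:0:0]$ and over $[1:b:0]$. The parameters $t_1,t_3,t_4,t_5$ on $V_1,V_3,V_4,V_5$ are those of the intersection with $y=t_1$, $(x-1)(y-1)=t_3$, $y=t_4$, $y=bx+t_5$. The maps $f^{\pm1}$ extend continuously to $\mathcal X_R$ minus a finite set $\mathcal I(f^{\pm1})$ of points of indeterminacy. A curve is the image of a continuous map $\gamma$ from an interval to $\mathcal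 X_R$. The length of a curve (of a map $\gamma$) is measured with respect to any fixed distance that induces the topology of $\mathcal X_R$, for instance a Riemannian one. **Arcs.** Cutting $\mathcal X_R$ along $\bigcup V_j$ leaves the half planes $x<0$ and $x>0$. Apart from $V_0,V_2$, each of them is bounded by one copy of each of $V_1,V_4,V_5$, and $x>0$ is bounded in addition by two copies $V_3^{\pm}$ of $V_3$, approached with $y\to\pm\infty$. Each of these sides is a copy of $[-\infty,\infty]$ through its parameter $t_j$ (an infinite parameter stands for the point of $V_j$ on $V_0\cup V_2$, approached from that end of the side). On the sides put $$E_1^s=[-\infty,a+1],\quad E_3^s=[-\infty,-1],\quad E_4^s=[-\infty,2a+2],\quad E_5^s=[-\infty,a+1],$$ $$E_1^u=[0,\infty],\quad E_3^u=[1,\infty],\quad E_4^u=[0,\infty],\quad E_5^u=[-1-a,\infty],$$ and write $E_{3\pm}^{s/u}$ for the copies on $V_3^\pm$. A $j$u-arc ($j=1,2,3,4$) is a simple arc in $\mathcal X_R$ whose interior lies in the half plane given below, and whose endpoints are approached within that half plane at the two sets of side points given below. * If $b>0$: 1u: $x<0$, from $E_4^s$ to $E_1^s\cup E_5^s$; 2u: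 $x>0$, from $E_5^s$ to $E_4^s\cup E_{3-}^s$; 3u: $x>0$, from $E_1^s$ to $E_5^s$; 4u: $x>0$, from $E_1^s$ to $E_{3+}^s$. * If $b<0$: 1u: $x<0$, from $E_5^s$ to $E_1^s\cup E_4^s$; 2u: $x>0$, from $E_1^s$ to $E_4^s$; 3u: $x>0$, from $E_1^s$ to $E_5^s\cup E_{3-}^s$; 4u: $x>0$, from $E_1^s$ to $E_{3+}^s$. The $j$s-arcs are the images of the $j$u-arcs under $\tau$; explicitly, they are given by the same list with $4\leftrightarrow5$, $3+\leftrightarrow3-$ and $E^s$ replaced by $E^u$. Two such arcs are distinct if they meet (if at all) only at endpoints, and $\mathbf u(S)=(m_1,\dots,m_4)$ means that $m_j\in\{0,1,\dots,\infty\}$ is the largest number of pairwise distinct $j$u-arcs contained in $S\subset\mathcal X_R$. **Theorem.** Let $a<-1$, $b\neq0$, and let $\gamma$ be a curve in $\mathcal X_R$ that is disjoint from $\bigcup_{n\ge0}f^{-n}\mathcal I(f)$ and that contains a u-arc (of any of the four types). Then $\mathbf u(f^n\gamma)$ and $\mathrm{Length}(f^n\gamma)$ both grow at least as fast as $\rho^n$: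 there is $c>0$ such that, for all large $n$, every component of $\mathbf u(f^n\gamma)$ is at least $c\rho^n$; and for each distance as above there is $c>0$ such that $\mathrm{Length}(f^n\gamma)\ge c\rho^n$ for all large $n$. If moreover $\gamma'$ is a curve in $\mathcal X_R$ that is disjoint from $\bigcup_{n\ge0}f^{n}\mathcal I(f^{-1})$ and that contains an s-arc, then there is $c>0$ such that $\#(f^n\gamma\cap f^{-n}\gamma')\ge c\rho^{2n}$ for all large $n$. -/

import Mathlib

open Set Filter Topology
open scoped ENNReal

noncomputable section

namespace PlaneBirational

/-! ### The plane maps -/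

/-- The involution `σ(x,y) = (1 - x + x/y, 1 - y + y/x)`, meaningful on `torusPart`. -/
def sigma (p : ℝ × ℝ) : ℝ × ℝ :=
  (1 - p.1 + p.1 / p.2, 1 - p.2 + p.2 / p.1)

/-- The involution `τ(x,y) = (x, b x + a + 1 - y)`. -/
def tau (a b : ℝ) (p : ℝ × ℝ) : ℝ × ℝ :=
  (p.1, b * p.1 + a + 1 - p.2)

/-- The dense open set `{x ≠ 0, y ≠ 0}` on which `σ` is given by its formula. -/
def torusPart : Set (ℝ × ℝ) := {p | p.1 ≠ 0 ∧ p.2 ≠ 0}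

/-! ### The compactification `X_R`

On the real projective plane consider the pencils
`[x : z]`, `[y : z]`, `[y - b x : z]`, `[(x - z) y : x² + z²]`.
Their real base points are `[0:1:0]`, `[1:0:0]`, `[1:b:0]` and, for the last one, `[0:1:0]`
with base ideal `(u - w, w²)` in the local coordinates `u = x/y`, `w = z/y`.  Blowing up these
ideals is blowing up the three points and then the point `x = 1` of the exceptional fibre over
`[0:1:0]`.  On the resulting surface the four pencils are continuous maps to the real projective
line `OnePoint ℝ`, and together they separate points; their values are
* `(x, y, y - b x, (x-1)y/(1+x²))` at a point of the plane (in particular `V₁ = {x = 0}`),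
* `(∞, ∞, ∞, t₀)` on `V₀` (the line at infinity), `(t₂, ∞, ∞, ∞)` on `V₂`,
* `(1, ∞, ∞, t₃/2)` on `V₃`, `(∞, t₄, ∞, 0)` on `V₄`, `(∞, ∞, t₅, b)` on `V₅`.
So the surface, which is compact, is the closure of the plane under these four functions. -/

/-- The four coordinate functions on the plane. -/
def coords (b : ℝ) (p : ℝ × ℝ) : OnePoint ℝ × OnePoint ℝ × OnePoint ℝ × OnePoint ℝ :=
  ((p.1 : OnePoint ℝ), (p.2 : OnePoint ℝ), ((p.2 - b * p.1 : ℝ) : OnePoint ℝ),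
    (((p.1 - 1) * p.2 / (1 + p.1 ^ 2) : ℝ) : OnePoint ℝ))

/-- The compact surface `X_R`: the closure of the real plane in the blown-up projective plane,
with its topology. -/
abbrev XR (b : ℝ) : Type := closure (range (coords b))

/-- `d` is a distance on `X_R` that induces its topology (e.g. any Riemannian distance). -/
def IsCompatible (b : ℝ) (d : MetricSpace (XR b)) : Prop :=
  d.toPseudoMetricSpace.toUniformSpace.toTopologicalSpace =
    @instTopologicalSpaceSubtype _ (fun p => p ∈ closure (range (coords b))) inferInstance

/-- The inclusion of the plane in `X_R`. -/
def incl (b : ℝ) (p : ℝ × ℝ) : XR b := ⟨coords b p, subset_closure (mem_range_self p)⟩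

instance (b : ℝ) : Nonempty (XR b) := ⟨incl b (0, 0)⟩

/-- The union of the curves `V₀, …, V₅` in `X_R`: the points at infinity and the line `x = 0`. -/
def curvesV (b : ℝ) : Set (XR b) := (incl b '' {p | p.1 ≠ 0})ᶜ

/-! ### Birational maps of `X_R` -/

/-- Indeterminacy points of the rational map of `X_R` given by `g` on the dense set `D` of the
plane: the points where it has no limit. -/
def indet (b : ℝ) (D : Set (ℝ × ℝ)) (g : ℝ × ℝ → ℝ × ℝ) : Set (XR b) :=
  {p | ¬ ∃ q : XR b, Tendsto (fun u => incl b (g u)) (comap (incl b) (𝓝 p) ⊓ 𝓟 D) (𝓝 q)}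

/-- The rational map of `X_R` given by `g` on the dense set `D` of the plane: the extension by
limits (the value at an indeterminacy point is irrelevant). -/
def extend (b : ℝ) (D : Set (ℝ × ℝ)) (g : ℝ × ℝ → ℝ × ℝ) (p : XR b) : XR b :=
  limUnder (comap (incl b) (𝓝 p) ⊓ 𝓟 D) (fun u => incl b (g u))

/-- `f = τ ∘ σ` on `X_R`. -/
def f (a b : ℝ) : XR b → XR b := extend b torusPart (tau a b ∘ sigma)

/-- `I(f)`. -/
def indetF (a b : ℝ) : Set (XR b) := indet b torusPart (tau a b ∘ sigma)

/-- `f⁻¹ = σ ∘ τ` on `X_R`. -/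
def fInv (a b : ℝ) : XR b → XR b := extend b (tau a b ⁻¹' torusPart) (sigma ∘ tau a b)

/-- `I(f⁻¹)`. -/
def indetFInv (a b : ℝ) : Set (XR b) := indet b (tau a b ⁻¹' torusPart) (sigma ∘ tau a b)

/-! ### The hexagon, s-arcs and u-arcs

Cutting `X_R` along the `Vⱼ` leaves the two open half planes `x < 0` and `x > 0`.  Up to the removed
curves `V₀`, `V₂` (which become vertices), `x < 0` is bounded by one copy of each of `V₁`, `V₄`,
`V₅`, and `x > 0` by one copy of each of `V₁`, `V₄`, `V₅` and by two copies of `V₃`, reached with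
`y → +∞` and `y → -∞`.  Each such side is a copy of `[-∞, ∞]`, through the parameter `tⱼ`. -/

/-- The sides of the two halves of the hexagon. -/
inductive Side
  | V1 | V3top | V3bot | V4 | V5

/-- The path `c` in the plane (in one of the two half planes) tends along `l` to the point with
parameter `t ∈ [-∞, ∞]` of the given side.  Parameters: `y = t₁` on `V₁`, `(x-1)(y-1) = t₃` on `V₃`,
`y = t₄` on `V₄`, `y = b x + t₅` on `V₅`.  If `t` is infinite this point is the intersection of `Vⱼ`
with `V₀` or `V₂`, approached from the corresponding end of the side; if `t` is finite, some of the
conditions are redundant. -/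
def Approaches (b : ℝ) (l : Filter ℝ) (c : ℝ → ℝ × ℝ) : Side → EReal → Prop
  | .V1, t => Tendsto (fun s => (c s).1) l (𝓝 0) ∧
      Tendsto (fun s => (((c s).2 : ℝ) : EReal)) l (𝓝 t)
  | .V3top, t => Tendsto (fun s => (c s).2) l atTop ∧ Tendsto (fun s => (c s).1) l (𝓝 1) ∧
      Tendsto (fun s => ((((c s).1 - 1) * ((c s).2 - 1) : ℝ) : EReal)) l (𝓝 t)
  | .V3bot, t => Tendsto (fun s => (c s).2) l atBot ∧ Tendsto (fun s => (c s).1) l (𝓝 1) ∧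
      Tendsto (fun s => ((((c s).1 - 1) * ((c s).2 - 1) : ℝ) : EReal)) l (𝓝 t)
  | .V4, t => Tendsto (fun s => |(c s).1|) l atTop ∧ Tendsto (fun s => (c s).2 / (c s).1) l (𝓝 0) ∧
      Tendsto (fun s => (((c s).2 : ℝ) : EReal)) l (𝓝 t)
  | .V5, t => Tendsto (fun s => |(c s).1|) l atTop ∧ Tendsto (fun s => (c s).2 / (c s).1) l (𝓝 b) ∧
      Tendsto (fun s => (((c s).2 - b * (c s).1 : ℝ) : EReal)) l (𝓝 t)

/-- The intervals `E^s_j`. -/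
def Es (a : ℝ) : Side → Set EReal
  | .V1 => Iic ((a + 1 : ℝ) : EReal)
  | .V3top => Iic ((-1 : ℝ) : EReal)
  | .V3bot => Iic ((-1 : ℝ) : EReal)
  | .V4 => Iic ((2 * a + 2 : ℝ) : EReal)
  | .V5 => Iic ((a + 1 : ℝ) : EReal)

/-- The intervals `E^u_j`. -/
def Eu (a : ℝ) : Side → Set EReal
  | .V1 => Ici ((0 : ℝ) : EReal)
  | .V3top => Ici ((1 : ℝ) : EReal)
  | .V3bot => Ici ((1 : ℝ) : EReal)
  | .V4 => Ici ((0 : ℝ) : EReal)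
  | .V5 => Ici ((-1 - a : ℝ) : EReal)

/-- A family of arcs: the half plane that contains the interior of the arc, and the sides on which
its two endpoints lie.  (As a half plane is simply connected, a homotopy class of arcs with
endpoints sliding in the `E`-intervals is given by such data.) -/
structure ArcType where
  half : Set (ℝ × ℝ)
  source : Set Side
  target : Set Side

def leftHalf : Set (ℝ × ℝ) := {p | p.1 < 0}

def rightHalf : Set (ℝ × ℝ) := {p | 0 < p.1}

/-- `A` is an arc in `X_R` (a homeomorphic image of `[0,1]`) of the type `T`, with endpoints in the
intervals `E`. -/
def IsArcOfType (b : ℝ) (E : Side → Set EReal) (T : ArcType) (A : Set (XR b)) : Prop :=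
  ∃ (α : ℝ → XR b) (c : ℝ → ℝ × ℝ),
    ContinuousOn α (Icc 0 1) ∧ InjOn α (Icc 0 1) ∧ α '' Icc 0 1 = A ∧
    (∀ s ∈ Ioo (0 : ℝ) 1, c s ∈ T.half ∧ α s = incl b (c s)) ∧
    (∃ v ∈ T.source, ∃ t ∈ E v, Approaches b (𝓝[>] 0) c v t) ∧
    (∃ v ∈ T.target, ∃ t ∈ E v, Approaches b (𝓝[<] 1) c v t)

/-- The four types of u-arcs, for `b > 0` and for `b < 0`.  (If `b < 0`, the places of `V₄` and `V₅`
in the hexagon are interchanged.) -/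
def uType (b : ℝ) (j : Fin 4) : ArcType :=
  if 0 < b then
    match j with
    | 0 => ⟨leftHalf, {.V4}, {.V1, .V5}⟩
    | 1 => ⟨rightHalf, {.V5}, {.V4, .V3bot}⟩
    | 2 => ⟨rightHalf, {.V1}, {.V5}⟩
    | 3 => ⟨rightHalf, {.V1}, {.V3top}⟩
  else
    match j with
    | 0 => ⟨leftHalf, {.V5}, {.V1, .V4}⟩
    | 1 => ⟨rightHalf, {.V1}, {.V4}⟩
    | 2 => ⟨rightHalf, {.V1}, {.V5, .V3bot}⟩
    | 3 => ⟨rightHalf, {.V1}, {.V3top}⟩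

/-- The four types of s-arcs: the mirror images of the u-arcs under `τ`, which interchanges
`V₄` and `V₅`, and the two copies of `V₃`. -/
def sType (b : ℝ) (j : Fin 4) : ArcType :=
  if 0 < b then
    match j with
    | 0 => ⟨leftHalf, {.V5}, {.V1, .V4}⟩
    | 1 => ⟨rightHalf, {.V4}, {.V5, .V3top}⟩
    | 2 => ⟨rightHalf, {.V1}, {.V4}⟩
    | 3 => ⟨rightHalf, {.V1}, {.V3bot}⟩
  else
    match j with
    | 0 => ⟨leftHalf, {.V4}, {.V1, .V5}⟩
    | 1 => ⟨rightHalf, {.V1}, {.V5}⟩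
    | 2 => ⟨rightHalf, {.V1}, {.V4, .V3top}⟩
    | 3 => ⟨rightHalf, {.V1}, {.V3bot}⟩

/-- `A` is a u-arc of type `j + 1`. -/
def IsUArc (a b : ℝ) (j : Fin 4) (A : Set (XR b)) : Prop :=
  IsArcOfType b (Es a) (uType b j) A

/-- `A` is an s-arc of type `j + 1`. -/
def IsSArc (a b : ℝ) (j : Fin 4) (A : Set (XR b)) : Prop :=
  IsArcOfType b (Eu a) (sType b j) A

/-- The component `u_{j+1}(S)`: the (maximal) number of distinct u-arcs of type `j + 1` contained
in `S`.  Distinct arcs are required to meet at most at endpoints; since the endpoints, and only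
they, lie on the `Vⱼ`, this says that they meet only on `⋃ Vⱼ`. -/
def uCount (a b : ℝ) (j : Fin 4) (S : Set (XR b)) : ℕ∞ :=
  ⨆ 𝒜 ∈ {𝒜 : Set (Set (XR b)) | (∀ A ∈ 𝒜, IsUArc a b j A ∧ A ⊆ S) ∧
    𝒜.Pairwise fun A B => A ∩ B ⊆ curvesV b}, 𝒜.encard

/-- The length of the curve `g` on `I`, for the distance `d` on `X_R`. -/
def curveLength {b : ℝ} (d : MetricSpace (XR b)) (I : Set ℝ) (g : ℝ → XR b) : ℝ≥0∞ :=
  letI := d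
  eVariationOn g I

end PlaneBirational

end

/-! Put ν = x + y − xy, so that σ = (ν/y, ν/x). Where defined, σ keeps the product (x−1)(y−1), and
it keeps the slope y/x off the curve ν = 0, which it contracts to the origin (the point t₁ = 0 of
V₁). A path crossing the axis y = 0 transversally or not is sent, at the crossing, to the point t₄ =
1 of V₄. On the sides, σ takes the intervals E^s into the intervals E^u (V₁ to V₃, V₃ to V₁, V₄ and
V₅ to themselves), and τ takes E^u back to E^s. Hence a stretch of a u-arc between consecutive
relevant zeros of ν and y, or between such a zero and an end of the arc, goes under σ to an arc with
ends in the E^u; the signs of ν and y tell in which half plane it lies.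

The zeros needed are forced by the intermediate value theorem: the sides at the two ends prescribe
the signs of ν and y there, and ν = x on the axis. This gives, for each type of u-arc, disjoint
stretches whose images are s-arcs of prescribed types (`exists_pieces`). After τ they are u-arcs, so
f acts on the numbers of arcs at least as a 4×4 matrix of zeros and ones, `transition`. For either
sign of b the matrix is primitive and has a positive eigenvector with eigenvalue ρ; its
characteristic polynomial is (x−1)(x³−x²−2x−1). Since f is injective where it matters, images of
distinct arcs stay distinct, and the counts grow at least like ρⁿ. Conjugating by τ gives the same
for s-arcs under f⁻¹.

Arcs of type 4 yield the other two claims. They join {x = 0} to V₃, two disjoint compact sets, so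
each adds a fixed amount to the length (`exists_length_bound_of_arcs`). A 4u-arc starts below a
4s-arc near x = 0 and ends above it near x = 1, so they cross off the Vⱼ (`exists_crossing`, by a
winding number); N arcs of one kind and N' of the other then meet in at least NN' points. -/

namespace PlaneBirational

/-! ### Length from separated points, and crossings from winding numbers. -/

section

/-- A curve that visits finitely many points at mutual distance at least `ε` has length at least
`ε` times their number minus one. -/
theorem card_sub_one_mul_le_eVariationOn {α E : Type*} [LinearOrder α] [PseudoEMetricSpace E]
    (g : α → E) (I : Set α) (F : Finset E) (hF : (F : Set E) ⊆ g '' I) (ε : ℝ≥0∞)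
    (hε : ∀ x ∈ F, ∀ y ∈ F, x ≠ y → ε ≤ edist x y) :
    ((F.card - 1 : ℕ) : ℝ≥0∞) * ε ≤ eVariationOn g I := by
  classical
  have hF' : ∀ x : F, ∃ s ∈ I, g s = x := fun x => hF x.2
  choose r hrI hr using hF'
  have hrinj : Function.Injective r := fun x y h => by
    apply Subtype.ext
    rw [← hr x, ← hr y, h]
  set s : Finset α := Finset.univ.image r with hs
  have hcard : s.card = F.card := by
    rw [hs, Finset.card_image_of_injective _ hrinj]; simp
  have hsI : ∀ x ∈ s, x ∈ I := by
    intro x hx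
    obtain ⟨y, -, rfl⟩ := Finset.mem_image.1 hx
    exact hrI y
  have hdist : ∀ x ∈ s, ∀ y ∈ s, x ≠ y → ε ≤ edist (g x) (g y) := by
    intro x hx y hy hxy
    obtain ⟨x', -, rfl⟩ := Finset.mem_image.1 hx
    obtain ⟨y', -, rfl⟩ := Finset.mem_image.1 hy
    rw [hr, hr]
    refine hε _ x'.2 _ y'.2 fun h => hxy ?_
    rw [Subtype.ext h]
  rcases Nat.eq_zero_or_pos F.card with h0 | hpos
  · simp [h0]
  let e := s.orderEmbOfFin hcard
  have hlt : ∀ i : ℕ, min i (F.card - 1) < F.card := fun i => by omega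
  -- The sorted parameters, with the index frozen at the last one so that the sequence is defined on
  -- all of ℕ.
  let u : ℕ → α := fun i => e ⟨min i (F.card - 1), hlt i⟩
  have hu : Monotone u := by
    intro i j hij
    apply e.monotone
    simp only [Fin.mk_le_mk]
    omega
  have hus : ∀ i, u i ∈ s := fun i => s.orderEmbOfFin_mem hcard _
  calc ((F.card - 1 : ℕ) : ℝ≥0∞) * ε = ∑ i ∈ Finset.range (F.card - 1), ε := by simp
    _ ≤ ∑ i ∈ Finset.range (F.card - 1), edist (g (u (i + 1))) (g (u i)) := by
        refine Finset.sum_le_sum fun i hi => hdist _ (hus _) _ (hus _) fun h => ?_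
        have := congrArg Fin.val (e.injective h)
        simp only [Finset.mem_range] at hi
        simp only at this
        omega
    _ ≤ eVariationOn g I := eVariationOn.sum_le hu fun i => hsI _ (hus i)

/-- A continuous real function cannot leave an interval of length `2π` whose endpoints, and all
their translates by `2π`, it avoids. -/
theorem mem_Ioo_of_avoids {h : ℝ → ℝ} (hh : Continuous h) {p q m : ℝ}
    (h1 : ∀ x ∈ uIcc p q, h x ≠ m) (h2 : ∀ x ∈ uIcc p q, h x ≠ m + 2 * Real.pi)
    (hp : h p ∈ Ioo m (m + 2 * Real.pi)) : h q ∈ Ioo m (m + 2 * Real.pi) := by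
  have key := intermediate_value_uIcc (a := p) (b := q) hh.continuousOn
  by_contra hq
  simp only [mem_Ioo, not_and_or, not_lt] at hq
  rcases hq with hq | hq
  · obtain ⟨x, hx, hxm⟩ := key (mem_uIcc.2 (Or.inr ⟨hq, hp.1.le⟩))
    exact h1 x hx hxm
  · obtain ⟨x, hx, hxm⟩ := key (mem_uIcc.2 (Or.inl ⟨hp.2.le, hq⟩))
    exact h2 x hx hxm

/-- A continuous function on a rectangle that winds around `0` along the boundary vanishes
somewhere. -/
theorem exists_eq_zero_of_winding {F : ℝ × ℝ → ℂ} (hF : Continuous F) {s₀ s₁ t₀ t₁ : ℝ}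
    (hbot : ∀ s ∈ uIcc s₀ s₁, 0 < (F (s, t₀)).re ∨ (F (s, t₀)).im < 0)
    (hright : ∀ t ∈ uIcc t₀ t₁, 0 < (F (s₁, t)).re ∨ 0 < (F (s₁, t)).im)
    (htop : ∀ s ∈ uIcc s₁ s₀, (F (s, t₁)).re < 0 ∨ 0 < (F (s, t₁)).im)
    (hleft : ∀ t ∈ uIcc t₁ t₀, (F (s₀, t)).re < 0 ∨ (F (s₀, t)).im < 0) :
    ∃ x, F x = 0 := by
  by_contra! hne
  let A : C(ℝ × ℝ, Real.Angle) := ⟨fun x => (Complex.arg (F x) : Real.Angle), by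
    refine continuous_iff_continuousAt.2 fun x => ?_
    exact (Complex.continuousAt_arg_coe_angle (hne x)).comp (f := F) hF.continuousAt⟩
  -- The plane is simply connected, so a nowhere zero F has a continuous argument θ. Following θ
  -- around the boundary will show that it gains a full turn.
  obtain ⟨θ, ⟨hθ0, hθ⟩, -⟩ := (AddCircle.isCoveringMap_coe (2 * Real.pi)).existsUnique_continuousMap_lifts
    A (a₀ := (s₀, t₀)) (e₀ := Complex.arg (F (s₀, t₀))) rfl
  have hA : ∀ x, ((θ x : ℝ) : Real.Angle) = (Complex.arg (F x) : Real.Angle) := fun x =>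
    congrFun hθ x
  have hnorm : ∀ x, 0 < ‖F x‖ := fun x => norm_pos_iff.2 (hne x)
  have hcos : ∀ x, (F x).re = ‖F x‖ * Real.cos (θ x) := fun x => by
    have := congrArg Real.Angle.cos (hA x)
    simp only [Real.Angle.cos_coe] at this
    rw [this, Complex.norm_mul_cos_arg]
  have hsin : ∀ x, (F x).im = ‖F x‖ * Real.sin (θ x) := fun x => by
    have := congrArg Real.Angle.sin (hA x)
    simp only [Real.Angle.sin_coe] at this
    rw [this, Complex.norm_mul_sin_arg]
  have hneg : ∀ x r, ‖F x‖ * r < 0 ↔ r < 0 := fun x r =>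
    ⟨fun h => by_contra fun h' => (mul_nonneg (hnorm x).le (not_lt.1 h')).not_gt h,
      fun h => mul_neg_of_pos_of_neg (hnorm x) h⟩
  simp only [hcos, hsin, mul_pos_iff_of_pos_left (hnorm _), hneg]
    at hbot hright htop hleft
  have hπ := Real.pi_pos
  have cq : Real.cos (Real.pi / 4) = √2 / 2 := Real.cos_pi_div_four
  have sq : Real.sin (Real.pi / 4) = √2 / 2 := Real.sin_pi_div_four
  have h2 : 0 < √2 / 2 := by positivity
  have e1 : Real.cos (3 * Real.pi / 4) = -(√2 / 2) := by
    rw [← cq, ← Real.cos_pi_sub]; ring_nf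
  have e2 : Real.sin (3 * Real.pi / 4) = √2 / 2 := by
    rw [← sq, ← Real.sin_pi_sub]; ring_nf
  have e3 : Real.cos (5 * Real.pi / 4) = -(√2 / 2) := by
    rw [← cq, ← Real.cos_add_pi]; ring_nf
  have e4 : Real.sin (5 * Real.pi / 4) = -(√2 / 2) := by
    rw [← sq, ← Real.sin_add_pi]; ring_nf
  have e5 : Real.cos (-(Real.pi / 4)) = √2 / 2 := by rw [Real.cos_neg, cq]
  have e6 : Real.sin (-(Real.pi / 4)) = -(√2 / 2) := by rw [Real.sin_neg, sq]
  have per : ∀ m : ℝ, Real.cos (m + 2 * Real.pi) = Real.cos m ∧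
      Real.sin (m + 2 * Real.pi) = Real.sin m := fun m =>
    ⟨Real.cos_add_two_pi m, Real.sin_add_two_pi m⟩
  -- the four sides
  have c00 : θ (s₀, t₀) ∈ Ioo (-Real.pi) 0 := by
    have him : (F (s₀, t₀)).im < 0 := by
      rw [hsin, hneg]
      rcases hbot s₀ left_mem_uIcc with h | h
      · rcases hleft t₀ right_mem_uIcc with h' | h'
        · linarith
        · exact h'
      · exact h
    have := Complex.arg_neg_iff.2 him
    rw [hθ0]
    exact ⟨Complex.neg_pi_lt_arg _, this⟩
  -- Each side of the rectangle avoids one closed quadrant (second, third, fourth, first, in this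
  -- order). The diagonal direction of that quadrant is a barrier for θ, which confines θ to an
  -- interval of length 2π; the conditions of two adjacent sides then sharpen this at the corner.
  have c10 : θ (s₁, t₀) ∈ Ioo (-(5 * Real.pi / 4)) (-(5 * Real.pi / 4) + 2 * Real.pi) := by
    refine mem_Ioo_of_avoids (h := fun s => θ (s, t₀)) (p := s₀) (by fun_prop) ?_ ?_ ?_
    · intro s hs h
      have := hbot s hs
      rw [h, Real.cos_neg, Real.sin_neg, e3, e4] at this
      rcases this with h | h <;> linarith
    · intro s hs h
      have := hbot s hs
      rw [h, (per _).1, (per _).2, Real.cos_neg, Real.sin_neg, e3, e4] at this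
      rcases this with h | h <;> linarith
    · exact ⟨by linarith [c00.1], by linarith [c00.2]⟩
  have k10 : 0 < Real.cos (θ (s₁, t₀)) := by
    rcases hbot s₁ right_mem_uIcc with h | h
    · exact h
    · rcases hright t₀ left_mem_uIcc with h' | h'
      · exact h'
      · linarith
  have c10' : -(Real.pi / 2) < θ (s₁, t₀) ∧ θ (s₁, t₀) < Real.pi / 2 := by
    constructor
    · by_contra! h
      have := Real.cos_nonpos_of_pi_div_two_le_of_le (x := -θ (s₁, t₀)) (by linarith)
        (by linarith [c10.1])
      rw [Real.cos_neg] at this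
      linarith
    · by_contra! h
      have := Real.cos_nonpos_of_pi_div_two_le_of_le h (by linarith [c10.2])
      linarith
  have c11 : θ (s₁, t₁) ∈ Ioo (-(3 * Real.pi / 4)) (-(3 * Real.pi / 4) + 2 * Real.pi) := by
    refine mem_Ioo_of_avoids (h := fun t => θ (s₁, t)) (p := t₀) (by fun_prop) ?_ ?_ ?_
    · intro s hs h
      have := hright s hs
      rw [h, Real.cos_neg, Real.sin_neg, e1, e2] at this
      rcases this with h | h <;> linarith
    · intro s hs h
      have := hright s hs
      rw [h, (per _).1, (per _).2, Real.cos_neg, Real.sin_neg, e1, e2] at this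
      rcases this with h | h <;> linarith
    · exact ⟨by linarith [c10'.1], by linarith [c10'.2]⟩
  have k11 : 0 < Real.sin (θ (s₁, t₁)) := by
    rcases hright t₁ right_mem_uIcc with h | h
    · rcases htop s₁ left_mem_uIcc with h' | h'
      · linarith
      · exact h'
    · exact h
  have c11' : 0 < θ (s₁, t₁) ∧ θ (s₁, t₁) < Real.pi := by
    constructor
    · by_contra! h
      have := Real.sin_nonpos_of_nonpos_of_neg_pi_le h (by linarith [c11.1])
      linarith
    · by_contra! h
      have := Real.sin_nonneg_of_nonneg_of_le_pi (x := θ (s₁, t₁) - Real.pi) (by linarith)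
        (by linarith [c11.2])
      rw [Real.sin_sub_pi] at this
      linarith
  have c01 : θ (s₀, t₁) ∈ Ioo (-(Real.pi / 4)) (-(Real.pi / 4) + 2 * Real.pi) := by
    refine mem_Ioo_of_avoids (h := fun s => θ (s, t₁)) (p := s₁) (by fun_prop) ?_ ?_ ?_
    · intro s hs h
      have := htop s hs
      rw [h, e5, e6] at this
      rcases this with h | h <;> linarith
    · intro s hs h
      have := htop s hs
      rw [h, (per _).1, (per _).2, e5, e6] at this
      rcases this with h | h <;> linarith
    · exact ⟨by linarith [c11'.1], by linarith [c11'.2]⟩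
  have k01 : Real.cos (θ (s₀, t₁)) < 0 := by
    rcases htop s₀ right_mem_uIcc with h | h
    · exact h
    · rcases hleft t₁ left_mem_uIcc with h' | h'
      · exact h'
      · linarith
  have c01' : Real.pi / 2 < θ (s₀, t₁) ∧ θ (s₀, t₁) < 3 * Real.pi / 2 := by
    constructor
    · by_contra! h
      have := Real.cos_nonneg_of_mem_Icc (x := θ (s₀, t₁)) ⟨by linarith [c01.1], h⟩
      linarith
    · by_contra! h
      have := Real.cos_nonneg_of_mem_Icc (x := θ (s₀, t₁) - 2 * Real.pi)
        ⟨by linarith, by linarith [c01.2]⟩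
      rw [Real.cos_sub_two_pi] at this
      linarith
  have c00' : θ (s₀, t₀) ∈ Ioo (Real.pi / 4) (Real.pi / 4 + 2 * Real.pi) := by
    refine mem_Ioo_of_avoids (h := fun t => θ (s₀, t)) (p := t₁) (by fun_prop) ?_ ?_ ?_
    · intro s hs h
      have := hleft s hs
      rw [h, cq, sq] at this
      rcases this with h | h <;> linarith
    · intro s hs h
      have := hleft s hs
      rw [h, (per _).1, (per _).2, cq, sq] at this
      rcases this with h | h <;> linarith
    · exact ⟨by linarith [c01'.1], by linarith [c01'.2]⟩
  -- Back at the first corner θ would exceed π/4, but it was negative there.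
  linarith [c00.2, c00'.1]

/-- Two plane paths whose difference winds around `0` along the boundary of the parameter rectangle
meet. -/
theorem exists_eq_of_winding {α β : ℝ → ℝ × ℝ} {s₀ s₁ t₀ t₁ : ℝ} (hs : s₀ ≤ s₁) (ht : t₀ ≤ t₁)
    (hα : ContinuousOn α (Icc s₀ s₁)) (hβ : ContinuousOn β (Icc t₀ t₁))
    (hbot : ∀ s ∈ Icc s₀ s₁, (β t₀).1 < (α s).1 ∨ (α s).2 < (β t₀).2)
    (hright : ∀ t ∈ Icc t₀ t₁, (β t).1 < (α s₁).1 ∨ (β t).2 < (α s₁).2)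
    (htop : ∀ s ∈ Icc s₀ s₁, (α s).1 < (β t₁).1 ∨ (β t₁).2 < (α s).2)
    (hleft : ∀ t ∈ Icc t₀ t₁, (α s₀).1 < (β t).1 ∨ (α s₀).2 < (β t).2) :
    ∃ s ∈ Icc s₀ s₁, ∃ t ∈ Icc t₀ t₁, α s = β t := by
  -- Clamping the parameters extends the paths to the whole line, as the winding lemma needs a
  -- function on the whole plane.
  have hα' : Continuous (fun s => α (projIcc s₀ s₁ hs s)) :=
    (continuousOn_iff_continuous_domRestrict.1 hα).comp continuous_projIcc
  have hβ' : Continuous (fun s => β (projIcc t₀ t₁ ht s)) :=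
    (continuousOn_iff_continuous_domRestrict.1 hβ).comp continuous_projIcc
  let D : ℝ × ℝ → ℝ × ℝ := fun x => α (projIcc s₀ s₁ hs x.1) - β (projIcc t₀ t₁ ht x.2)
  have hD : Continuous D := (hα'.comp continuous_fst).sub (hβ'.comp continuous_snd)
  have hs' := uIcc_of_le hs
  have ht' := uIcc_of_le ht
  obtain ⟨x, hx⟩ := exists_eq_zero_of_winding (F := fun x => Complex.equivRealProdCLM.symm (D x))
    (s₀ := s₀) (s₁ := s₁) (t₀ := t₀) (t₁ := t₁)
    (Complex.equivRealProdCLM.symm.continuous.comp hD) (by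
      intro s h
      rw [hs'] at h
      simpa [D, projIcc_of_mem hs h, projIcc_left] using hbot s h) (by
      intro s h
      rw [ht'] at h
      simpa [D, projIcc_of_mem ht h, projIcc_right] using hright s h) (by
      intro s h
      rw [uIcc_comm, hs'] at h
      simpa [D, projIcc_of_mem hs h, projIcc_right] using htop s h) (by
      intro s h
      rw [uIcc_comm, ht'] at h
      simpa [D, projIcc_of_mem ht h, projIcc_left] using hleft s h)
  refine ⟨_, (projIcc s₀ s₁ hs x.1).2, _, (projIcc t₀ t₁ ht x.2).2, ?_⟩
  have : D x = 0 := by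
    simpa using hx
  exact sub_eq_zero.1 this

end

/-! ### The plane in the surface, arcs as closures of plane paths, and extension by limits. -/

section

variable {b : ℝ}

/-! ### The plane inside the surface -/

theorem tendsto_coe_infty_of_abs {ι : Type*} {l : Filter ι} {h : ι → ℝ}
    (hh : Tendsto (fun s => |h s|) l atTop) :
    Tendsto (fun s => (h s : OnePoint ℝ)) l (𝓝 OnePoint.infty) := by
  have : Tendsto h l (coclosedCompact ℝ) := by
    rw [coclosedCompact_eq_cocompact, ← Metric.cobounded_eq_cocompact,
      ← tendsto_norm_atTop_iff_cobounded]
    exact hh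
  exact OnePoint.tendsto_coe_infty.comp this

theorem tendsto_coe_coe {ι : Type*} {l : Filter ι} {h : ι → ℝ} {x : ℝ}
    (hh : Tendsto h l (𝓝 x)) : Tendsto (fun s => (h s : OnePoint ℝ)) l (𝓝 (x : OnePoint ℝ)) :=
  (OnePoint.continuous_coe.tendsto x).comp hh

theorem continuous_coords : Continuous (coords b) := by
  unfold coords
  have h : Continuous fun p : ℝ × ℝ => (p.1 - 1) * p.2 / (1 + p.1 ^ 2) :=
    Continuous.div (by fun_prop) (by fun_prop) fun p => by positivity
  have := OnePoint.continuous_coe (X := ℝ)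
  fun_prop

theorem continuous_incl : Continuous (incl b) :=
  continuous_coords.subtype_mk _

/-- The first two coordinates recover the point of the plane, so the plane carries the topology
induced from the surface. In particular the plane path inside a continuous arc is continuous. -/
theorem comap_incl_le (w : ℝ × ℝ) : comap (incl b) (𝓝 (incl b w)) ≤ 𝓝 w := by
  have e1 : Continuous fun P : XR b => P.1.1 := by fun_prop
  have e2 : Continuous fun P : XR b => P.1.2.1 := by fun_prop
  have t1 := (e1.tendsto (incl b w)).comp (tendsto_comap (f := incl b))
  have t2 := (e2.tendsto (incl b w)).comp (tendsto_comap (f := incl b))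
  have h1 : Tendsto (Prod.fst : ℝ × ℝ → ℝ) (comap (incl b) (𝓝 (incl b w))) (𝓝 w.1) :=
    OnePoint.isOpenEmbedding_coe.isInducing.tendsto_nhds_iff.2 t1
  have h2 : Tendsto (Prod.snd : ℝ × ℝ → ℝ) (comap (incl b) (𝓝 (incl b w))) (𝓝 w.2) :=
    OnePoint.isOpenEmbedding_coe.isInducing.tendsto_nhds_iff.2 t2
  exact h1.prodMk_nhds h2

theorem incl_injective : Function.Injective (incl b) := by
  intro v w h
  have h := congrArg Subtype.val h
  simp only [incl, coords, Prod.mk.injEq, OnePoint.coe_eq_coe] at h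
  exact Prod.ext h.1 h.2.1

theorem incl_mem_curvesV_iff {w : ℝ × ℝ} : incl b w ∈ curvesV b ↔ w.1 = 0 := by
  simp only [curvesV, mem_compl_iff, incl_injective.mem_set_image, mem_ofPred_eq, not_not]

theorem continuousAt_of_incl {ι : Type*} [TopologicalSpace ι] {c : ι → ℝ × ℝ} {s : ι}
    (h : ContinuousAt (fun s => incl b (c s)) s) : ContinuousAt c s :=
  Tendsto.mono_right (tendsto_comap_iff.2 (show Tendsto (incl b ∘ c) (𝓝 s) (𝓝 (incl b (c s))) from h))
    (comap_incl_le (c s))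

/-- The points of the surface on the side `v`, in terms of the coordinates that tell apart
different sides. -/
def sideSet (b : ℝ) : Side → Set (XR b)
  | .V1 => {P | P.1.1 = ((0 : ℝ) : OnePoint ℝ)}
  | .V3top => {P | P.1.1 = ((1 : ℝ) : OnePoint ℝ) ∧ P.1.2.1 = OnePoint.infty}
  | .V3bot => {P | P.1.1 = ((1 : ℝ) : OnePoint ℝ) ∧ P.1.2.1 = OnePoint.infty}
  | .V4 => {P | P.1.1 = OnePoint.infty ∧ P.1.2.2.2 = ((0 : ℝ) : OnePoint ℝ)}
  | .V5 => {P | P.1.1 = OnePoint.infty ∧ P.1.2.2.2 = ((b : ℝ) : OnePoint ℝ)}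

theorem sideSet_subset_curvesV (v : Side) : sideSet b v ⊆ curvesV b := by
  rintro P hP ⟨w, hw, rfl⟩
  cases v <;> simp only [sideSet, incl, coords, mem_ofPred_eq, OnePoint.coe_eq_coe,
    OnePoint.coe_ne_infty, and_false, false_and] at hP
  exact hw hP

theorem tendsto_inv_of_abs {ι : Type*} {l : Filter ι} {h : ι → ℝ}
    (hh : Tendsto (fun s => |h s|) l atTop) : Tendsto (fun s => (h s)⁻¹) l (𝓝 0) :=
  tendsto_inv₀_cobounded.comp (tendsto_norm_atTop_iff_cobounded.1 hh)

theorem eventually_ne_of_abs {ι : Type*} {l : Filter ι} {h : ι → ℝ}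
    (hh : Tendsto (fun s => |h s|) l atTop) : ∀ᶠ s in l, h s ≠ 0 := by
  filter_upwards [hh.eventually_gt_atTop 0] with s hs
  exact abs_pos.1 hs

/-- The last coordinate is (y/x)·(1 − 1/x)/(1/x² + 1). Hence at |x| = ∞ it is the slope, which
separates V₄ from V₅. -/
theorem tendsto_last_coord {ι : Type*} {l : Filter ι} {c : ι → ℝ × ℝ} {m : ℝ}
    (h1 : Tendsto (fun s => |(c s).1|) l atTop)
    (h2 : Tendsto (fun s => (c s).2 / (c s).1) l (𝓝 m)) :
    Tendsto (fun s => ((c s).1 - 1) * (c s).2 / (1 + (c s).1 ^ 2)) l (𝓝 m) := by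
  have hz := tendsto_inv_of_abs h1
  have : Tendsto (fun s => (c s).2 / (c s).1 * ((1 - (c s).1⁻¹) / ((c s).1⁻¹ ^ 2 + 1))) l
      (𝓝 (m * ((1 - 0) / (0 ^ 2 + 1)))) :=
    h2.mul ((hz.const_sub 1).div ((hz.pow 2).add_const 1) (by norm_num))
  simp only [sub_zero, ne_eq, OfNat.ofNat_ne_zero, not_false_eq_true, zero_pow, zero_add, div_one,
    mul_one] at this
  refine this.congr' ?_
  filter_upwards [eventually_ne_of_abs h1] with s hs
  have : 1 + (c s).1 ^ 2 ≠ 0 := by positivity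
  field_simp

theorem mem_sideSet_of_approaches {l : Filter ℝ} [l.NeBot] {c : ℝ → ℝ × ℝ} {v : Side} {t : EReal}
    (h : Approaches b l c v t) {P : XR b} (hP : Tendsto (fun s => incl b (c s)) l (𝓝 P)) :
    P ∈ sideSet b v := by
  have e1 : Tendsto (fun s => ((c s).1 : OnePoint ℝ)) l (𝓝 P.1.1) :=
    ((by fun_prop : Continuous fun P : XR b => P.1.1).tendsto P).comp hP
  have e2 : Tendsto (fun s => ((c s).2 : OnePoint ℝ)) l (𝓝 P.1.2.1) :=
    ((by fun_prop : Continuous fun P : XR b => P.1.2.1).tendsto P).comp hP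
  have e4 : Tendsto (fun s => ((((c s).1 - 1) * (c s).2 / (1 + (c s).1 ^ 2) : ℝ) : OnePoint ℝ)) l
      (𝓝 P.1.2.2.2) :=
    ((by fun_prop : Continuous fun P : XR b => P.1.2.2.2).tendsto P).comp hP
  cases v with
  | V1 => exact tendsto_nhds_unique e1 (tendsto_coe_coe h.1)
  | V3top =>
    exact ⟨tendsto_nhds_unique e1 (tendsto_coe_coe h.2.1),
      tendsto_nhds_unique e2 (tendsto_coe_infty_of_abs (tendsto_abs_atTop_atTop.comp h.1))⟩
  | V3bot =>
    exact ⟨tendsto_nhds_unique e1 (tendsto_coe_coe h.2.1),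
      tendsto_nhds_unique e2 (tendsto_coe_infty_of_abs (tendsto_abs_atBot_atTop.comp h.1))⟩
  | V4 =>
    exact ⟨tendsto_nhds_unique e1 (tendsto_coe_infty_of_abs h.1),
      tendsto_nhds_unique e4 (tendsto_coe_coe (tendsto_last_coord h.1 h.2.1))⟩
  | V5 =>
    exact ⟨tendsto_nhds_unique e1 (tendsto_coe_infty_of_abs h.1),
      tendsto_nhds_unique e4 (tendsto_coe_coe (tendsto_last_coord h.1 h.2.1))⟩

theorem Approaches.comp {l l' : Filter ℝ} {c : ℝ → ℝ × ℝ} {v : Side} {t : EReal} {φ : ℝ → ℝ}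
    (h : Approaches b l c v t) (hφ : Tendsto φ l' l) :
    Approaches b l' (fun s => c (φ s)) v t := by
  cases v with
  | V1 => exact ⟨h.1.comp hφ, h.2.comp hφ⟩
  | V3top => exact ⟨h.1.comp hφ, h.2.1.comp hφ, h.2.2.comp hφ⟩
  | V3bot => exact ⟨h.1.comp hφ, h.2.1.comp hφ, h.2.2.comp hφ⟩
  | V4 => exact ⟨h.1.comp hφ, h.2.1.comp hφ, h.2.2.comp hφ⟩
  | V5 => exact ⟨h.1.comp hφ, h.2.1.comp hφ, h.2.2.comp hφ⟩

/-! ### Paths in the half planes and arcs in the surface -/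

/-- The path `c`, defined between the parameters `p` and `q`, is the interior of an arc of type `T`,
traversed in either direction. -/
def IsPath (b : ℝ) (E : Side → Set EReal) (T : ArcType) (c : ℝ → ℝ × ℝ) (p q : ℝ) : Prop :=
  ContinuousOn c (Ioo p q) ∧ InjOn c (Ioo p q) ∧ (∀ s ∈ Ioo p q, c s ∈ T.half) ∧
  ∃ v ∈ T.source, ∃ t ∈ E v, ∃ w ∈ T.target, ∃ t' ∈ E w,
    (Approaches b (𝓝[>] p) c v t ∧ Approaches b (𝓝[<] q) c w t') ∨
    (Approaches b (𝓝[<] q) c v t ∧ Approaches b (𝓝[>] p) c w t')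

/-- Arcs of type `T` avoid the curves `Vⱼ` in their interior and have different endpoints. -/
structure ArcType.IsProper (b : ℝ) (T : ArcType) : Prop where
  half_ne : ∀ w ∈ T.half, w.1 ≠ 0
  disjoint : ∀ v ∈ T.source, ∀ w ∈ T.target, Disjoint (sideSet b v) (sideSet b w)

/-- Only injectivity at the ends is at stake: the endpoints lie on disjoint sides, hence differ, and
they lie on the Vⱼ, which the interior avoids. An affine change of parameter, increasing or
decreasing, brings the source to 0. -/
theorem isArcOfType_of_isPath {E : Side → Set EReal} {T : ArcType} (hT : T.IsProper b)
    {β : ℝ → XR b} {c : ℝ → ℝ × ℝ} {p q : ℝ} (hpq : p < q) (hβ : ContinuousOn β (Icc p q))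
    (hβc : ∀ s ∈ Ioo p q, β s = incl b (c s)) (hc : IsPath b E T c p q) :
    IsArcOfType b E T (β '' Icc p q) ∧ β p ∈ curvesV b ∧ β q ∈ curvesV b := by
  obtain ⟨hcont, hinj, hhalf, v, hv, t, ht, w, hw, t', ht', happ⟩ := hc
  have hp : Tendsto (fun s => incl b (c s)) (𝓝[>] p) (𝓝 (β p)) := by
    have h1 : Tendsto β (𝓝[>] p) (𝓝 (β p)) :=
      ((hβ p (left_mem_Icc.2 hpq.le)).mono Ioo_subset_Icc_self).mono_left
        (nhdsWithin_Ioo_eq_nhdsGT hpq).ge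
    refine h1.congr' ?_
    filter_upwards [Ioo_mem_nhdsGT hpq] with s hs using hβc s hs
  have hq : Tendsto (fun s => incl b (c s)) (𝓝[<] q) (𝓝 (β q)) := by
    have h1 : Tendsto β (𝓝[<] q) (𝓝 (β q)) :=
      ((hβ q (right_mem_Icc.2 hpq.le)).mono Ioo_subset_Icc_self).mono_left
        (nhdsWithin_Ioo_eq_nhdsLT hpq).ge
    refine h1.congr' ?_
    filter_upwards [Ioo_mem_nhdsLT hpq] with s hs using hβc s hs
  have hends : β p ∈ curvesV b ∧ β q ∈ curvesV b ∧ β p ≠ β q := by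
    have hd := hT.disjoint v hv w hw
    rcases happ with ⟨h1, h2⟩ | ⟨h1, h2⟩
    · have m1 := mem_sideSet_of_approaches h1 hp
      have m2 := mem_sideSet_of_approaches h2 hq
      exact ⟨sideSet_subset_curvesV _ m1, sideSet_subset_curvesV _ m2, fun h =>
        disjoint_left.1 hd m1 (h ▸ m2)⟩
    · have m1 := mem_sideSet_of_approaches h1 hq
      have m2 := mem_sideSet_of_approaches h2 hp
      exact ⟨sideSet_subset_curvesV _ m2, sideSet_subset_curvesV _ m1, fun h =>
        disjoint_left.1 hd m1 (h ▸ m2)⟩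
  have hint : ∀ s ∈ Ioo p q, β s ∉ curvesV b := fun s hs => by
    rw [hβc s hs, incl_mem_curvesV_iff]
    exact hT.half_ne _ (hhalf s hs)
  have cases_Icc : ∀ s ∈ Icc p q, s = p ∨ s = q ∨ s ∈ Ioo p q := fun s hs => by
    rcases hs.1.eq_or_lt with h | h
    · exact Or.inl h.symm
    · rcases hs.2.eq_or_lt with h' | h'
      · exact Or.inr (Or.inl h')
      · exact Or.inr (Or.inr ⟨h, h'⟩)
  have hβinj : InjOn β (Icc p q) := by
    intro s hs s' hs' h
    rcases cases_Icc s hs with h1 | h1 | h1 <;> rcases cases_Icc s' hs' with h2 | h2 | h2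
    · rw [h1, h2]
    · rw [h1, h2] at h; exact absurd h hends.2.2
    · rw [h1] at h; exact absurd (h ▸ hends.1) (hint _ h2)
    · rw [h1, h2] at h; exact absurd h.symm hends.2.2
    · rw [h1, h2]
    · rw [h1] at h; exact absurd (h ▸ hends.2.1) (hint _ h2)
    · rw [h2] at h; exact absurd (h ▸ hends.1) (hint _ h1)
    · rw [h2] at h; exact absurd (h ▸ hends.2.1) (hint _ h1)
    · rw [hβc _ h1, hβc _ h2] at h
      exact hinj h1 h2 (incl_injective h)
  have hd : 0 < q - p := sub_pos.2 hpq
  refine ⟨?_, hends.1, hends.2.1⟩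
  rcases happ with ⟨h1, h2⟩ | ⟨h1, h2⟩
  · have hφ : (fun s : ℝ => (q - p) * s + p) '' Icc 0 1 = Icc p q := by
      rw [image_affine_Icc' hd]; simp
    have hφo : ∀ s ∈ Ioo (0 : ℝ) 1, (q - p) * s + p ∈ Ioo p q := fun s hs =>
      ⟨by nlinarith [hs.1], by nlinarith [hs.2]⟩
    have hφm : MapsTo (fun s : ℝ => (q - p) * s + p) (Icc 0 1) (Icc p q) :=
      mapsTo_iff_image_subset.2 hφ.subset
    refine ⟨fun s => β ((q - p) * s + p), fun s => c ((q - p) * s + p),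
      hβ.comp (by fun_prop) hφm, hβinj.comp (fun x _ y _ h => ?_) hφm, ?_,
      fun s hs => ⟨hhalf _ (hφo s hs), hβc _ (hφo s hs)⟩,
      ⟨v, hv, t, ht, h1.comp ?_⟩, ⟨w, hw, t', ht', h2.comp ?_⟩⟩
    · simpa [hd.ne'] using h
    · rw [← image_image β, hφ]
    · refine tendsto_nhdsWithin_iff.2 ⟨?_, ?_⟩
      · have : Continuous fun s : ℝ => (q - p) * s + p := by fun_prop
        have := this.tendsto 0
        simp only [mul_zero, zero_add] at this
        exact this.mono_left nhdsWithin_le_nhds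
      · filter_upwards [Ioo_mem_nhdsGT one_pos] with s hs using (hφo s hs).1
    · refine tendsto_nhdsWithin_iff.2 ⟨?_, ?_⟩
      · have : Continuous fun s : ℝ => (q - p) * s + p := by fun_prop
        have := this.tendsto 1
        simp only [mul_one, sub_add_cancel] at this
        exact this.mono_left nhdsWithin_le_nhds
      · filter_upwards [Ioo_mem_nhdsLT one_pos] with s hs using (hφo s hs).2
  · have hφ : (fun s : ℝ => q - (q - p) * s) '' Icc 0 1 = Icc p q := by
      rw [← image_image (fun s => q - s) (fun s => (q - p) * s), image_mul_left_Icc' hd]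
      simp
    have hφo : ∀ s ∈ Ioo (0 : ℝ) 1, q - (q - p) * s ∈ Ioo p q := fun s hs =>
      ⟨by nlinarith [hs.2], by nlinarith [hs.1]⟩
    have hφm : MapsTo (fun s : ℝ => q - (q - p) * s) (Icc 0 1) (Icc p q) :=
      mapsTo_iff_image_subset.2 hφ.subset
    refine ⟨fun s => β (q - (q - p) * s), fun s => c (q - (q - p) * s),
      hβ.comp (by fun_prop) hφm, hβinj.comp (fun x _ y _ h => ?_) hφm, ?_,
      fun s hs => ⟨hhalf _ (hφo s hs), hβc _ (hφo s hs)⟩,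
      ⟨v, hv, t, ht, h1.comp ?_⟩, ⟨w, hw, t', ht', h2.comp ?_⟩⟩
    · simpa [hd.ne'] using h
    · rw [← image_image β, hφ]
    · refine tendsto_nhdsWithin_iff.2 ⟨?_, ?_⟩
      · have : Continuous fun s : ℝ => q - (q - p) * s := by fun_prop
        have := this.tendsto 0
        simp only [mul_zero, sub_zero] at this
        exact this.mono_left nhdsWithin_le_nhds
      · filter_upwards [Ioo_mem_nhdsGT one_pos] with s hs using (hφo s hs).2
    · refine tendsto_nhdsWithin_iff.2 ⟨?_, ?_⟩
      · have : Continuous fun s : ℝ => q - (q - p) * s := by fun_prop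
        have := this.tendsto 1
        simp only [mul_one, sub_sub_cancel] at this
        exact this.mono_left nhdsWithin_le_nhds
      · filter_upwards [Ioo_mem_nhdsLT one_pos] with s hs using (hφo s hs).1

/-! ### Extension of a plane map to the surface -/

variable {D : Set (ℝ × ℝ)} {g : ℝ × ℝ → ℝ × ℝ}

theorem tendsto_extend {p : XR b} (hp : p ∉ indet b D g) {l : Filter ℝ} [l.NeBot] {c : ℝ → ℝ × ℝ}
    (hc : Tendsto (fun s => incl b (c s)) l (𝓝 p)) (hD : ∀ᶠ s in l, c s ∈ D) :
    Tendsto (fun s => incl b (g (c s))) l (𝓝 (extend b D g p)) := by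
  simp only [indet, mem_ofPred_eq, not_not] at hp
  have hl : Tendsto c l (comap (incl b) (𝓝 p) ⊓ 𝓟 D) :=
    tendsto_inf.2 ⟨tendsto_comap_iff.2 hc, tendsto_principal.2 hD⟩
  exact (tendsto_nhds_limUnder hp).comp hl

theorem extend_incl {w : ℝ × ℝ} (hw : w ∈ D) (hg : ContinuousAt g w) :
    extend b D g (incl b w) = incl b (g w) := by
  have hne : (comap (incl b) (𝓝 (incl b w)) ⊓ 𝓟 D).NeBot := by
    refine NeBot.mono (pure_neBot (a := w)) (le_inf ?_ ?_)
    · rw [← map_le_iff_le_comap, map_pure]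
      exact pure_le_nhds _
    · rwa [le_principal_iff, mem_pure]
  refine Tendsto.limUnder_eq ?_
  exact ((continuous_incl.tendsto _).comp hg).mono_left
    (inf_le_left.trans (comap_incl_le w))

/-- If the plane map `g` takes a part of the interior of an arc to the interior of an arc of type
`T`, then its extension takes the closed part to such an arc. -/
theorem isArcOfType_extend {E : Side → Set EReal} {T : ArcType} (hT : T.IsProper b)
    (hg : ∀ w ∈ D, ContinuousAt g w) {α : ℝ → XR b} {c : ℝ → ℝ × ℝ} {p q : ℝ} (hpq : p < q)
    (hα : ContinuousOn α (Icc p q)) (hαc : ∀ s ∈ Ioo p q, α s = incl b (c s))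
    (hind : ∀ s ∈ Icc p q, α s ∉ indet b D g) (hD : ∀ s ∈ Ioo p q, c s ∈ D)
    (hc : IsPath b E T (fun s => g (c s)) p q) :
    IsArcOfType b E T (extend b D g '' (α '' Icc p q)) ∧
      extend b D g (α p) ∈ curvesV b ∧ extend b D g (α q) ∈ curvesV b := by
  have hint : ∀ s ∈ Ioo p q, extend b D g (α s) = incl b (g (c s)) := fun s hs => by
    rw [hαc s hs, extend_incl (hD s hs) (hg _ (hD s hs))]
  rw [image_image]
  -- What remains is continuity along the arc. At the two ends it comes from limits along the path
  -- inside D; in between, from the plane formula.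
  refine isArcOfType_of_isPath (β := fun s => extend b D g (α s)) hT hpq ?_ hint hc
  have hp : Tendsto (fun s => extend b D g (α s)) (𝓝[>] p) (𝓝 (extend b D g (α p))) := by
    have hev := Ioo_mem_nhdsGT hpq
    refine (tendsto_extend (c := c) (hind p (left_mem_Icc.2 hpq.le)) ?_ ?_).congr' ?_
    · have h1 : Tendsto α (𝓝[>] p) (𝓝 (α p)) :=
        ((hα p (left_mem_Icc.2 hpq.le)).mono Ioo_subset_Icc_self).mono_left
          (nhdsWithin_Ioo_eq_nhdsGT hpq).ge
      refine h1.congr' ?_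
      filter_upwards [hev] with s hs using hαc s hs
    · filter_upwards [hev] with s hs using hD s hs
    · filter_upwards [hev] with s hs using (hint s hs).symm
  have hq : Tendsto (fun s => extend b D g (α s)) (𝓝[<] q) (𝓝 (extend b D g (α q))) := by
    have hev := Ioo_mem_nhdsLT hpq
    refine (tendsto_extend (c := c) (hind q (right_mem_Icc.2 hpq.le)) ?_ ?_).congr' ?_
    · have h1 : Tendsto α (𝓝[<] q) (𝓝 (α q)) :=
        ((hα q (right_mem_Icc.2 hpq.le)).mono Ioo_subset_Icc_self).mono_left
          (nhdsWithin_Ioo_eq_nhdsLT hpq).ge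
      refine h1.congr' ?_
      filter_upwards [hev] with s hs using hαc s hs
    · filter_upwards [hev] with s hs using hD s hs
    · filter_upwards [hev] with s hs using (hint s hs).symm
  intro s hs
  rcases hs.1.eq_or_lt with h | h
  · subst h
    exact (continuousWithinAt_Ioi_iff_Ici.1 hp).mono Icc_subset_Ici_self
  rcases hs.2.eq_or_lt with h' | h'
  · subst h'
    exact (continuousWithinAt_Iio_iff_Iic.1 hq).mono Icc_subset_Iic_self
  have hcs : ContinuousAt (fun s => incl b (g (c s))) s := by
    have h1 : ContinuousAt (fun s => g (c s)) s :=
      (hc.1 s ⟨h, h'⟩).continuousAt (Ioo_mem_nhds h h')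
    exact continuous_incl.continuousAt.comp h1
  refine (hcs.congr ?_).continuousWithinAt
  filter_upwards [Ioo_mem_nhds h h'] with s hs using (hint s hs).symm

/-- The interior of an arc is a path. -/
theorem IsArcOfType.exists_path {E : Side → Set EReal} {T : ArcType} {A : Set (XR b)}
    (h : IsArcOfType b E T A) : ∃ (α : ℝ → XR b) (c : ℝ → ℝ × ℝ), ContinuousOn α (Icc 0 1) ∧
      α '' Icc 0 1 = A ∧ (∀ s ∈ Ioo (0 : ℝ) 1, α s = incl b (c s)) ∧
      ContinuousOn c (Ioo 0 1) ∧ InjOn c (Ioo 0 1) ∧ (∀ s ∈ Ioo (0 : ℝ) 1, c s ∈ T.half) ∧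
      (∃ v ∈ T.source, ∃ t ∈ E v, Approaches b (𝓝[>] 0) c v t) ∧
      (∃ v ∈ T.target, ∃ t ∈ E v, Approaches b (𝓝[<] 1) c v t) := by
  obtain ⟨α, c, h1, h2, h3, h4, h5, h6⟩ := h
  refine ⟨α, c, h1, h3, fun s hs => (h4 s hs).2, ?_, ?_, fun s hs => (h4 s hs).1, h5, h6⟩
  · intro s hs
    have hn := Ioo_mem_nhds hs.1 hs.2
    have : ContinuousAt α s := (h1 s ⟨hs.1.le, hs.2.le⟩).continuousAt
      (mem_of_superset hn Ioo_subset_Icc_self)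
    refine (continuousAt_of_incl (b := b) (this.congr ?_)).continuousWithinAt
    filter_upwards [hn] with s hs using (h4 s hs).2
  · intro s hs s' hs' h
    refine h2 ⟨hs.1.le, hs.2.le⟩ ⟨hs'.1.le, hs'.2.le⟩ ?_
    rw [(h4 s hs).2, (h4 s' hs').2, h]

/-- V₄ and V₅ are told apart by the last coordinate, 0 or b, hence b ≠ 0. The two copies of V₃ are
the same subset of the surface and have to be excluded. -/
theorem disjoint_sideSet (hb : b ≠ 0) {v w : Side} (hvw : v ≠ w)
    (h3 : ¬(v = .V3top ∧ w = .V3bot)) (h3' : ¬(v = .V3bot ∧ w = .V3top)) :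
    Disjoint (sideSet b v) (sideSet b w) := by
  have h01 : ((0 : ℝ) : OnePoint ℝ) ≠ ((1 : ℝ) : OnePoint ℝ) := by simp
  have h0b : ((0 : ℝ) : OnePoint ℝ) ≠ ((b : ℝ) : OnePoint ℝ) := by simpa using hb.symm
  have h0 := OnePoint.coe_ne_infty (0 : ℝ)
  have h1 := OnePoint.coe_ne_infty (1 : ℝ)
  refine disjoint_left.2 fun P hv hw => ?_
  cases v <;> cases w <;> simp only [sideSet, mem_ofPred_eq] at hv hw <;>
    simp only [ne_eq, not_true_eq_false, and_self] at hvw h3 h3' <;> grind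

theorem uType_isProper (hb : b ≠ 0) (j : Fin 4) : (uType b j).IsProper b := by
  have hl : ∀ w ∈ leftHalf, w.1 ≠ 0 := fun w hw => (show w.1 < 0 from hw).ne
  have hr : ∀ w ∈ rightHalf, w.1 ≠ 0 := fun w hw => (show 0 < w.1 from hw).ne'
  unfold uType
  split_ifs <;> fin_cases j <;> refine ⟨by assumption, ?_⟩ <;>
    simp only [mem_singleton_iff, mem_insert_iff, forall_eq_or_imp, forall_eq] <;>
    first
    | exact disjoint_sideSet hb (by simp) (by simp) (by simp)
    | exact ⟨disjoint_sideSet hb (by simp) (by simp) (by simp),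
        disjoint_sideSet hb (by simp) (by simp) (by simp)⟩

theorem sType_isProper (hb : b ≠ 0) (j : Fin 4) : (sType b j).IsProper b := by
  have hl : ∀ w ∈ leftHalf, w.1 ≠ 0 := fun w hw => (show w.1 < 0 from hw).ne
  have hr : ∀ w ∈ rightHalf, w.1 ≠ 0 := fun w hw => (show 0 < w.1 from hw).ne'
  unfold sType
  split_ifs <;> fin_cases j <;> refine ⟨by assumption, ?_⟩ <;>
    simp only [mem_singleton_iff, mem_insert_iff, forall_eq_or_imp, forall_eq] <;>
    first
    | exact disjoint_sideSet hb (by simp) (by simp) (by simp)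
    | exact ⟨disjoint_sideSet hb (by simp) (by simp) (by simp),
        disjoint_sideSet hb (by simp) (by simp) (by simp)⟩

end

/-! ### The involutions σ and τ at the sides of the half planes. -/

section

variable {a b : ℝ}

/-! ### Limits in the extended reals -/

theorem tendsto_coe_sub {ι : Type*} {l : Filter ι} {r h : ι → ℝ} {r₀ : ℝ} {t : EReal}
    (hr : Tendsto r l (𝓝 r₀)) (hh : Tendsto (fun s => (h s : EReal)) l (𝓝 t)) :
    Tendsto (fun s => ((r s - h s : ℝ) : EReal)) l (𝓝 ((r₀ : EReal) - t)) := by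
  have h1 : Tendsto (fun s => (r s : EReal)) l (𝓝 (r₀ : EReal)) :=
    (continuous_coe_real_ereal.tendsto r₀).comp hr
  have h2 : Tendsto (fun s => -(h s : EReal)) l (𝓝 (-t)) := (continuous_neg.tendsto t).comp hh
  have := (EReal.continuousAt_add (p := ((r₀ : EReal), -t)) (Or.inl (EReal.coe_ne_top _))
    (Or.inl (EReal.coe_ne_bot _))).tendsto.comp (h1.prodMk_nhds h2)
  simpa only [Function.comp_def, sub_eq_add_neg, EReal.coe_add, EReal.coe_neg] using this

theorem tendsto_coe_mul {ι : Type*} {l : Filter ι} {r h : ι → ℝ} {t : EReal}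
    (hr : Tendsto r l (𝓝 1)) (hh : Tendsto (fun s => (h s : EReal)) l (𝓝 t)) :
    Tendsto (fun s => ((r s * h s : ℝ) : EReal)) l (𝓝 t) := by
  have h1 : Tendsto (fun s => (r s : EReal)) l (𝓝 ((1 : ℝ) : EReal)) :=
    (continuous_coe_real_ereal.tendsto _).comp hr
  have h10 : ((1 : ℝ) : EReal) ≠ 0 := by norm_num
  have := (EReal.continuousAt_mul (p := (((1 : ℝ) : EReal), t)) (Or.inl h10) (Or.inl h10)
    (Or.inl (EReal.coe_ne_bot _)) (Or.inl (EReal.coe_ne_top _))).tendsto.comp (h1.prodMk_nhds hh)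
  simpa only [Function.comp_def, EReal.coe_mul, EReal.coe_one, one_mul] using this

theorem exists_eventually_lt_neg {ι : Type*} {l : Filter ι} {h : ι → ℝ} {t : EReal} (ht : t < 0)
    (hh : Tendsto (fun s => (h s : EReal)) l (𝓝 t)) : ∃ δ > 0, ∀ᶠ s in l, h s < -δ := by
  obtain ⟨r, h1, h2⟩ := EReal.lt_iff_exists_real_btwn.1 ht
  refine ⟨-r, by simpa using (EReal.coe_neg'.1 h2), ?_⟩
  filter_upwards [hh.eventually_lt_const h1] with s hs
  simpa using hs

/-- A positive real function of absolute value tending to infinity. -/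
theorem eventually_gt_of_abs {ι : Type*} {l : Filter ι} {h : ι → ℝ}
    (hh : Tendsto (fun s => |h s|) l atTop) (hpos : ∀ᶠ s in l, 0 < h s) (M : ℝ) :
    ∀ᶠ s in l, M < h s := by
  filter_upwards [hh.eventually_gt_atTop M, hpos] with s hs hs'
  rwa [abs_of_pos hs'] at hs

theorem eventually_lt_of_abs {ι : Type*} {l : Filter ι} {h : ι → ℝ}
    (hh : Tendsto (fun s => |h s|) l atTop) (hneg : ∀ᶠ s in l, h s < 0) (M : ℝ) :
    ∀ᶠ s in l, h s < -M := by
  filter_upwards [hh.eventually_gt_atTop M, hneg] with s hs hs'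
  rw [abs_of_neg hs'] at hs
  linarith

/-! ### The involutions at the sides -/

/-- The path `c` tends along `l` to a point of the subset `E v` of the side `v`. -/
def Reaches (b : ℝ) (E : Side → Set EReal) (l : Filter ℝ) (c : ℝ → ℝ × ℝ) (v : Side) : Prop :=
  ∃ t ∈ E v, Approaches b l c v t

/-- The equation of the curve that `σ` contracts to the origin. -/
def nu (w : ℝ × ℝ) : ℝ := w.1 + w.2 - w.1 * w.2

theorem nu_eq (w : ℝ × ℝ) : nu w = 1 - (w.1 - 1) * (w.2 - 1) := by
  unfold nu; ring

theorem continuous_nu : Continuous nu := by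
  unfold nu; fun_prop

theorem sigma_fst {w : ℝ × ℝ} (h : w.2 ≠ 0) : (sigma w).1 = nu w / w.2 := by
  unfold sigma nu; field_simp; ring

theorem sigma_snd {w : ℝ × ℝ} (h : w.1 ≠ 0) : (sigma w).2 = nu w / w.1 := by
  unfold sigma nu; field_simp; ring

/-- Lines through the origin are preserved; this is why σ fixes the sides V₄ (slope 0) and V₅ (slope
b). -/
theorem sigma_slope {w : ℝ × ℝ} (hx : w.1 ≠ 0) (hy : w.2 ≠ 0) (hX : (sigma w).1 ≠ 0) :
    (sigma w).2 / (sigma w).1 = w.2 / w.1 := by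
  have hn : nu w ≠ 0 := fun h => hX (by rw [sigma_fst hy, h, zero_div])
  rw [sigma_fst hy, sigma_snd hx]
  field_simp

theorem sigma_sub_one_mul_sub_one {w : ℝ × ℝ} (hx : w.1 ≠ 0) (hy : w.2 ≠ 0) :
    ((sigma w).1 - 1) * ((sigma w).2 - 1) = (1 - w.1) * (1 - w.2) := by
  unfold sigma
  field_simp
  ring

/-- The slope is recovered from the image, and for a given slope the first coordinate (1 + x/y) − x
determines x. The nonvanishing of this coordinate excludes the contracted curve ν = 0. -/
theorem sigma_injOn {w w' : ℝ × ℝ} (hw : w ∈ torusPart) (hw' : w' ∈ torusPart)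
    (h : sigma w = sigma w') (hX : (sigma w).1 ≠ 0) : w = w' := by
  obtain ⟨hx, hy⟩ := hw
  obtain ⟨hx', hy'⟩ := hw'
  have h1 := sigma_slope hx hy hX
  have h2 := sigma_slope hx' hy' (h ▸ hX)
  rw [h, h2] at h1
  have h3 : w.1 / w.2 = w'.1 / w'.2 := by
    rw [← inv_div, ← h1, inv_div]
  have h4 : (sigma w).1 = (sigma w').1 := by rw [h]
  simp only [sigma, h3] at h4
  have h5 : w.1 = w'.1 := by linarith
  rw [h5, div_left_inj' hx'] at h1
  exact Prod.ext h5 h1.symm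

theorem continuousAt_sigma {w : ℝ × ℝ} (hw : w ∈ torusPart) : ContinuousAt sigma w := by
  unfold sigma
  have h1 : ContinuousAt (fun p : ℝ × ℝ => p.1 / p.2) w :=
    ContinuousAt.div (by fun_prop) (by fun_prop) hw.2
  have h2 : ContinuousAt (fun p : ℝ × ℝ => p.2 / p.1) w :=
    ContinuousAt.div (by fun_prop) (by fun_prop) hw.1
  fun_prop

theorem continuous_tau : Continuous (tau a b) := by
  unfold tau; fun_prop

theorem tau_tau (w : ℝ × ℝ) : tau a b (tau a b w) = w := by
  unfold tau; ext <;> simp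

variable {l : Filter ℝ} {c : ℝ → ℝ × ℝ}

theorem tendsto_slope_sigma {m : ℝ}
    (hx : ∀ᶠ s in l, (c s).1 ≠ 0) (hy : ∀ᶠ s in l, (c s).2 ≠ 0)
    (hX : Tendsto (fun s => |(sigma (c s)).1|) l atTop)
    (hm : Tendsto (fun s => (c s).2 / (c s).1) l (𝓝 m)) :
    Tendsto (fun s => (sigma (c s)).2 / (sigma (c s)).1) l (𝓝 m) := by
  refine hm.congr' ?_
  filter_upwards [hx, hy, eventually_ne_of_abs hX] with s h1 h2 h3
  exact (sigma_slope h1 h2 h3).symm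

theorem Es_lt_zero_V1 (ha : a < -1) {t : EReal} (ht : t ∈ Es a .V1) : t < 0 := by
  refine lt_of_le_of_lt (mem_Iic.1 ht) ?_
  rw [← EReal.coe_zero, EReal.coe_lt_coe_iff]; linarith

theorem Es_lt_zero_V4 (ha : a < -1) {t : EReal} (ht : t ∈ Es a .V4) : t < 0 := by
  refine lt_of_le_of_lt (mem_Iic.1 ht) ?_
  rw [← EReal.coe_zero, EReal.coe_lt_coe_iff]; linarith

/-- The limits common to both halves of the side `V₁`. -/
theorem sigma_tendsto_of_V1 {t : EReal} (ht : t < 0) (h : Approaches b l c .V1 t)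
    (hx : ∀ᶠ s in l, (c s).1 ≠ 0) :
    Tendsto (fun s => (sigma (c s)).1) l (𝓝 1) ∧
      Tendsto (fun s => ((((sigma (c s)).1 - 1) * ((sigma (c s)).2 - 1) : ℝ) : EReal)) l
        (𝓝 (((1 : ℝ) : EReal) - t)) := by
  obtain ⟨δ, hδ, hy⟩ := exists_eventually_lt_neg ht h.2
  constructor
  · have h0 : Tendsto (fun s => (c s).1 / (c s).2) l (𝓝 0) := by
      have h1 : Tendsto (fun s => |(c s).1| / δ) l (𝓝 0) := by
        simpa using h.1.abs.div_const δ
      refine squeeze_zero_norm' ?_ h1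
      filter_upwards [hy] with s hs
      rw [Real.norm_eq_abs, abs_div]
      have : δ ≤ |(c s).2| := by rw [abs_of_neg (by linarith)]; linarith
      gcongr
    have := (h.1.const_sub 1).add h0
    simpa [sigma] using this
  · have h1 : Tendsto (fun s => 1 - (c s).1) l (𝓝 1) := by simpa using h.1.const_sub 1
    refine (tendsto_coe_mul h1 (tendsto_coe_sub (tendsto_const_nhds (x := (1 : ℝ))) h.2)).congr' ?_
    filter_upwards [hx, hy] with s h1 h2
    rw [sigma_sub_one_mul_sub_one h1 (by linarith)]

theorem one_sub_mem_Eu_V3 (ha : a < -1) {t : EReal} (ht : t ∈ Es a .V1) :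
    ((1 : ℝ) : EReal) - t ∈ Ici ((1 : ℝ) : EReal) := by
  have := Es_lt_zero_V1 ha ht
  induction t using EReal.rec with
  | bot => simp [-EReal.coe_one]
  | top => simp at this
  | coe t =>
    rw [mem_Ici, ← EReal.coe_sub, EReal.coe_le_coe_iff]
    have := EReal.coe_neg'.1 this
    linarith

/-- The second coordinate of the image is 1 + y(1/x − 1) with y < −δ, so it tends to −∞ as x → 0⁺;
from the left it tends to +∞. This decides which copy of V₃ is reached. -/
theorem reaches_sigma_V1_pos (ha : a < -1) (h : Reaches b (Es a) l c .V1)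
    (hx : ∀ᶠ s in l, 0 < (c s).1) : Reaches b (Eu a) l (fun s => sigma (c s)) .V3bot := by
  obtain ⟨t, ht, h⟩ := h
  have ht0 := Es_lt_zero_V1 ha ht
  obtain ⟨h1, h2⟩ := sigma_tendsto_of_V1 ht0 h (hx.mono fun s => ne_of_gt)
  obtain ⟨δ, hδ, hy⟩ := exists_eventually_lt_neg ht0 h.2
  refine ⟨_, one_sub_mem_Eu_V3 ha ht, ?_, h1, h2⟩
  have hinv : Tendsto (fun s => ((c s).1)⁻¹) l atTop :=
    tendsto_inv_nhdsGT_zero.comp (tendsto_nhdsWithin_iff.2 ⟨h.1, hx⟩)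
  have hb : Tendsto (fun s => 1 - δ * (((c s).1)⁻¹ - 1)) l atBot := by
    have := (tendsto_atTop_add_const_right l (-1) hinv).const_mul_atTop hδ
    have := tendsto_atBot_add_const_left l 1 (tendsto_neg_atTop_atBot.comp this)
    simpa [sub_eq_add_neg, Function.comp_def] using this
  refine tendsto_atBot_mono' l ?_ hb
  filter_upwards [hy, hinv.eventually_gt_atTop 1] with s h1 h2
  have : (sigma (c s)).2 = 1 + (c s).2 * (((c s).1)⁻¹ - 1) := by
    simp only [sigma, div_eq_mul_inv]; ring
  rw [this]
  nlinarith

theorem reaches_sigma_V1_neg (ha : a < -1) (h : Reaches b (Es a) l c .V1)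
    (hx : ∀ᶠ s in l, (c s).1 < 0) : Reaches b (Eu a) l (fun s => sigma (c s)) .V3top := by
  obtain ⟨t, ht, h⟩ := h
  have ht0 := Es_lt_zero_V1 ha ht
  obtain ⟨h1, h2⟩ := sigma_tendsto_of_V1 ht0 h (hx.mono fun s => ne_of_lt)
  obtain ⟨δ, hδ, hy⟩ := exists_eventually_lt_neg ht0 h.2
  refine ⟨_, one_sub_mem_Eu_V3 ha ht, ?_, h1, h2⟩
  have hinv : Tendsto (fun s => ((c s).1)⁻¹) l atBot :=
    tendsto_inv_nhdsLT_zero.comp (tendsto_nhdsWithin_iff.2 ⟨h.1, hx⟩)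
  have hb : Tendsto (fun s => 1 - δ * (((c s).1)⁻¹ - 1)) l atTop := by
    have := (tendsto_atBot_add_const_right l (-1) hinv).const_mul_atBot hδ
    have := tendsto_atTop_add_const_left l 1 (tendsto_neg_atBot_atTop.comp this)
    simpa [sub_eq_add_neg, Function.comp_def] using this
  refine tendsto_atTop_mono' l ?_ hb
  filter_upwards [hy, hinv.eventually_lt_atBot 1] with s h1 h2
  have : (sigma (c s)).2 = 1 + (c s).2 * (((c s).1)⁻¹ - 1) := by
    simp only [sigma, div_eq_mul_inv]; ring
  rw [this]
  nlinarith

/-- The second coordinate of the image is (1 − (x−1)(y−1))/x, which tends to 1 − t ≥ 2. -/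
theorem reaches_sigma_of_V3 {t : EReal} (ht : t ≤ ((-1 : ℝ) : EReal))
    (hy : Tendsto (fun s => |(c s).2|) l atTop) (hx : Tendsto (fun s => (c s).1) l (𝓝 1))
    (h : Tendsto (fun s => ((((c s).1 - 1) * ((c s).2 - 1) : ℝ) : EReal)) l (𝓝 t)) :
    Reaches b (Eu a) l (fun s => sigma (c s)) .V1 := by
  refine ⟨((1 : ℝ) : EReal) - t, ?_, ?_, ?_⟩
  · induction t using EReal.rec with
    | bot => simp [Eu, -EReal.coe_one]
    | top => exact (not_le.2 (EReal.coe_lt_top _) ht).elim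
    | coe t =>
      rw [EReal.coe_le_coe_iff] at ht
      change ((0 : ℝ) : EReal) ≤ _
      rw [← EReal.coe_sub, EReal.coe_le_coe_iff]
      linarith
  · have := (hx.const_sub 1).add (hx.mul (tendsto_inv_of_abs hy))
    simpa [sigma, div_eq_mul_inv] using this
  · have h1 : Tendsto (fun s => ((c s).1)⁻¹) l (𝓝 1) := by
      simpa using hx.inv₀ one_ne_zero
    refine (tendsto_coe_mul h1 (tendsto_coe_sub (tendsto_const_nhds (x := (1 : ℝ))) h)).congr' ?_
    filter_upwards [hx.eventually_ne one_ne_zero] with s hs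
    rw [sigma_snd hs, nu_eq, div_eq_inv_mul]

theorem reaches_sigma_V3top (h : Reaches b (Es a) l c .V3top) :
    Reaches b (Eu a) l (fun s => sigma (c s)) .V1 := by
  obtain ⟨t, ht, h⟩ := h
  exact reaches_sigma_of_V3 ht (tendsto_abs_atTop_atTop.comp h.1) h.2.1 h.2.2

/-- With y < 0 the factor in X = 1 + x(1/y − 1) has absolute value at least 1, so |X| → ∞; and Y = 1
+ y/x − y tends to 1 − t. -/
theorem reaches_sigma_V4 (ha : a < -1) (h : Reaches b (Es a) l c .V4) :
    Reaches b (Eu a) l (fun s => sigma (c s)) .V4 := by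
  obtain ⟨t, ht, h1, h2, h3⟩ := h
  have ht0 := Es_lt_zero_V4 ha ht
  obtain ⟨δ, hδ, hy⟩ := exists_eventually_lt_neg ht0 h3
  have hX : Tendsto (fun s => |(sigma (c s)).1|) l atTop := by
    refine tendsto_atTop_mono' l ?_ (tendsto_atTop_add_const_right l (-1) h1)
    filter_upwards [hy] with s hs
    have hyi : ((c s).2)⁻¹ ≤ 0 := inv_nonpos.2 (by linarith)
    have e : (sigma (c s)).1 = 1 + (c s).1 * (((c s).2)⁻¹ - 1) := by
      simp only [sigma, div_eq_mul_inv]; ring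
    have e1 : |(c s).1| ≤ |(c s).1 * (((c s).2)⁻¹ - 1)| := by
      rw [abs_mul]
      refine le_mul_of_one_le_right (abs_nonneg _) ?_
      rw [abs_of_neg (by linarith)]; linarith
    have e2 := abs_sub_abs_le_abs_sub ((c s).1 * (((c s).2)⁻¹ - 1)) (-1)
    rw [e]
    simp only [abs_neg, abs_one, sub_neg_eq_add] at e2
    rw [add_comm 1]
    linarith
  refine ⟨((1 : ℝ) : EReal) - t, ?_, hX, ?_, ?_⟩
  · induction t using EReal.rec with
    | bot => simp [Eu, -EReal.coe_one]
    | top => simp at ht0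
    | coe t =>
      have := EReal.coe_neg'.1 ht0
      change ((0 : ℝ) : EReal) ≤ _
      rw [← EReal.coe_sub, EReal.coe_le_coe_iff]
      linarith
  · exact tendsto_slope_sigma (eventually_ne_of_abs h1) (hy.mono fun s hs => by linarith) hX h2
  · have := tendsto_coe_sub (h2.const_add 1) h3
    rw [add_zero] at this
    refine this.congr fun s => ?_
    simp only [sigma]; congr 1; ring

/-- Y − bX = (1 + y/x − b − b·x/y) − (y − bx), and the bracket tends to 0 because y/x → b. Thus t₅
becomes −t₅. -/
theorem reaches_sigma_V5 (hb : b ≠ 0) (h : Reaches b (Es a) l c .V5) :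
    Reaches b (Eu a) l (fun s => sigma (c s)) .V5 := by
  obtain ⟨t, ht, h1, h2, h3⟩ := h
  have h4 : Tendsto (fun s => (c s).1 / (c s).2) l (𝓝 b⁻¹) := by
    simpa using h2.inv₀ hb
  have hX : Tendsto (fun s => |(sigma (c s)).1|) l atTop := by
    refine tendsto_atTop_mono' l ?_ (h1.atTop_add ((h4.const_add 1).abs.neg))
    filter_upwards with s
    have e2 := abs_sub_abs_le_abs_sub (c s).1 (1 + (c s).1 / (c s).2)
    rw [abs_sub_comm] at e2
    have : 1 + (c s).1 / (c s).2 - (c s).1 = (sigma (c s)).1 := by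
      simp only [sigma]; ring
    rw [this] at e2
    linarith
  refine ⟨((0 : ℝ) : EReal) - t, ?_, hX, ?_, ?_⟩
  · induction t using EReal.rec with
    | bot => simp [Eu]
    | top => exact (not_le.2 (EReal.coe_lt_top _) ht).elim
    | coe t =>
      have ht : (t : EReal) ≤ ((a + 1 : ℝ) : EReal) := ht
      rw [EReal.coe_le_coe_iff] at ht
      change ((-1 - a : ℝ) : EReal) ≤ _
      rw [← EReal.coe_sub, EReal.coe_le_coe_iff]
      linarith
  · refine tendsto_slope_sigma (eventually_ne_of_abs h1) ?_ hX h2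
    filter_upwards [h2.eventually_ne hb] with s hs h
    rw [h, zero_div] at hs
    exact hs rfl
  · have h5 : Tendsto (fun s => 1 + (c s).2 / (c s).1 - b - b * ((c s).1 / (c s).2)) l (𝓝 0) := by
      have := ((h2.const_add 1).sub_const b).sub (h4.const_mul b)
      simpa [mul_inv_cancel₀ hb] using this
    refine (tendsto_coe_sub h5 h3).congr fun s => ?_
    simp only [sigma]; congr 1; ring

/-- Near the axis X is x/y up to a bounded term and Y = 1 − y + y/x → 1: every crossing is sent to
the point t₄ = 1. -/
theorem reaches_sigma_of_axis {w : ℝ × ℝ} (hw : Tendsto c l (𝓝 w)) (hx : w.1 ≠ 0) (hy : w.2 = 0)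
    (hl : ∀ᶠ s in l, (c s).2 ≠ 0) : Reaches b (Eu a) l (fun s => sigma (c s)) .V4 := by
  have h1 : Tendsto (fun s => (c s).1) l (𝓝 w.1) := (continuous_fst.tendsto w).comp hw
  have h2 : Tendsto (fun s => (c s).2) l (𝓝 0) := hy ▸ (continuous_snd.tendsto w).comp hw
  have h3 : Tendsto (fun s => (c s).2 / (c s).1) l (𝓝 0) := by
    have := h2.div h1 hx
    rwa [zero_div] at this
  have h4 : Tendsto (fun s => |((c s).2)⁻¹|) l atTop :=
    tendsto_norm_atTop_iff_cobounded.2 (tendsto_inv₀_nhdsNE_zero.comp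
      (tendsto_nhdsWithin_iff.2 ⟨h2, hl⟩))
  have hX : Tendsto (fun s => |(sigma (c s)).1|) l atTop := by
    refine tendsto_atTop_mono' l ?_ ((h1.abs.pos_mul_atTop (abs_pos.2 hx) h4).atTop_add
      (h1.sub_const 1).abs.neg)
    filter_upwards with s
    have e2 := abs_sub_abs_le_abs_sub ((c s).1 * ((c s).2)⁻¹) ((c s).1 - 1)
    have : (c s).1 * ((c s).2)⁻¹ - ((c s).1 - 1) = (sigma (c s)).1 := by
      simp only [sigma, div_eq_mul_inv]; ring
    rw [this, abs_mul] at e2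
    linarith
  refine ⟨((1 : ℝ) : EReal), ?_, hX, ?_, ?_⟩
  · change ((0 : ℝ) : EReal) ≤ _
    rw [EReal.coe_le_coe_iff]; norm_num
  · exact tendsto_slope_sigma (h1.eventually_ne hx) hl hX h3
  · refine (continuous_coe_real_ereal.tendsto _).comp ?_
    simpa [sigma] using (h2.const_sub 1).add h3

/-- The curve ν = 0 is contracted to the origin, whose parameter 0 on V₁ is the very end of E₁ᵘ. -/
theorem reaches_sigma_of_nu {w : ℝ × ℝ} (hw : Tendsto c l (𝓝 w)) (hx : w.1 ≠ 0)
    (hn : nu w = 0) : Reaches b (Eu a) l (fun s => sigma (c s)) .V1 := by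
  have hy : w.2 ≠ 0 := fun h => hx (by simpa [nu, h] using hn)
  have h := (continuousAt_sigma (w := w) ⟨hx, hy⟩).tendsto.comp hw
  have e1 : (sigma w).1 = 0 := by rw [sigma_fst hy, hn, zero_div]
  have e2 : (sigma w).2 = 0 := by rw [sigma_snd hx, hn, zero_div]
  refine ⟨((0 : ℝ) : EReal), self_mem_Ici, ?_, ?_⟩
  · exact e1 ▸ (continuous_fst.tendsto _).comp h
  · exact (continuous_coe_real_ereal.tendsto _).comp (e2 ▸ (continuous_snd.tendsto _).comp h)

/-- The action of `τ` on the sides. -/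
def Side.mirror : Side → Side
  | .V1 => .V1
  | .V3top => .V3bot
  | .V3bot => .V3top
  | .V4 => .V5
  | .V5 => .V4

/-- `τ` acts on the parameter of the side `v` as the reflection `t ↦ mirrorConst a v - t`. -/
def mirrorConst (a : ℝ) : Side → ℝ
  | .V3top => 0
  | .V3bot => 0
  | _ => a + 1

theorem Approaches.tau {v : Side} {t : EReal} (h : Approaches b l c v t) :
    Approaches b l (fun s => PlaneBirational.tau a b (c s)) v.mirror
      ((mirrorConst a v : EReal) - t) := by
  have hV3 : Tendsto (fun s => (c s).1) l (𝓝 1) →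
      Tendsto (fun s => ((((c s).1 - 1) * ((c s).2 - 1) : ℝ) : EReal)) l (𝓝 t) →
      Tendsto (fun s => ((((PlaneBirational.tau a b (c s)).1 - 1) *
        ((PlaneBirational.tau a b (c s)).2 - 1) : ℝ) : EReal)) l
        (𝓝 (((0 : ℝ) : EReal) - t)) := by
    intro h1 h2
    have h3 : Tendsto (fun s => ((c s).1 - 1) * (b * (c s).1 + a - 1)) l (𝓝 0) := by
      simpa using (h1.sub_const 1).mul (((h1.const_mul b).add_const a).sub_const 1)
    refine (tendsto_coe_sub h3 h2).congr fun s => ?_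
    simp only [PlaneBirational.tau]; congr 1; ring
  cases v with
  | V1 =>
    refine ⟨h.1, ?_⟩
    have h3 : Tendsto (fun s => b * (c s).1 + a + 1) l (𝓝 (a + 1)) := by
      simpa using ((h.1.const_mul b).add_const a).add_const 1
    exact tendsto_coe_sub h3 h.2
  | V3top =>
    refine ⟨?_, h.2.1, hV3 h.2.1 h.2.2⟩
    have h3 := ((h.2.1.const_mul b).add_const a).add_const 1
    have := (tendsto_neg_atTop_atBot.comp h.1).atBot_add h3
    refine this.congr fun s => ?_
    simp only [PlaneBirational.tau, Function.comp_apply]; ring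
  | V3bot =>
    refine ⟨?_, h.2.1, hV3 h.2.1 h.2.2⟩
    have h3 := ((h.2.1.const_mul b).add_const a).add_const 1
    have := (tendsto_neg_atBot_atTop.comp h.1).atTop_add h3
    refine this.congr fun s => ?_
    simp only [PlaneBirational.tau, Function.comp_apply]; ring
  | V4 =>
    refine ⟨h.1, ?_, ?_⟩
    · have := (((tendsto_inv_of_abs h.1).const_mul (a + 1)).const_add b).sub h.2.1
      rw [mul_zero, add_zero, sub_zero] at this
      refine this.congr' ?_
      filter_upwards [eventually_ne_of_abs h.1] with s hs
      simp only [PlaneBirational.tau]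
      field_simp
      ring
    · refine (tendsto_coe_sub (tendsto_const_nhds (x := a + 1)) h.2.2).congr fun s => ?_
      simp only [PlaneBirational.tau]; congr 1; ring
  | V5 =>
    refine ⟨h.1, ?_, ?_⟩
    · have := (((tendsto_inv_of_abs h.1).const_mul (a + 1)).const_add b).sub h.2.1
      rw [mul_zero, add_zero, sub_self] at this
      refine this.congr' ?_
      filter_upwards [eventually_ne_of_abs h.1] with s hs
      simp only [PlaneBirational.tau]
      field_simp
      ring
    · refine (tendsto_coe_sub (tendsto_const_nhds (x := a + 1)) h.2.2).congr fun s => ?_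
      simp only [PlaneBirational.tau]; congr 1; ring

/-- The bounds of E^s are the reflected bounds of E^u; for instance 2a + 2 = (a + 1) − (−1 − a) on
passing from V₅ to V₄. -/
theorem mirror_mem_Es {v : Side} {t : EReal} (ht : t ∈ Eu a v) :
    (mirrorConst a v : EReal) - t ∈ Es a v.mirror := by
  induction t using EReal.rec with
  | bot => cases v <;> exact (not_le.2 (EReal.bot_lt_coe _) ht).elim
  | top => cases v <;> simp [Es, Side.mirror]
  | coe t =>
    cases v <;>
    · simp only [Eu, mem_Ici, EReal.coe_le_coe_iff] at ht
      simp only [mirrorConst, Side.mirror, Es, mem_Iic, ← EReal.coe_sub, EReal.coe_le_coe_iff]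
      linarith

theorem Reaches.tau_of_Eu {v : Side} (h : Reaches b (Eu a) l c v) :
    Reaches b (Es a) l (fun s => tau a b (c s)) v.mirror := by
  obtain ⟨t, ht, h⟩ := h
  exact ⟨_, mirror_mem_Es ht, h.tau⟩

end

/-! ### Signs of y and ν along a path, and the stretches that they cut out. -/

section

variable {a b : ℝ}

/-! ### First and last zeros -/

/-- As h < 0 near the open end p, the set {h ≥ 0} can be searched on a compact interval, where it
has a least element. -/
theorem exists_first_zero {h : ℝ → ℝ} {p r : ℝ} (hpr : p < r) (hh : ContinuousOn h (Ioc p r))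
    (hp : ∀ᶠ s in 𝓝[>] p, h s < 0) (hr : 0 ≤ h r) :
    ∃ q ∈ Ioc p r, h q = 0 ∧ ∀ s ∈ Ioo p q, h s < 0 := by
  obtain ⟨e, he, hneg⟩ := (mem_nhdsGT_iff_exists_Ioc_subset).1 hp
  have hep : p < e := he
  have her : e < r := by
    by_contra! h'
    exact (show h r < 0 from hneg ⟨hpr, h'⟩).not_ge hr
  have hsub : Icc e r ⊆ Ioc p r := fun s hs => ⟨hep.trans_le hs.1, hs.2⟩
  have hcl := (hh.mono hsub).preimage_isClosed_of_isClosed isClosed_Icc (isClosed_Ici (a := (0 : ℝ)))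
  obtain ⟨q, ⟨hq, hq0⟩, hmin⟩ := (isCompact_Icc.of_isClosed_subset hcl
    inter_subset_left).exists_isLeast ⟨r, ⟨her.le, le_rfl⟩, hr⟩
  have hlt : ∀ s ∈ Ioo p q, h s < 0 := by
    intro s hs
    rcases le_or_gt s e with h' | h'
    · exact hneg ⟨hs.1, h'⟩
    · by_contra! h''
      exact (hmin ⟨⟨h'.le, hs.2.le.trans hq.2⟩, h''⟩).not_gt hs.2
  refine ⟨q, hsub hq, le_antisymm ?_ hq0, hlt⟩
  have heq : e ≤ q := hq.1
  obtain ⟨x, hx, hx0⟩ := intermediate_value_Icc heq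
    ((hh.mono hsub).mono (Icc_subset_Icc_right hq.2)) ⟨(hneg ⟨hep, le_rfl⟩ : h e < 0).le, hq0⟩
  have : q ≤ x := hmin ⟨⟨hx.1, hx.2.trans hq.2⟩, hx0.ge⟩
  rw [le_antisymm this hx.2, hx0]

theorem exists_last_zero {h : ℝ → ℝ} {r q : ℝ} (hrq : r < q) (hh : ContinuousOn h (Ico r q))
    (hq : ∀ᶠ s in 𝓝[<] q, h s < 0) (hr : 0 ≤ h r) :
    ∃ p ∈ Ico r q, h p = 0 ∧ ∀ s ∈ Ioo p q, h s < 0 := by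
  obtain ⟨x, hx, hx0, hlt⟩ := exists_first_zero (h := fun s => h (-s)) (p := -q) (r := -r)
    (neg_lt_neg hrq) (hh.comp continuous_neg.continuousOn fun s hs =>
      ⟨by linarith [hs.2], by linarith [hs.1]⟩)
    (by
      have : Tendsto (fun s : ℝ => -s) (𝓝[>] (-q)) (𝓝[<] q) := by
        simpa using tendsto_neg_nhdsGT_neg (a := q)
      exact this.eventually hq) (by simpa using hr)
  refine ⟨-x, ⟨by linarith [hx.2], by linarith [hx.1]⟩, hx0, fun s hs => ?_⟩
  simpa using hlt (-s) ⟨by linarith [hs.2], by linarith [hs.1]⟩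

theorem exists_first_zero' {h : ℝ → ℝ} {p r : ℝ} (hpr : p < r) (hh : ContinuousOn h (Ioc p r))
    (hp : ∀ᶠ s in 𝓝[>] p, 0 < h s) (hr : h r ≤ 0) :
    ∃ q ∈ Ioc p r, h q = 0 ∧ ∀ s ∈ Ioo p q, 0 < h s := by
  obtain ⟨q, h1, h2, h3⟩ := exists_first_zero (h := fun s => -h s) hpr hh.neg
    (hp.mono fun s hs => neg_neg_of_pos hs) (by linarith)
  exact ⟨q, h1, by linarith, fun s hs => by linarith [h3 s hs]⟩

theorem exists_last_zero' {h : ℝ → ℝ} {r q : ℝ} (hrq : r < q) (hh : ContinuousOn h (Ico r q))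
    (hq : ∀ᶠ s in 𝓝[<] q, 0 < h s) (hr : h r ≤ 0) :
    ∃ p ∈ Ico r q, h p = 0 ∧ ∀ s ∈ Ioo p q, 0 < h s := by
  obtain ⟨p, h1, h2, h3⟩ := exists_last_zero (h := fun s => -h s) hrq hh.neg
    (hq.mono fun s hs => neg_neg_of_pos hs) (by linarith)
  exact ⟨p, h1, by linarith, fun s hs => by linarith [h3 s hs]⟩

/-! ### Quadrants near the sides -/

section Quadrants

variable {l : Filter ℝ} {c : ℝ → ℝ × ℝ}

theorem nu_neg_of_neg {w : ℝ × ℝ} (hx : w.1 < 0) (hy : w.2 < 0) : nu w < 0 := by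
  have := mul_pos_of_neg_of_neg hx hy
  unfold nu; linarith

/-- This and the following lemmas give the signs of y and ν near the sides. As the first coordinate
of σ is ν/y, these signs decide the half plane of the image and force the zeros used later. -/
theorem near_V1 (ha : a < -1) (h : Reaches b (Es a) l c .V1) :
    ∀ᶠ s in l, (c s).2 < 0 ∧ nu (c s) < 0 := by
  obtain ⟨t, ht, h⟩ := h
  obtain ⟨δ, hδ, hy⟩ := exists_eventually_lt_neg (Es_lt_zero_V1 ha ht) h.2
  -- In ν = x + y(1 − x) one has x < δ/2, and x < 1/2 makes the second term less than −δ/2.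
  filter_upwards [hy, h.1.eventually_lt_const (show (0 : ℝ) < min (1 / 2) (δ / 2) by positivity)]
    with s h1 h2
  have h3 := h2.trans_le (min_le_left _ _)
  have h4 := h2.trans_le (min_le_right _ _)
  refine ⟨by linarith, ?_⟩
  unfold nu
  nlinarith

theorem near_V4 (ha : a < -1) (h : Reaches b (Es a) l c .V4) : ∀ᶠ s in l, (c s).2 < 0 := by
  obtain ⟨t, ht, h⟩ := h
  obtain ⟨δ, hδ, hy⟩ := exists_eventually_lt_neg (Es_lt_zero_V4 ha ht) h.2.2
  filter_upwards [hy] with s h1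
  linarith

theorem nu_near_V4 (ha : a < -1) (h : Reaches b (Es a) l c .V4) (hx : ∀ᶠ s in l, 0 < (c s).1) :
    ∀ᶠ s in l, 0 < nu (c s) := by
  have hy := near_V4 ha h
  obtain ⟨t, ht, h⟩ := h
  filter_upwards [hy, eventually_gt_of_abs h.1 hx 1] with s h1 h2
  unfold nu
  nlinarith

theorem near_V5_right_pos (hb : 0 < b) {E : Side → Set EReal} (h : Reaches b E l c .V5)
    (hx : ∀ᶠ s in l, 0 < (c s).1) : ∀ᶠ s in l, 0 < (c s).2 ∧ nu (c s) < 0 := by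
  obtain ⟨t, ht, h⟩ := h
  -- From y > bx/2 and b(x − 1) > 2 follows y(x − 1) > x, that is ν < 0.
  filter_upwards [hx, eventually_gt_of_abs h.1 hx (1 + 2 / b),
    h.2.1.eventually_const_lt (half_lt_self hb)] with s h0 h1 h2
  rw [lt_div_iff₀ h0] at h2
  have hy : 0 < (c s).2 := (by positivity : 0 < b / 2 * (c s).1).trans h2
  refine ⟨hy, ?_⟩
  have h3 : 2 < b * ((c s).1 - 1) := by
    have : 2 / b < (c s).1 - 1 := by linarith
    rw [div_lt_iff₀ hb] at this
    linarith
  have h4 : 0 < (c s).1 - 1 := by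
    by_contra! h'
    nlinarith
  have h5 := mul_lt_mul_of_pos_right h2 h4
  unfold nu
  nlinarith

theorem near_V5_left_pos (hb : 0 < b) {E : Side → Set EReal} (h : Reaches b E l c .V5)
    (hx : ∀ᶠ s in l, (c s).1 < 0) : ∀ᶠ s in l, (c s).2 < 0 := by
  obtain ⟨t, ht, h⟩ := h
  filter_upwards [hx, h.2.1.eventually_const_lt hb] with s h0 h2
  rw [div_pos_iff] at h2
  rcases h2 with h | h
  · exact absurd h.2 h0.not_gt
  · exact h.1

theorem near_V5_right_neg (hb : b < 0) {E : Side → Set EReal} (h : Reaches b E l c .V5)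
    (hx : ∀ᶠ s in l, 0 < (c s).1) : ∀ᶠ s in l, (c s).2 < 0 ∧ 0 < nu (c s) := by
  obtain ⟨t, ht, h⟩ := h
  filter_upwards [hx, eventually_gt_of_abs h.1 hx 1,
    h.2.1.eventually_lt_const hb] with s h0 h1 h2
  have hy : (c s).2 < 0 := by
    rw [div_neg_iff] at h2
    rcases h2 with h | h
    · exact absurd h.2 h0.not_gt
    · exact h.1
  refine ⟨hy, ?_⟩
  unfold nu
  nlinarith

theorem near_V5_left_neg (hb : b < 0) {E : Side → Set EReal} (h : Reaches b E l c .V5)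
    (hx : ∀ᶠ s in l, (c s).1 < 0) : ∀ᶠ s in l, 0 < (c s).2 ∧ 0 < nu (c s) := by
  obtain ⟨t, ht, h⟩ := h
  -- Here y > bx/2 > 1, so both terms of ν = y + x(1 − y) are positive.
  filter_upwards [hx, eventually_lt_of_abs h.1 hx (-2 / b),
    h.2.1.eventually_lt_const (show b < b / 2 by linarith)] with s h0 h1 h2
  rw [div_lt_iff_of_neg h0] at h2
  have hy : 0 < (c s).2 := (mul_pos_of_neg_of_neg (by linarith) h0).trans h2
  refine ⟨hy, ?_⟩
  have h3 : 2 < b * (c s).1 := by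
    have : (c s).1 < 2 / b := by rw [neg_div, neg_neg] at h1; exact h1
    rw [lt_div_iff_of_neg hb] at this
    linarith
  unfold nu
  nlinarith

theorem near_V3top (h : Reaches b (Es a) l c .V3top) :
    ∀ᶠ s in l, 0 < (c s).2 ∧ 0 < nu (c s) := by
  obtain ⟨t, ht, h⟩ := h
  have ht : t < ((0 : ℝ) : EReal) := lt_of_le_of_lt ht (by
    rw [EReal.coe_lt_coe_iff]; norm_num)
  filter_upwards [h.1.eventually_gt_atTop 0, h.2.2.eventually_lt_const ht] with s h1 h2
  rw [EReal.coe_lt_coe_iff] at h2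
  exact ⟨h1, by rw [nu_eq]; linarith⟩

theorem near_V3bot (h : Reaches b (Es a) l c .V3bot) :
    ∀ᶠ s in l, (c s).2 < 0 ∧ 0 < nu (c s) := by
  obtain ⟨t, ht, h⟩ := h
  have ht : t < ((0 : ℝ) : EReal) := lt_of_le_of_lt ht (by
    rw [EReal.coe_lt_coe_iff]; norm_num)
  filter_upwards [h.1.eventually_lt_atBot 0, h.2.2.eventually_lt_const ht] with s h1 h2
  rw [EReal.coe_lt_coe_iff] at h2
  exact ⟨h1, by rw [nu_eq]; linarith⟩

theorem sigma_mem_rightHalf {w : ℝ × ℝ} (h : 0 < nu w ∧ 0 < w.2 ∨ nu w < 0 ∧ w.2 < 0) :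
    sigma w ∈ rightHalf := by
  change 0 < (sigma w).1
  rw [sigma_fst (by rcases h with h | h; exacts [h.2.ne', h.2.ne]), div_pos_iff]
  exact h

theorem sigma_mem_leftHalf {w : ℝ × ℝ} (h : 0 < nu w ∧ w.2 < 0 ∨ nu w < 0 ∧ 0 < w.2) :
    sigma w ∈ leftHalf := by
  change (sigma w).1 < 0
  rw [sigma_fst (by rcases h with h | h; exacts [h.2.ne, h.2.ne']), div_neg_iff]
  exact h

end Quadrants

/-! ### Pieces of a path that `σ` takes to s-arcs -/

/-- The part of the path `c` between the parameters `p` and `q` is mapped by `σ` to the interior of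
an s-arc of type `j + 1`. -/
def IsPiece (a b : ℝ) (c : ℝ → ℝ × ℝ) (j : Fin 4) (p q : ℝ) : Prop :=
  0 ≤ p ∧ p < q ∧ q ≤ 1 ∧ (∀ s ∈ Ioo p q, c s ∈ torusPart) ∧
    IsPath b (Eu a) (sType b j) (fun s => sigma (c s)) p q

section Pieces

variable {c : ℝ → ℝ × ℝ}

/-- A path in one of the half planes. -/
structure IsHalfPath (c : ℝ → ℝ × ℝ) (H : Set (ℝ × ℝ)) : Prop where
  cont : ContinuousOn c (Ioo 0 1)
  inj : InjOn c (Ioo 0 1)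
  mem : ∀ s ∈ Ioo (0 : ℝ) 1, c s ∈ H

/-- Injectivity of the image path needs no extra hypothesis: σ is injective off its contracted
curve, and an image inside a half plane avoids x = 0. -/
theorem isPiece_of_reaches (hb : b ≠ 0) {H : Set (ℝ × ℝ)} (hc : IsHalfPath c H)
    (hH : ∀ w ∈ H, w.1 ≠ 0) {j : Fin 4}
    {p q : ℝ} (h0 : 0 ≤ p) (hpq : p < q) (h1 : q ≤ 1)
    (hy : ∀ s ∈ Ioo p q, (c s).2 ≠ 0)
    (hhalf : ∀ s ∈ Ioo p q, sigma (c s) ∈ (sType b j).half)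
    {v w : Side} (hv : v ∈ (sType b j).source) (hw : w ∈ (sType b j).target)
    (h : Reaches b (Eu a) (𝓝[>] p) (fun s => sigma (c s)) v ∧
        Reaches b (Eu a) (𝓝[<] q) (fun s => sigma (c s)) w ∨
      Reaches b (Eu a) (𝓝[>] p) (fun s => sigma (c s)) w ∧
        Reaches b (Eu a) (𝓝[<] q) (fun s => sigma (c s)) v) :
    IsPiece a b c j p q := by
  have hsub : Ioo p q ⊆ Ioo 0 1 := Ioo_subset_Ioo h0 h1
  have hT : ∀ s ∈ Ioo p q, c s ∈ torusPart := fun s hs =>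
    ⟨hH _ (hc.mem s (hsub hs)), hy s hs⟩
  refine ⟨h0, hpq, h1, hT, ?_, ?_, hhalf, ?_⟩
  · intro s hs
    exact (continuousAt_sigma (hT s hs)).comp_continuousWithinAt ((hc.cont.mono hsub) s hs)
  · intro s hs s' hs' h
    exact hc.inj (hsub hs) (hsub hs') (sigma_injOn (hT s hs) (hT s' hs') h
      ((sType_isProper hb j).half_ne _ (hhalf s hs)))
  · rcases h with ⟨⟨t, ht, h⟩, ⟨t', ht', h'⟩⟩ | ⟨⟨t, ht, h⟩, ⟨t', ht', h'⟩⟩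
    · exact ⟨v, hv, t, ht, w, hw, t', ht', Or.inl ⟨h, h'⟩⟩
    · exact ⟨v, hv, t', ht', w, hw, t, ht, Or.inr ⟨h', h⟩⟩

namespace IsHalfPath

variable {H : Set (ℝ × ℝ)}

theorem tendsto (hc : IsHalfPath c H) {s : ℝ} (hs : s ∈ Ioo (0 : ℝ) 1) : Tendsto c (𝓝 s) (𝓝 (c s)) :=
  (hc.cont s hs).continuousAt (Ioo_mem_nhds hs.1 hs.2)

theorem contOn_snd (hc : IsHalfPath c H) : ContinuousOn (fun s => (c s).2) (Ioo 0 1) :=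
  continuous_snd.comp_continuousOn hc.cont

theorem contOn_nu (hc : IsHalfPath c H) : ContinuousOn (fun s => nu (c s)) (Ioo 0 1) :=
  continuous_nu.comp_continuousOn hc.cont

theorem tendsto_nu (hc : IsHalfPath c H) {s : ℝ} (hs : s ∈ Ioo (0 : ℝ) 1) :
    Tendsto (fun s => nu (c s)) (𝓝 s) (𝓝 (nu (c s))) :=
  (continuous_nu.tendsto _).comp (hc.tendsto hs)

theorem reaches_axis_right (hc : IsHalfPath c H) (hH : ∀ w ∈ H, w.1 ≠ 0) {p q : ℝ} (hpq : p < q)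
    (hp : p ∈ Ioo (0 : ℝ) 1) (hy : (c p).2 = 0) (hne : ∀ s ∈ Ioo p q, (c s).2 ≠ 0) :
    Reaches b (Eu a) (𝓝[>] p) (fun s => sigma (c s)) .V4 := by
  refine reaches_sigma_of_axis ((hc.tendsto hp).mono_left nhdsWithin_le_nhds)
    (hH _ (hc.mem p hp)) hy ?_
  filter_upwards [Ioo_mem_nhdsGT hpq] with s hs using hne s hs

theorem reaches_axis_left (hc : IsHalfPath c H) (hH : ∀ w ∈ H, w.1 ≠ 0) {p q : ℝ} (hpq : p < q)
    (hq : q ∈ Ioo (0 : ℝ) 1) (hy : (c q).2 = 0) (hne : ∀ s ∈ Ioo p q, (c s).2 ≠ 0) :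
    Reaches b (Eu a) (𝓝[<] q) (fun s => sigma (c s)) .V4 := by
  refine reaches_sigma_of_axis ((hc.tendsto hq).mono_left nhdsWithin_le_nhds)
    (hH _ (hc.mem q hq)) hy ?_
  filter_upwards [Ioo_mem_nhdsLT hpq] with s hs using hne s hs

theorem reaches_nu (hc : IsHalfPath c H) (hH : ∀ w ∈ H, w.1 ≠ 0) {p : ℝ} {S : Set ℝ}
    (hp : p ∈ Ioo (0 : ℝ) 1) (hn : nu (c p) = 0) :
    Reaches b (Eu a) (𝓝[S] p) (fun s => sigma (c s)) .V1 :=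
  reaches_sigma_of_nu ((hc.tendsto hp).mono_left nhdsWithin_le_nhds) (hH _ (hc.mem p hp)) hn

end IsHalfPath

/-- This fixes the order of crossings: on the axis ν has the sign of the half plane, so a path that
starts with the other sign of ν crosses ν = 0 before the axis. -/
theorem nu_of_snd_eq_zero {w : ℝ × ℝ} (h : w.2 = 0) : nu w = w.1 := by
  simp [nu, h]

theorem rightHalf_ne : ∀ w ∈ rightHalf, w.1 ≠ 0 := fun w hw => (show 0 < w.1 from hw).ne'

theorem leftHalf_ne : ∀ w ∈ leftHalf, w.1 ≠ 0 := fun w hw => (show w.1 < 0 from hw).ne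

theorem eventually_mem_right {c : ℝ → ℝ × ℝ} {H : Set (ℝ × ℝ)} (hc : IsHalfPath c H) :
    ∀ᶠ s in 𝓝[>] (0 : ℝ), c s ∈ H := by
  filter_upwards [Ioo_mem_nhdsGT one_pos] with s hs using hc.mem s hs

theorem eventually_mem_left {c : ℝ → ℝ × ℝ} {H : Set (ℝ × ℝ)} (hc : IsHalfPath c H) :
    ∀ᶠ s in 𝓝[<] (1 : ℝ), c s ∈ H := by
  filter_upwards [Ioo_mem_nhdsLT one_pos] with s hs using hc.mem s hs

theorem exists_mem_of_eventually_left {P : ℝ → Prop} (h : ∀ᶠ s in 𝓝[<] (1 : ℝ), P s) {r : ℝ}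
    (hr : r < 1) : ∃ s ∈ Ioo r 1, P s := by
  obtain ⟨s, h1, h2⟩ := (h.and (Ioo_mem_nhdsLT hr)).exists
  exact ⟨s, h2, h1⟩

theorem sType_three (b : ℝ) : sType b 3 = ⟨rightHalf, {.V1}, {.V3bot}⟩ := by
  unfold sType; split_ifs <;> rfl

/-- A path in the right half plane that starts on the side `V₁` and reaches `N > 0` has a first
piece that goes over to an s-arc of type 4. -/
theorem exists_piece_start_V1 (ha : a < -1) (hb : b ≠ 0) (hc : IsHalfPath c rightHalf)
    (h0 : Reaches b (Es a) (𝓝[>] 0) c .V1) {r : ℝ} (hr : r ∈ Ioo (0 : ℝ) 1)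
    (hrn : 0 ≤ nu (c r)) :
    ∃ p ∈ Ioc 0 r, nu (c p) = 0 ∧ (∀ s ∈ Ioo 0 p, (c s).2 < 0) ∧ IsPiece a b c 3 0 p := by
  have hev := near_V1 ha h0
  obtain ⟨p, hp, hp0, hlt⟩ := exists_first_zero hr.1
    (hc.contOn_nu.mono fun s hs => ⟨hs.1, hs.2.trans_lt hr.2⟩) (hev.mono fun s => And.right) hrn
  have hp1 : p ∈ Ioo (0 : ℝ) 1 := ⟨hp.1, hp.2.trans_lt hr.2⟩
  -- On the axis ν = x > 0, so the path cannot touch it before the first zero of ν.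
  have hy : ∀ s ∈ Ioo 0 p, (c s).2 < 0 := by
    intro s hs
    by_contra! h
    obtain ⟨q, hq, hq0, -⟩ := exists_first_zero (h := fun s => (c s).2) hs.1
      (hc.contOn_snd.mono fun x hx => ⟨hx.1, hx.2.trans_lt (hs.2.trans hp1.2)⟩)
      (hev.mono fun s => And.left) h
    have hx : 0 < (c q).1 := hc.mem q ⟨hq.1, hq.2.trans_lt (hs.2.trans hp1.2)⟩
    have := hlt q ⟨hq.1, hq.2.trans_lt hs.2⟩
    rw [nu_of_snd_eq_zero hq0] at this
    linarith
  refine ⟨p, hp, hp0, hy, isPiece_of_reaches hb hc rightHalf_ne le_rfl hp.1 hp1.2.le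
    (fun s hs => (hy s hs).ne) ?_ (v := .V1) (w := .V3bot) ?_ ?_ (Or.inr ⟨?_, ?_⟩)⟩
  · intro s hs
    rw [sType_three]
    exact sigma_mem_rightHalf (Or.inr ⟨hlt s hs, hy s hs⟩)
  · rw [sType_three]; exact mem_singleton _
  · rw [sType_three]; exact mem_singleton _
  · exact reaches_sigma_V1_pos ha h0 (eventually_mem_right hc)
  · exact hc.reaches_nu rightHalf_ne hp1 hp0

/-- The part of the path before its first crossing `q` of the axis `y = 0`, after the last zero of
`N`. -/
theorem exists_piece_before_axis (hb : b < 0) {H : Set (ℝ × ℝ)} (hc : IsHalfPath c H)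
    (hH : ∀ w ∈ H, w.1 ≠ 0) {p q : ℝ} (hp : p ∈ Ioo (0 : ℝ) 1) (hq : q ∈ Ioo (0 : ℝ) 1)
    (hpq : p < q) (hp0 : nu (c p) = 0) (hq0 : (c q).2 = 0)
    (hsign : 0 < nu (c q) ∧ (∀ s ∈ Ioo p q, (c s).2 < 0) ∨
      nu (c q) < 0 ∧ (∀ s ∈ Ioo p q, 0 < (c s).2)) :
    ∃ p' ∈ Ico p q, IsPiece a b c 0 p' q := by
  have hcont : ContinuousOn (fun s => nu (c s)) (Ico p q) :=
    hc.contOn_nu.mono fun s hs => ⟨hp.1.trans_le hs.1, hs.2.trans hq.2⟩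
  have hs0 : sType b 0 = ⟨leftHalf, {.V4}, {.V1, .V5}⟩ := by
    unfold sType; rw [if_neg hb.not_gt]
  -- Between the last zero of ν and the crossing of the axis, ν and y have opposite signs; hence the
  -- image lies in the left half plane.
  have key : ∃ p' ∈ Ico p q, nu (c p') = 0 ∧
      ∀ s ∈ Ioo p' q, 0 < nu (c s) ∧ (c s).2 < 0 ∨ nu (c s) < 0 ∧ 0 < (c s).2 := by
    rcases hsign with ⟨h1, h2⟩ | ⟨h1, h2⟩
    · obtain ⟨p', hp', hp'0, h3⟩ := exists_last_zero' hpq hcont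
        (((hc.tendsto_nu hq).eventually_const_lt h1).filter_mono nhdsWithin_le_nhds) hp0.le
      exact ⟨p', hp', hp'0, fun s hs => Or.inl ⟨h3 s hs, h2 s ⟨hp'.1.trans_lt hs.1, hs.2⟩⟩⟩
    · obtain ⟨p', hp', hp'0, h3⟩ := exists_last_zero hpq hcont
        (((hc.tendsto_nu hq).eventually_lt_const h1).filter_mono nhdsWithin_le_nhds) hp0.ge
      exact ⟨p', hp', hp'0, fun s hs => Or.inr ⟨h3 s hs, h2 s ⟨hp'.1.trans_lt hs.1, hs.2⟩⟩⟩
  obtain ⟨p', hp', hp'0, h3⟩ := key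
  have hp'1 : p' ∈ Ioo (0 : ℝ) 1 := ⟨hp.1.trans_le hp'.1, hp'.2.trans hq.2⟩
  have hne : ∀ s ∈ Ioo p' q, (c s).2 ≠ 0 := fun s hs => by
    rcases h3 s hs with h | h
    exacts [h.2.ne, h.2.ne']
  refine ⟨p', hp', isPiece_of_reaches hb.ne hc hH hp'1.1.le hp'.2 hq.2.le hne ?_
    (v := .V4) (w := .V1) ?_ ?_ (Or.inr ⟨?_, ?_⟩)⟩
  · intro s hs
    rw [hs0]
    exact sigma_mem_leftHalf (h3 s hs)
  · rw [hs0]; exact mem_singleton _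
  · rw [hs0]; exact mem_insert _ _
  · exact hc.reaches_nu hH hp'1 hp'0
  · exact hc.reaches_axis_left hH hp'.2 hq hq0 hne

/-- The part of a path after its last crossing `q` of the axis `y = 0`. -/
theorem exists_piece_after_axis (hb : b ≠ 0) (hc : IsHalfPath c rightHalf) {q : ℝ}
    (hq : q ∈ Ioo (0 : ℝ) 1) (hq0 : (c q).2 = 0) (hy : ∀ s ∈ Ioo q 1, 0 < (c s).2)
    (hend : (∃ s ∈ Ioo q 1, nu (c s) ≤ 0) ∨
      Reaches b (Eu a) (𝓝[<] 1) (fun s => sigma (c s)) .V1) :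
    ∃ p ∈ Ioc q 1, IsPiece a b c 2 q p ∧ (p = 1 ∨ nu (c p) = 0) ∧
      ∀ s ∈ Ioo q p, 0 < nu (c s) := by
  have hnq : 0 < nu (c q) := by
    rw [nu_of_snd_eq_zero hq0]; exact hc.mem q hq
  have hsrc : (sType b 2).half = rightHalf ∧ Side.V1 ∈ (sType b 2).source ∧
      Side.V4 ∈ (sType b 2).target := by
    unfold sType; split_ifs <;> simp
  have main : ∀ p ∈ Ioc q 1, (∀ s ∈ Ioo q p, 0 < nu (c s)) →
      Reaches b (Eu a) (𝓝[<] p) (fun s => sigma (c s)) .V1 → IsPiece a b c 2 q p := by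
    intro p hp hn hr
    have hne : ∀ s ∈ Ioo q p, (c s).2 ≠ 0 := fun s hs => (hy s ⟨hs.1, hs.2.trans_le hp.2⟩).ne'
    refine isPiece_of_reaches hb hc rightHalf_ne hq.1.le hp.1 hp.2 hne ?_ hsrc.2.1 hsrc.2.2
      (Or.inr ⟨hc.reaches_axis_right rightHalf_ne hp.1 hq hq0 hne, hr⟩)
    intro s hs
    rw [hsrc.1]
    exact sigma_mem_rightHalf (Or.inl ⟨hn s hs, hy s ⟨hs.1, hs.2.trans_le hp.2⟩⟩)
  by_cases hex : ∃ s ∈ Ioo q 1, nu (c s) ≤ 0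
  · obtain ⟨r, hr, hr0⟩ := hex
    obtain ⟨p, hp, hp0, hn⟩ := exists_first_zero' hr.1
      (hc.contOn_nu.mono fun s hs => ⟨hq.1.trans hs.1, hs.2.trans_lt hr.2⟩)
      (((hc.tendsto_nu hq).eventually_const_lt hnq).filter_mono nhdsWithin_le_nhds) hr0
    have hp1 : p < 1 := hp.2.trans_lt hr.2
    exact ⟨p, ⟨hp.1, hp1.le⟩, main p ⟨hp.1, hp1.le⟩ hn
      (hc.reaches_nu rightHalf_ne ⟨hq.1.trans hp.1, hp1⟩ hp0), Or.inr hp0, hn⟩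
  · have hn : ∀ s ∈ Ioo q 1, 0 < nu (c s) := fun s hs => by
      by_contra! h
      exact hex ⟨s, hs, h⟩
    exact ⟨1, ⟨hq.2, le_rfl⟩, main 1 ⟨hq.2, le_rfl⟩ hn (hend.resolve_left hex), Or.inl rfl, hn⟩

end Pieces

end

/-! ### The transitions, type by type. -/

section

variable {a b : ℝ} {c : ℝ → ℝ × ℝ}

/-! ### The pieces of the u-arcs -/

/-- For x, y < 0 also ν < 0, so the stretch after the last crossing of the axis goes to the right
half plane. If there is no crossing the whole arc serves; either way the image starts on V₄. -/
theorem exists_pieces_pos_zero (ha : a < -1) (hb : 0 < b) (hc : IsHalfPath c leftHalf)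
    (h0 : Reaches b (Es a) (𝓝[>] 0) c .V4)
    (h1 : Reaches b (Es a) (𝓝[<] 1) c .V1 ∨ Reaches b (Es a) (𝓝[<] 1) c .V5) :
    ∃ p q, IsPiece a b c 1 p q := by
  have hs : sType b 1 = ⟨rightHalf, {.V4}, {.V5, .V3top}⟩ := by
    unfold sType; rw [if_pos hb]
  have hend : ∀ᶠ s in 𝓝[<] (1 : ℝ), (c s).2 < 0 := by
    rcases h1 with h1 | h1
    · exact (near_V1 ha h1).mono fun s => And.left
    · exact near_V5_left_pos hb h1 (eventually_mem_left hc)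
  have main : ∀ p, 0 ≤ p → p < 1 → (∀ s ∈ Ioo p 1, (c s).2 < 0) →
      Reaches b (Eu a) (𝓝[>] p) (fun s => sigma (c s)) .V4 → IsPiece a b c 1 p 1 := by
    intro p hp0 hp1 hy hr
    have hhalf : ∀ s ∈ Ioo p 1, sigma (c s) ∈ (sType b 1).half := fun s h => by
      rw [hs]
      exact sigma_mem_rightHalf (Or.inr ⟨nu_neg_of_neg (hc.mem s ⟨hp0.trans_lt h.1, h.2⟩)
        (hy s h), hy s h⟩)
    rcases h1 with h1 | h1
    · exact isPiece_of_reaches hb.ne' hc leftHalf_ne hp0 hp1 le_rfl (fun s h => (hy s h).ne) hhalf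
        (v := .V4) (w := .V3top) (by rw [hs]; simp) (by rw [hs]; simp)
        (Or.inl ⟨hr, reaches_sigma_V1_neg ha h1 (eventually_mem_left hc)⟩)
    · exact isPiece_of_reaches hb.ne' hc leftHalf_ne hp0 hp1 le_rfl (fun s h => (hy s h).ne) hhalf
        (v := .V4) (w := .V5) (by rw [hs]; simp) (by rw [hs]; simp)
        (Or.inl ⟨hr, reaches_sigma_V5 hb.ne' h1⟩)
  by_cases hex : ∃ r ∈ Ioo (0 : ℝ) 1, 0 ≤ (c r).2
  · obtain ⟨r, hr, hr0⟩ := hex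
    obtain ⟨p, hp, hp0, hy⟩ := exists_last_zero hr.2
      (hc.contOn_snd.mono fun s hs => ⟨hr.1.trans_le hs.1, hs.2⟩) hend hr0
    have hp1 : p ∈ Ioo (0 : ℝ) 1 := ⟨hr.1.trans_le hp.1, hp.2⟩
    exact ⟨p, 1, main p hp1.1.le hp1.2 hy
      (hc.reaches_axis_right leftHalf_ne hp1.2 hp1 hp0 fun s h => (hy s h).ne)⟩
  · refine ⟨0, 1, main 0 le_rfl one_pos (fun s h => ?_) (reaches_sigma_V4 ha h0)⟩
    by_contra! h'
    exact hex ⟨s, h, h'⟩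

/-- The path starts with y > 0 > ν and ends with y < 0, so ν vanishes before the first crossing of
the axis. The stretch up to its first zero goes to the left half plane, and the one from its last
zero to the crossing goes to the right. -/
theorem exists_pieces_pos_one (ha : a < -1) (hb : 0 < b) (hc : IsHalfPath c rightHalf)
    (h0 : Reaches b (Es a) (𝓝[>] 0) c .V5)
    (h1 : Reaches b (Es a) (𝓝[<] 1) c .V4 ∨ Reaches b (Es a) (𝓝[<] 1) c .V3bot) :
    ∃ p q p' q', IsPiece a b c 0 p q ∧ IsPiece a b c 2 p' q' ∧ q ≤ p' := by
  have hs0 : sType b 0 = ⟨leftHalf, {.V5}, {.V1, .V4}⟩ := by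
    unfold sType; rw [if_pos hb]
  have hs2 : sType b 2 = ⟨rightHalf, {.V1}, {.V4}⟩ := by
    unfold sType; rw [if_pos hb]
  have hstart := near_V5_right_pos hb h0 (eventually_mem_right hc)
  have hend : ∀ᶠ s in 𝓝[<] (1 : ℝ), (c s).2 < 0 := by
    rcases h1 with h1 | h1
    · exact near_V4 ha h1
    · exact (near_V3bot h1).mono fun s => And.left
  obtain ⟨r, hr, hr0⟩ := exists_mem_of_eventually_left hend one_pos
  obtain ⟨q, hq, hq0, hy⟩ := exists_first_zero' hr.1
    (hc.contOn_snd.mono fun s hs => ⟨hs.1, hs.2.trans_lt hr.2⟩)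
    (hstart.mono fun s => And.left) hr0.le
  have hq1 : q ∈ Ioo (0 : ℝ) 1 := ⟨hq.1, hq.2.trans_lt hr.2⟩
  have hnq : 0 < nu (c q) := by
    rw [nu_of_snd_eq_zero hq0]; exact hc.mem q hq1
  obtain ⟨p, hp, hp0, hn⟩ := exists_first_zero hq.1
    (hc.contOn_nu.mono fun s hs => ⟨hs.1, hs.2.trans_lt hq1.2⟩)
    (hstart.mono fun s => And.right) hnq.le
  have hpq : p < q := lt_of_le_of_ne hp.2 fun h => by
    rw [h] at hp0; exact hnq.ne' hp0
  have hp1 : p ∈ Ioo (0 : ℝ) 1 := ⟨hp.1, hpq.trans hq1.2⟩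
  obtain ⟨p', hp', hp'0, hn'⟩ := exists_last_zero' hpq
    (hc.contOn_nu.mono fun s hs => ⟨hp.1.trans_le hs.1, hs.2.trans hq1.2⟩)
    (((hc.tendsto_nu hq1).eventually_const_lt hnq).filter_mono nhdsWithin_le_nhds) hp0.le
  have hp'1 : p' ∈ Ioo (0 : ℝ) 1 := ⟨hp.1.trans_le hp'.1, hp'.2.trans hq1.2⟩
  have hy1 : ∀ s ∈ Ioo 0 p, 0 < (c s).2 := fun s h => hy s ⟨h.1, h.2.trans hpq⟩
  have hy2 : ∀ s ∈ Ioo p' q, 0 < (c s).2 := fun s h => hy s ⟨hp'1.1.trans h.1, h.2⟩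
  refine ⟨0, p, p', q, ?_, ?_, hp'.1⟩
  · refine isPiece_of_reaches hb.ne' hc rightHalf_ne le_rfl hp.1 hp1.2.le
      (fun s h => (hy1 s h).ne') (fun s h => ?_) (v := .V5) (w := .V1) (by rw [hs0]; simp)
      (by rw [hs0]; simp) (Or.inl ⟨reaches_sigma_V5 hb.ne' h0, hc.reaches_nu rightHalf_ne hp1 hp0⟩)
    rw [hs0]
    exact sigma_mem_leftHalf (Or.inr ⟨hn s h, hy1 s h⟩)
  · refine isPiece_of_reaches hb.ne' hc rightHalf_ne hp'1.1.le hp'.2 hq1.2.le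
      (fun s h => (hy2 s h).ne') (fun s h => ?_) (v := .V1) (w := .V4) (by rw [hs2]; simp)
      (by rw [hs2]; simp) (Or.inl ⟨hc.reaches_nu rightHalf_ne hp'1 hp'0,
        hc.reaches_axis_left rightHalf_ne hp'.2 hq1 hq0 fun s h => (hy2 s h).ne'⟩)
    rw [hs2]
    exact sigma_mem_rightHalf (Or.inl ⟨hn' s h, hy2 s h⟩)

/-- A path in the right half plane from the side `V₁` to the region `y > 0` crosses `N = 0` before
it first crosses the axis. -/
theorem exists_crossings_of_V1 (ha : a < -1) (hb : b ≠ 0) (hc : IsHalfPath c rightHalf)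
    (h0 : Reaches b (Es a) (𝓝[>] 0) c .V1) (hend : ∀ᶠ s in 𝓝[<] (1 : ℝ), 0 < (c s).2) :
    ∃ p q q', 0 < p ∧ p < q ∧ q ≤ q' ∧ q' < 1 ∧ nu (c p) = 0 ∧ (c q).2 = 0 ∧ (c q').2 = 0 ∧
      IsPiece a b c 3 0 p ∧ (∀ s ∈ Ioo 0 q, (c s).2 < 0) ∧ ∀ s ∈ Ioo q' 1, 0 < (c s).2 := by
  have hstart := near_V1 ha h0
  obtain ⟨r, hr, hr0⟩ := exists_mem_of_eventually_left hend one_pos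
  obtain ⟨q, hq, hq0, hy⟩ := exists_first_zero hr.1
    (hc.contOn_snd.mono fun s hs => ⟨hs.1, hs.2.trans_lt hr.2⟩)
    (hstart.mono fun s => And.left) hr0.le
  have hq1 : q ∈ Ioo (0 : ℝ) 1 := ⟨hq.1, hq.2.trans_lt hr.2⟩
  have hnq : 0 < nu (c q) := by
    rw [nu_of_snd_eq_zero hq0]; exact hc.mem q hq1
  obtain ⟨p, hp, hp0, -, hpiece⟩ := exists_piece_start_V1 ha hb hc h0 hq1 hnq.le
  have hpq : p < q := lt_of_le_of_ne hp.2 fun h => by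
    rw [h] at hp0; exact hnq.ne' hp0
  obtain ⟨q', hq', hq'0, hy'⟩ := exists_last_zero' hq1.2
    (hc.contOn_snd.mono fun s hs => ⟨hq1.1.trans_le hs.1, hs.2⟩) hend hq0.le
  exact ⟨p, q, q', hp.1, hpq, hq'.1, hq'.2, hp0, hq0, hq'0, hpiece, hy, hy'⟩

/-- ν is negative at both ends and positive on the axis, which is crossed. The stretches run from
the start to the first zero of ν, from the last axis crossing to the next zero of ν, and from the
last zero of ν to the end. -/
theorem exists_pieces_pos_two (ha : a < -1) (hb : 0 < b) (hc : IsHalfPath c rightHalf)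
    (h0 : Reaches b (Es a) (𝓝[>] 0) c .V1) (h1 : Reaches b (Es a) (𝓝[<] 1) c .V5) :
    ∃ p q p' q' p'' q'', IsPiece a b c 3 p q ∧ IsPiece a b c 2 p' q' ∧ IsPiece a b c 0 p'' q'' ∧
      q ≤ p' ∧ q' ≤ p'' := by
  have hs0 : sType b 0 = ⟨leftHalf, {.V5}, {.V1, .V4}⟩ := by
    unfold sType; rw [if_pos hb]
  have hend := near_V5_right_pos hb h1 (eventually_mem_left hc)
  obtain ⟨p, q, q', hp, hpq, hqq', hq'1, hp0, hq0, hq'0, hpiece, hy, hy'⟩ :=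
    exists_crossings_of_V1 ha hb.ne' hc h0 (hend.mono fun s => And.left)
  have hq' : q' ∈ Ioo (0 : ℝ) 1 := ⟨hp.trans (hpq.trans_le hqq'), hq'1⟩
  obtain ⟨r, hr, hr0⟩ := exists_mem_of_eventually_left (hend.mono fun s => And.right) hq'1
  obtain ⟨e, he, hpiece', he0, hn⟩ := exists_piece_after_axis (a := a) hb.ne' hc hq' hq'0 hy'
    (Or.inl ⟨r, hr, hr0.le⟩)
  have her : e ≤ r := by
    by_contra! h
    exact (hn r ⟨hr.1, h⟩).not_gt hr0
  have he1 : e ∈ Ioo (0 : ℝ) 1 := ⟨hq'.1.trans he.1, her.trans_lt hr.2⟩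
  obtain ⟨x, hx, hx0, hn'⟩ := exists_last_zero he1.2
    (hc.contOn_nu.mono fun s hs => ⟨he1.1.trans_le hs.1, hs.2⟩) (hend.mono fun s => And.right)
    (he0.resolve_left he1.2.ne).ge
  have hx1 : x ∈ Ioo (0 : ℝ) 1 := ⟨he1.1.trans_le hx.1, hx.2⟩
  have hyx : ∀ s ∈ Ioo x 1, 0 < (c s).2 := fun s h =>
    hy' s ⟨he.1.trans_le (hx.1.trans h.1.le), h.2⟩
  refine ⟨0, p, q', e, x, 1, hpiece, hpiece', ?_, (hpq.trans_le hqq').le, hx.1⟩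
  refine isPiece_of_reaches hb.ne' hc rightHalf_ne hx1.1.le hx.2 le_rfl
    (fun s h => (hyx s h).ne') (fun s h => ?_) (v := .V5) (w := .V1) (by rw [hs0]; simp)
    (by rw [hs0]; simp) (Or.inr ⟨hc.reaches_nu rightHalf_ne hx1 hx0, reaches_sigma_V5 hb.ne' h1⟩)
  rw [hs0]
  exact sigma_mem_leftHalf (Or.inr ⟨hn' s h, hyx s h⟩)

/-- The stretch between ν = 0 and the first axis crossing is sent to the left half plane, from V₁ to
V₄. This is an s-arc only if b < 0. -/
theorem exists_pieces_three (ha : a < -1) (hb : b ≠ 0) (hc : IsHalfPath c rightHalf)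
    (h0 : Reaches b (Es a) (𝓝[>] 0) c .V1) (h1 : Reaches b (Es a) (𝓝[<] 1) c .V3top) :
    ∃ p q e f e' f', IsPiece a b c 3 p q ∧ (b < 0 → IsPiece a b c 0 e f) ∧ IsPiece a b c 2 e' f' ∧
      q ≤ e ∧ f ≤ e' ∧ q ≤ e' := by
  have hend := near_V3top h1
  obtain ⟨p, q, q', hp, hpq, hqq', hq'1, hp0, hq0, hq'0, hpiece, hy, hy'⟩ :=
    exists_crossings_of_V1 ha hb hc h0 (hend.mono fun s => And.left)
  have hq' : q' ∈ Ioo (0 : ℝ) 1 := ⟨hp.trans (hpq.trans_le hqq'), hq'1⟩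
  have hq : q ∈ Ioo (0 : ℝ) 1 := ⟨hp.trans hpq, hqq'.trans_lt hq'1⟩
  obtain ⟨e, he, hpiece', -, -⟩ := exists_piece_after_axis (a := a) hb hc hq' hq'0 hy'
    (Or.inr (reaches_sigma_V3top h1))
  have hmid : ∃ x ∈ Ico p q, b < 0 → IsPiece a b c 0 x q := by
    by_cases hb' : b < 0
    · obtain ⟨x, hx, h⟩ := exists_piece_before_axis (a := a) hb' hc rightHalf_ne
        ⟨hp, hpq.trans hq.2⟩ hq hpq hp0 hq0 (Or.inl ⟨by
          rw [nu_of_snd_eq_zero hq0]; exact hc.mem q hq, fun s hs => hy s ⟨hp.trans hs.1, hs.2⟩⟩)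
      exact ⟨x, hx, fun _ => h⟩
    -- For b > 0 the middle stretch is not used; p only keeps the order relations true.
    · exact ⟨p, ⟨le_rfl, hpq⟩, fun h => absurd h hb'⟩
  obtain ⟨x, hx, hx0⟩ := hmid
  exact ⟨0, p, x, q, q', e, hpiece, hx0, hpiece', hx.1, hqq', (hpq.trans_le hqq').le⟩

/-- In the left half plane ν = x < 0 on the axis, whereas ν > 0 near V₅ when b < 0: again ν vanishes
before the axis is reached. -/
theorem exists_pieces_neg_zero (ha : a < -1) (hb : b < 0) (hc : IsHalfPath c leftHalf)
    (h0 : Reaches b (Es a) (𝓝[>] 0) c .V5)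
    (h1 : Reaches b (Es a) (𝓝[<] 1) c .V1 ∨ Reaches b (Es a) (𝓝[<] 1) c .V4) :
    ∃ p q p' q', IsPiece a b c 1 p q ∧ IsPiece a b c 0 p' q' ∧ q ≤ p' := by
  have hs1 : sType b 1 = ⟨rightHalf, {.V1}, {.V5}⟩ := by
    unfold sType; rw [if_neg hb.not_gt]
  have hstart := near_V5_left_neg hb h0 (eventually_mem_right hc)
  have hend : ∀ᶠ s in 𝓝[<] (1 : ℝ), (c s).2 < 0 := by
    rcases h1 with h1 | h1
    · exact (near_V1 ha h1).mono fun s => And.left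
    · exact near_V4 ha h1
  obtain ⟨r, hr, hr0⟩ := exists_mem_of_eventually_left hend one_pos
  obtain ⟨q, hq, hq0, hy⟩ := exists_first_zero' hr.1
    (hc.contOn_snd.mono fun s hs => ⟨hs.1, hs.2.trans_lt hr.2⟩)
    (hstart.mono fun s => And.left) hr0.le
  have hq1 : q ∈ Ioo (0 : ℝ) 1 := ⟨hq.1, hq.2.trans_lt hr.2⟩
  have hnq : nu (c q) < 0 := by
    rw [nu_of_snd_eq_zero hq0]; exact hc.mem q hq1
  obtain ⟨p, hp, hp0, hn⟩ := exists_first_zero' hq.1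
    (hc.contOn_nu.mono fun s hs => ⟨hs.1, hs.2.trans_lt hq1.2⟩)
    (hstart.mono fun s => And.right) hnq.le
  have hpq : p < q := lt_of_le_of_ne hp.2 fun h => by
    rw [h] at hp0; exact hnq.ne hp0
  have hp1 : p ∈ Ioo (0 : ℝ) 1 := ⟨hp.1, hpq.trans hq1.2⟩
  have hy1 : ∀ s ∈ Ioo 0 p, 0 < (c s).2 := fun s h => hy s ⟨h.1, h.2.trans hpq⟩
  obtain ⟨x, hx, hpiece⟩ := exists_piece_before_axis (a := a) hb hc leftHalf_ne hp1 hq1 hpq hp0 hq0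
    (Or.inr ⟨hnq, fun s hs => hy s ⟨hp.1.trans hs.1, hs.2⟩⟩)
  refine ⟨0, p, x, q, ?_, hpiece, hx.1⟩
  refine isPiece_of_reaches hb.ne hc leftHalf_ne le_rfl hp.1 hp1.2.le
    (fun s h => (hy1 s h).ne') (fun s h => ?_) (v := .V1) (w := .V5) (by rw [hs1]; simp)
    (by rw [hs1]; simp) (Or.inr ⟨reaches_sigma_V5 hb.ne h0, hc.reaches_nu leftHalf_ne hp1 hp0⟩)
  rw [hs1]
  exact sigma_mem_rightHalf (Or.inl ⟨hn s h, hy1 s h⟩)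

/-- The second stretch starts at a zero of ν with ν > 0 > y after it. It stops at the first axis
crossing, or at the end of the arc if there is none; both are sent to V₄. -/
theorem exists_pieces_neg_one (ha : a < -1) (hb : b < 0) (hc : IsHalfPath c rightHalf)
    (h0 : Reaches b (Es a) (𝓝[>] 0) c .V1) (h1 : Reaches b (Es a) (𝓝[<] 1) c .V4) :
    ∃ p q p' q', IsPiece a b c 3 p q ∧ IsPiece a b c 0 p' q' ∧ q ≤ p' := by
  have hs0 : sType b 0 = ⟨leftHalf, {.V4}, {.V1, .V5}⟩ := by
    unfold sType; rw [if_neg hb.not_gt]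
  have hstart := near_V1 ha h0
  have hendn := nu_near_V4 ha h1 (eventually_mem_left hc)
  by_cases hex : ∃ r ∈ Ioo (0 : ℝ) 1, 0 ≤ (c r).2
  · obtain ⟨r, hr, hr0⟩ := hex
    obtain ⟨q, hq, hq0, hy⟩ := exists_first_zero hr.1
      (hc.contOn_snd.mono fun s hs => ⟨hs.1, hs.2.trans_lt hr.2⟩)
      (hstart.mono fun s => And.left) hr0
    have hq1 : q ∈ Ioo (0 : ℝ) 1 := ⟨hq.1, hq.2.trans_lt hr.2⟩
    have hnq : 0 < nu (c q) := by
      rw [nu_of_snd_eq_zero hq0]; exact hc.mem q hq1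
    obtain ⟨p, hp, hp0, -, hpiece⟩ := exists_piece_start_V1 ha hb.ne hc h0 hq1 hnq.le
    have hpq : p < q := lt_of_le_of_ne hp.2 fun h => by
      rw [h] at hp0; exact hnq.ne' hp0
    obtain ⟨x, hx, hpiece'⟩ := exists_piece_before_axis (a := a) hb hc rightHalf_ne
      ⟨hp.1, hpq.trans hq1.2⟩ hq1 hpq hp0 hq0
      (Or.inl ⟨hnq, fun s hs => hy s ⟨hp.1.trans hs.1, hs.2⟩⟩)
    exact ⟨0, p, x, q, hpiece, hpiece', hx.1⟩
  · have hy : ∀ s ∈ Ioo (0 : ℝ) 1, (c s).2 < 0 := fun s hs => by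
      by_contra! h
      exact hex ⟨s, hs, h⟩
    obtain ⟨r, hr, hr0⟩ := exists_mem_of_eventually_left hendn one_pos
    obtain ⟨p, hp, hp0, -, hpiece⟩ := exists_piece_start_V1 ha hb.ne hc h0 hr hr0.le
    have hp1 : p ∈ Ioo (0 : ℝ) 1 := ⟨hp.1, hp.2.trans_lt hr.2⟩
    obtain ⟨x, hx, hx0, hn⟩ := exists_last_zero' hp1.2
      (hc.contOn_nu.mono fun s hs => ⟨hp.1.trans_le hs.1, hs.2⟩) hendn hp0.le
    have hx1 : x ∈ Ioo (0 : ℝ) 1 := ⟨hp.1.trans_le hx.1, hx.2⟩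
    have hyx : ∀ s ∈ Ioo x 1, (c s).2 < 0 := fun s h => hy s ⟨hx1.1.trans h.1, h.2⟩
    refine ⟨0, p, x, 1, hpiece, ?_, hx.1⟩
    refine isPiece_of_reaches hb.ne hc rightHalf_ne hx1.1.le hx.2 le_rfl
      (fun s h => (hyx s h).ne) (fun s h => ?_) (v := .V4) (w := .V1) (by rw [hs0]; simp)
      (by rw [hs0]; simp) (Or.inr ⟨hc.reaches_nu rightHalf_ne hx1 hx0, reaches_sigma_V4 ha h1⟩)
    rw [hs0]
    exact sigma_mem_leftHalf (Or.inl ⟨hn s h, hyx s h⟩)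

theorem exists_pieces_neg_two (ha : a < -1) (hb : b < 0) (hc : IsHalfPath c rightHalf)
    (h0 : Reaches b (Es a) (𝓝[>] 0) c .V1)
    (h1 : Reaches b (Es a) (𝓝[<] 1) c .V5 ∨ Reaches b (Es a) (𝓝[<] 1) c .V3bot) :
    ∃ p q, IsPiece a b c 3 p q := by
  have hend : ∀ᶠ s in 𝓝[<] (1 : ℝ), 0 < nu (c s) := by
    rcases h1 with h1 | h1
    · exact (near_V5_right_neg hb h1 (eventually_mem_left hc)).mono fun s => And.right
    · exact (near_V3bot h1).mono fun s => And.right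
  obtain ⟨r, hr, hr0⟩ := exists_mem_of_eventually_left hend one_pos
  obtain ⟨p, -, -, -, hpiece⟩ := exists_piece_start_V1 ha hb.ne hc h0 hr hr0.le
  exact ⟨0, p, hpiece⟩

/-- `transition b j k` says that the image of a u-arc of type `j + 1` contains one of type
`k + 1`. -/
noncomputable def transition (b : ℝ) : Fin 4 → Fin 4 → Bool :=
  if 0 < b then
    ![![false, true, false, false], ![true, false, true, false], ![true, false, true, true],
      ![false, false, true, true]]
  else
    ![![true, true, false, false], ![true, false, false, true], ![false, false, false, true],
      ![true, false, true, true]]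

theorem disjoint_Ioo_of_le {p q p' q' : ℝ} (h : q ≤ p') : Disjoint (Ioo p q) (Ioo p' q') :=
  disjoint_left.2 fun _ h1 h2 => (h1.2.trans_le h).not_gt h2.1

/-- The pieces of a path of the type of a u-arc. -/
theorem exists_pieces (ha : a < -1) (hb : b ≠ 0) (j : Fin 4)
    (hc : IsHalfPath c (uType b j).half)
    (h0 : ∃ v ∈ (uType b j).source, Reaches b (Es a) (𝓝[>] 0) c v)
    (h1 : ∃ v ∈ (uType b j).target, Reaches b (Es a) (𝓝[<] 1) c v) :
    ∃ P Q : Fin 4 → ℝ,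
      (∀ k, transition b j k = true → IsPiece a b c k (P k) (Q k)) ∧
      ∀ k k', transition b j k = true → transition b j k' = true → k < k' →
        Disjoint (Ioo (P k) (Q k)) (Ioo (P k') (Q k')) := by
  rcases hb.lt_or_gt with hb' | hb'
  · have hT : transition b = ![![true, true, false, false], ![true, false, false, true],
        ![false, false, false, true], ![true, false, true, true]] := by
      unfold transition; rw [if_neg hb'.not_gt]
    rw [hT]
    unfold uType at hc h0 h1
    rw [if_neg hb'.not_gt] at hc h0 h1
    fin_cases j
    · simp only [mem_singleton_iff, mem_insert_iff, exists_eq_left, exists_eq_or_imp] at hc h0 h1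
      obtain ⟨p, q, p', q', h, h', hle⟩ := exists_pieces_neg_zero ha hb' hc h0 h1
      -- Here and below, the zeros fill the types that do not occur in the row of the matrix.
      refine ⟨![p', p, 0, 0], ![q', q, 0, 0], ?_, ?_⟩
      · simp [Fin.forall_fin_succ, h, h']
      · simpa [Fin.forall_fin_succ] using (disjoint_Ioo_of_le hle).symm
    · simp only [mem_singleton_iff, exists_eq_left] at hc h0 h1
      obtain ⟨p, q, p', q', h, h', hle⟩ := exists_pieces_neg_one ha hb' hc h0 h1
      refine ⟨![p', 0, 0, p], ![q', 0, 0, q], ?_, ?_⟩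
      · simp [Fin.forall_fin_succ, h, h']
      · simpa [Fin.forall_fin_succ] using (disjoint_Ioo_of_le hle).symm
    · simp only [mem_singleton_iff, mem_insert_iff, exists_eq_left, exists_eq_or_imp] at hc h0 h1
      obtain ⟨p, q, h⟩ := exists_pieces_neg_two ha hb' hc h0 h1
      refine ⟨![0, 0, 0, p], ![0, 0, 0, q], ?_, ?_⟩
      · simp [Fin.forall_fin_succ, h]
      · simp [Fin.forall_fin_succ]
    · simp only [mem_singleton_iff, exists_eq_left] at hc h0 h1
      obtain ⟨p, q, e, f, e', f', h, h', h'', l1, l2, l3⟩ :=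
        exists_pieces_three ha hb hc h0 h1
      refine ⟨![e, 0, e', p], ![f, 0, f', q], ?_, ?_⟩
      · simp [Fin.forall_fin_succ, h, h' hb', h'']
      · simp [Fin.forall_fin_succ, disjoint_Ioo_of_le l2, (disjoint_Ioo_of_le l1).symm,
          (disjoint_Ioo_of_le l3).symm, -Ioo_disjoint_Ioo]
  · have hT : transition b = ![![false, true, false, false], ![true, false, true, false],
        ![true, false, true, true], ![false, false, true, true]] := by
      unfold transition; rw [if_pos hb']
    rw [hT]
    unfold uType at hc h0 h1
    rw [if_pos hb'] at hc h0 h1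
    fin_cases j
    · simp only [mem_singleton_iff, mem_insert_iff, exists_eq_left, exists_eq_or_imp] at hc h0 h1
      obtain ⟨p, q, h⟩ := exists_pieces_pos_zero ha hb' hc h0 h1
      refine ⟨![0, p, 0, 0], ![0, q, 0, 0], ?_, ?_⟩
      · simp [Fin.forall_fin_succ, h]
      · simp [Fin.forall_fin_succ]
    · simp only [mem_singleton_iff, mem_insert_iff, exists_eq_left, exists_eq_or_imp] at hc h0 h1
      obtain ⟨p, q, p', q', h, h', hle⟩ := exists_pieces_pos_one ha hb' hc h0 h1
      refine ⟨![p, 0, p', 0], ![q, 0, q', 0], ?_, ?_⟩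
      · simp [Fin.forall_fin_succ, h, h']
      · simpa [Fin.forall_fin_succ] using disjoint_Ioo_of_le hle
    · simp only [mem_singleton_iff, exists_eq_left] at hc h0 h1
      obtain ⟨p, q, p', q', p'', q'', h, h', h'', l1, l2⟩ := exists_pieces_pos_two ha hb' hc h0 h1
      have l3 : q ≤ p'' := l1.trans (h'.2.1.le.trans l2)
      refine ⟨![p'', 0, p', p], ![q'', 0, q', q], ?_, ?_⟩
      · simp [Fin.forall_fin_succ, h, h', h'']
      · simp [Fin.forall_fin_succ, (disjoint_Ioo_of_le l2).symm, (disjoint_Ioo_of_le l1).symm,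
          (disjoint_Ioo_of_le l3).symm, -Ioo_disjoint_Ioo]
    · simp only [mem_singleton_iff, exists_eq_left] at hc h0 h1
      obtain ⟨p, q, e, f, e', f', h, h', h'', l1, l2, l3⟩ :=
        exists_pieces_three ha hb hc h0 h1
      refine ⟨![0, 0, e', p], ![0, 0, f', q], ?_, ?_⟩
      · simp [Fin.forall_fin_succ, h, h'']
      · simpa [Fin.forall_fin_succ] using (disjoint_Ioo_of_le l3).symm

end

/-! ### Iteration: the numbers of arcs grow like ρⁿ. -/

section

variable {a b : ℝ}

/-! ### Reflection of paths by `τ` -/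

theorem uType_half (b : ℝ) (j : Fin 4) : (uType b j).half = (sType b j).half := by
  unfold uType sType
  split_ifs <;> fin_cases j <;> rfl

theorem mirror_source_iff {j : Fin 4} {v : Side} :
    v.mirror ∈ (uType b j).source ↔ v ∈ (sType b j).source := by
  unfold uType sType
  split_ifs <;> fin_cases j <;> cases v <;> simp [Side.mirror]

theorem mirror_target_iff {j : Fin 4} {v : Side} :
    v.mirror ∈ (uType b j).target ↔ v ∈ (sType b j).target := by
  unfold uType sType
  split_ifs <;> fin_cases j <;> cases v <;> simp [Side.mirror]

theorem sType_half_tau {j : Fin 4} {w : ℝ × ℝ} (hw : w ∈ (sType b j).half) :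
    tau a b w ∈ (uType b j).half := by
  rw [uType_half]
  revert hw
  unfold sType
  split_ifs <;> fin_cases j <;> exact id

theorem tau_injective : Function.Injective (tau a b) :=
  Function.LeftInverse.injective tau_tau

theorem IsPath.tau {c : ℝ → ℝ × ℝ} {j : Fin 4} {p q : ℝ}
    (h : IsPath b (Eu a) (sType b j) c p q) :
    IsPath b (Es a) (uType b j) (fun s => PlaneBirational.tau a b (c s)) p q := by
  obtain ⟨h1, h2, h3, v, hv, t, ht, w, hw, t', ht', h4⟩ := h
  refine ⟨continuous_tau.comp_continuousOn h1, tau_injective.comp_injOn h2,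
    fun s hs => sType_half_tau (h3 s hs), v.mirror, mirror_source_iff.2 hv, _, mirror_mem_Es ht,
    w.mirror, mirror_target_iff.2 hw, _, mirror_mem_Es ht', ?_⟩
  exact h4.imp (fun h => ⟨h.1.tau, h.2.tau⟩) fun h => ⟨h.1.tau, h.2.tau⟩

/-! ### Maps under which arcs multiply -/

/-- The plane map `g`, regular on `D`, takes pieces of the interior of an arc of type `T j` to
interiors of arcs of the types `T k` with `tr j k`. -/
structure ArcSystem (b : ℝ) (E : Side → Set EReal) (T : Fin 4 → ArcType) (D : Set (ℝ × ℝ))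
    (g : ℝ × ℝ → ℝ × ℝ) (tr : Fin 4 → Fin 4 → Bool) : Prop where
  proper : ∀ j, (T j).IsProper b
  cont : ∀ w ∈ D, ContinuousAt g w
  ne : ∀ w ∈ D, w.1 ≠ 0
  inj : ∀ w ∈ D, ∀ w' ∈ D, g w = g w' → (g w).1 ≠ 0 → w = w'
  pieces : ∀ j c, IsHalfPath c (T j).half → (∃ v ∈ (T j).source, Reaches b E (𝓝[>] 0) c v) →
    (∃ v ∈ (T j).target, Reaches b E (𝓝[<] 1) c v) → ∃ P Q : Fin 4 → ℝ,
      (∀ k, tr j k = true → 0 ≤ P k ∧ P k < Q k ∧ Q k ≤ 1 ∧ (∀ s ∈ Ioo (P k) (Q k), c s ∈ D) ∧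
        IsPath b E (T k) (fun s => g (c s)) (P k) (Q k)) ∧
      ∀ k k', tr j k = true → tr j k' = true → k < k' →
        Disjoint (Ioo (P k) (Q k)) (Ioo (P k') (Q k'))

/-- For f = τ ∘ σ the s-arcs produced by σ are reflected afterwards; for f⁻¹ = σ ∘ τ the s-arc is
reflected to a u-arc beforehand. So both directions have the same matrix. -/
theorem arcSystem_u (ha : a < -1) (hb : b ≠ 0) :
    ArcSystem b (Es a) (uType b) torusPart (tau a b ∘ sigma) (transition b) where
  proper := uType_isProper hb
  cont w hw := continuous_tau.continuousAt.comp (continuousAt_sigma hw)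
  ne w hw := hw.1
  inj w hw w' hw' h hX := sigma_injOn hw hw' (tau_injective h) hX
  pieces j c hc h0 h1 := by
    obtain ⟨P, Q, hP, hd⟩ := exists_pieces ha hb j hc h0 h1
    refine ⟨P, Q, fun k hk => ?_, hd⟩
    obtain ⟨e1, e2, e3, e4, e5⟩ := hP k hk
    exact ⟨e1, e2, e3, e4, e5.tau⟩

theorem arcSystem_s (ha : a < -1) (hb : b ≠ 0) :
    ArcSystem b (Eu a) (sType b) (tau a b ⁻¹' torusPart) (sigma ∘ tau a b) (transition b) where
  proper := sType_isProper hb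
  cont w hw := (continuousAt_sigma hw).comp continuous_tau.continuousAt
  ne w hw := hw.1
  inj w hw w' hw' h hX := tau_injective (sigma_injOn hw hw' h hX)
  pieces j c hc h0 h1 := by
    obtain ⟨v, hv, h0⟩ := h0
    obtain ⟨w, hw, h1⟩ := h1
    obtain ⟨P, Q, hP, hd⟩ := exists_pieces (c := fun s => tau a b (c s)) ha hb j
      ⟨continuous_tau.comp_continuousOn hc.cont, tau_injective.comp_injOn hc.inj,
        fun s hs => sType_half_tau (hc.mem s hs)⟩
      ⟨_, mirror_source_iff.2 hv, h0.tau_of_Eu⟩ ⟨_, mirror_target_iff.2 hw, h1.tau_of_Eu⟩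
    exact ⟨P, Q, hP, hd⟩

section Growth

variable {E : Side → Set EReal} {T : Fin 4 → ArcType} {D : Set (ℝ × ℝ)}
  {g : ℝ × ℝ → ℝ × ℝ} {tr : Fin 4 → Fin 4 → Bool}

/-- The arcs in the image of an arc. -/
theorem ArcSystem.exists_arcs (hS : ArcSystem b E T D g tr) {j : Fin 4} {A : Set (XR b)}
    (hA : IsArcOfType b E (T j) A) (hind : Disjoint A (indet b D g)) :
    ∃ B : Fin 4 → Set (XR b), (∀ k, tr j k = true → IsArcOfType b E (T k) (B k) ∧
        B k ⊆ extend b D g '' A ∧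
        B k \ curvesV b ⊆ (fun w => incl b (g w)) '' {w | w ∈ D ∧ incl b w ∈ A}) ∧
      ∀ k k', tr j k = true → tr j k' = true → k ≠ k' → B k ∩ B k' ⊆ curvesV b := by
  obtain ⟨α, c, hα, rfl, hαc, hcont, hinj, hhalf, h0, h1⟩ := hA.exists_path
  obtain ⟨P, Q, hP, hd⟩ := hS.pieces j c ⟨hcont, hinj, hhalf⟩ h0 h1
  have hsub : ∀ k, tr j k = true → Icc (P k) (Q k) ⊆ Icc 0 1 := fun k hk =>
    Icc_subset_Icc (hP k hk).1 (hP k hk).2.2.1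
  have hsubo : ∀ k, tr j k = true → Ioo (P k) (Q k) ⊆ Ioo 0 1 := fun k hk =>
    Ioo_subset_Ioo (hP k hk).1 (hP k hk).2.2.1
  have harc := fun k (hk : tr j k = true) => isArcOfType_extend (hS.proper k) hS.cont
    (hP k hk).2.1 (hα.mono (hsub k hk)) (fun s hs => hαc s (hsubo k hk hs))
    (fun s hs => disjoint_left.1 hind (mem_image_of_mem α (hsub k hk hs))) (hP k hk).2.2.2.1
    (hP k hk).2.2.2.2
  -- Off the Vⱼ a point of the image comes from an interior parameter, so injectivity of g on D
  -- applies to it.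
  have hpt : ∀ k, tr j k = true → ∀ x ∈ extend b D g '' (α '' Icc (P k) (Q k)), x ∉ curvesV b →
      ∃ s ∈ Ioo (P k) (Q k), x = incl b (g (c s)) := by
    rintro k hk _ ⟨_, ⟨s, hs, rfl⟩, rfl⟩ hx
    have hs1 : s ≠ P k := fun h => hx (h ▸ (harc k hk).2.1)
    have hs2 : s ≠ Q k := fun h => hx (h ▸ (harc k hk).2.2)
    have hs' : s ∈ Ioo (P k) (Q k) := ⟨lt_of_le_of_ne hs.1 hs1.symm, lt_of_le_of_ne hs.2 hs2⟩
    have hsD := (hP k hk).2.2.2.1 s hs'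
    exact ⟨s, hs', by rw [hαc s (hsubo k hk hs'), extend_incl hsD (hS.cont _ hsD)]⟩
  have hlt : ∀ k k', tr j k = true → tr j k' = true → k < k' →
      (extend b D g '' (α '' Icc (P k) (Q k))) ∩ (extend b D g '' (α '' Icc (P k') (Q k'))) ⊆
        curvesV b := by
    rintro k k' hk hk' hkk' x ⟨hx, hx'⟩
    by_contra hxV
    obtain ⟨s, hs, rfl⟩ := hpt k hk x hx hxV
    obtain ⟨s', hs', h⟩ := hpt k' hk' _ hx' hxV
    have e := hS.inj _ ((hP k hk).2.2.2.1 s hs) _ ((hP k' hk').2.2.2.1 s' hs')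
      (incl_injective h) (fun h => hxV (incl_mem_curvesV_iff.2 h))
    have e' := hinj (hsubo k hk hs) (hsubo k' hk' hs') e
    exact disjoint_left.1 (hd k k' hk hk' hkk') hs (e' ▸ hs')
  refine ⟨fun k => extend b D g '' (α '' Icc (P k) (Q k)), fun k hk => ⟨(harc k hk).1,
    image_mono (image_mono (hsub k hk)), ?_⟩, fun k k' hk hk' hne => ?_⟩
  · rintro x ⟨hx, hxV⟩
    obtain ⟨s, hs, rfl⟩ := hpt k hk x hx hxV
    refine ⟨c s, ⟨(hP k hk).2.2.2.1 s hs, ?_⟩, rfl⟩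
    rw [← hαc s (hsubo k hk hs)]
    exact mem_image_of_mem α (Ioo_subset_Icc_self (hsubo k hk hs))
  · rcases hne.lt_or_gt with h | h
    · exact hlt k k' hk hk' h
    · rw [inter_comm]; exact hlt k' k hk' hk h

/-- The set `S` contains `m j` arcs of type `T j` for every `j`, and these arcs are pairwise
distinct. -/
def HasArcs (b : ℝ) (E : Side → Set EReal) (T : Fin 4 → ArcType) (S : Set (XR b))
    (m : Fin 4 → ℕ) : Prop :=
  ∃ (ι : Type) (_ : Fintype ι) (typ : ι → Fin 4) (A : ι → Set (XR b)),
    (∀ i, IsArcOfType b E (T (typ i)) (A i)) ∧ (∀ i, A i ⊆ S) ∧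
    (∀ i i', i ≠ i' → A i ∩ A i' ⊆ curvesV b) ∧
    ∀ j, m j ≤ (Finset.univ.filter fun i => typ i = j).card

/-- The numbers of arcs after one more step. -/
def stepCount (tr : Fin 4 → Fin 4 → Bool) (m : Fin 4 → ℕ) : Fin 4 → ℕ :=
  fun k => ∑ j, if tr j k then m j else 0

theorem hasArcs_single {S A : Set (XR b)} {j : Fin 4} (hA : IsArcOfType b E (T j) A)
    (hAS : A ⊆ S) : HasArcs b E T S (Pi.single j 1) := by
  refine ⟨Unit, inferInstance, fun _ => j, fun _ => A, fun _ => hA, fun _ => hAS,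
    fun i i' h => absurd (Subsingleton.elim i i') h, fun k => ?_⟩
  by_cases h : j = k
  · subst h; simp
  · simp [Ne.symm h]

/-- A common point, off the Vⱼ, of images of two old arcs has the same plane preimage in D on both.
There x ≠ 0, so the old arcs would meet off the Vⱼ. -/
theorem ArcSystem.hasArcs_step (hS : ArcSystem b E T D g tr) {S : Set (XR b)} {m : Fin 4 → ℕ}
    (h : HasArcs b E T S m) (hind : Disjoint S (indet b D g)) :
    HasArcs b E T (extend b D g '' S) (stepCount tr m) := by
  classical
  obtain ⟨ι, _, typ, A, hA, hAS, hdisj, hm⟩ := h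
  choose B hB hBB using fun i => hS.exists_arcs (hA i) (hind.mono_left (hAS i))
  refine ⟨{x : ι × Fin 4 // tr (typ x.1) x.2 = true}, inferInstance, fun x => x.1.2,
    fun x => B x.1.1 x.1.2, fun x => (hB _ _ x.2).1,
    fun x => (hB _ _ x.2).2.1.trans (image_mono (hAS _)), ?_, fun k => ?_⟩
  · rintro ⟨⟨i, k⟩, hk⟩ ⟨⟨i', k'⟩, hk'⟩ hne
    by_cases hi : i = i'
    · subst hi
      exact hBB i k k' hk hk' fun h => hne (by simp [h])
    · rintro x ⟨hx, hx'⟩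
      by_contra hxV
      obtain ⟨w, ⟨hwD, hwA⟩, rfl⟩ := (hB i k hk).2.2 ⟨hx, hxV⟩
      obtain ⟨w', ⟨hwD', hwA'⟩, h⟩ := (hB i' k' hk').2.2 ⟨hx', hxV⟩
      have e := hS.inj w hwD w' hwD' (incl_injective h).symm
        fun h => hxV (incl_mem_curvesV_iff.2 h)
      subst e
      exact hS.ne w hwD (incl_mem_curvesV_iff.1 (hdisj i i' hi ⟨hwA, hwA'⟩))
  · have h1 : (Finset.univ.filter fun x : {x : ι × Fin 4 // tr (typ x.1) x.2 = true} =>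
        x.1.2 = k).card = (Finset.univ.filter fun i => tr (typ i) k = true).card := by
      refine (Finset.card_bij (fun i hi => ⟨(i, k), (Finset.mem_filter.1 hi).2⟩) ?_ ?_ ?_).symm
      · intro i hi; simp
      · intro i hi i' hi' h
        simpa using h
      · rintro ⟨⟨i, k'⟩, hk⟩ hx
        obtain rfl : k' = k := by simpa using hx
        exact ⟨i, by simpa using hk, rfl⟩
    -- The new arcs of type k correspond to the old arcs whose type leads to k; these are counted by
    -- old type.
    rw [h1, Finset.card_filter, ← Finset.sum_fiberwise Finset.univ typ]
    refine Finset.sum_le_sum fun j _ => ?_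
    have : ∀ i ∈ Finset.univ.filter fun i => typ i = j,
        (if tr (typ i) k = true then 1 else 0) = if tr j k = true then 1 else 0 := fun i hi => by
      rw [(Finset.mem_filter.1 hi).2]
    rw [Finset.sum_congr rfl this]
    split_ifs
    · simpa using hm j
    · simp

theorem ArcSystem.hasArcs_iterate (hS : ArcSystem b E T D g tr) {S : Set (XR b)} {m : Fin 4 → ℕ}
    (h : HasArcs b E T S m)
    (hind : Disjoint S (⋃ n : ℕ, (extend b D g)^[n] ⁻¹' indet b D g)) (n : ℕ) :
    HasArcs b E T ((extend b D g)^[n] '' S) ((stepCount tr)^[n] m) := by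
  induction n with
  | zero => simpa using h
  | succ n ih =>
    rw [Function.iterate_succ', Function.iterate_succ', image_comp]
    refine hS.hasArcs_step ih (disjoint_left.2 ?_)
    rintro _ ⟨x, hx, rfl⟩ hx'
    exact disjoint_left.1 hind hx (mem_iUnion.2 ⟨n, hx'⟩)

end Growth

/-! ### Growth of the numbers of arcs -/

/-- The matrix is primitive: its sixth power has no zero entry, so a single arc of any type produces
all types. -/
theorem stepCount_pos (b : ℝ) (j k : Fin 4) :
    1 ≤ (stepCount (transition b))^[6] (Pi.single j 1) k := by
  unfold transition
  split_ifs
  · revert j k; decide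
  · revert j k; decide

/-- The cubic is −1 at 2 and 11 at 3. The bound makes ρ² − ρ − 1 and the other entries of the
eigenvector positive. -/
theorem two_le_of_isGreatest {ρ : ℝ}
    (hρ : IsGreatest {x : ℝ | x ^ 3 - x ^ 2 - 2 * x - 1 = 0} ρ) : 2 ≤ ρ := by
  have hc : ContinuousOn (fun x : ℝ => x ^ 3 - x ^ 2 - 2 * x - 1) (Icc 2 3) := by fun_prop
  obtain ⟨x, hx, hx0⟩ := intermediate_value_Icc (by norm_num : (2 : ℝ) ≤ 3) hc
    (show (0 : ℝ) ∈ Icc _ _ by norm_num)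
  exact hx.1.trans (hρ.2 hx0)

/-- A positive eigenvector of the transition matrix. -/
theorem exists_eigenvector (b : ℝ) {ρ : ℝ}
    (hρ : IsGreatest {x : ℝ | x ^ 3 - x ^ 2 - 2 * x - 1 = 0} ρ) :
    ∃ v : Fin 4 → ℝ, (∀ k, 0 < v k) ∧
      ∀ k, ρ * v k = ∑ j, if transition b j k then v j else 0 := by
  have h2 := two_le_of_isGreatest hρ
  have h0 : ρ ^ 3 - ρ ^ 2 - 2 * ρ - 1 = 0 := hρ.1
  have hpos : 0 < ρ := by linarith
  have h4 : 0 < ρ ^ 2 - ρ - 1 := by nlinarith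
  unfold transition
  split_ifs
  -- The second entry is normalized to 1 and three equations are solved in turn; the remaining one
  -- is the cubic, or (ρ − 1) times it when b < 0.
  · refine ⟨![ρ, 1, ρ ^ 2 - 1, ρ + 1], ?_, ?_⟩
    · simp only [Fin.forall_fin_succ, Fin.isValue, Matrix.cons_val_zero, Matrix.cons_val_succ,
        IsEmpty.forall_iff, and_true]
      exact ⟨hpos, one_pos, by nlinarith, by linarith⟩
    · simp only [Fin.forall_fin_succ, Fin.sum_univ_succ, Fin.isValue, Matrix.cons_val_zero,
        Matrix.cons_val_succ, IsEmpty.forall_iff, and_true]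
      norm_num
      refine ⟨?_, ?_, ?_⟩ <;> linarith
  · refine ⟨![ρ, 1, (ρ ^ 2 - ρ - 1) / ρ, ρ ^ 2 - ρ - 1], ?_, ?_⟩
    · simp only [Fin.forall_fin_succ, Fin.isValue, Matrix.cons_val_zero, Matrix.cons_val_succ,
        IsEmpty.forall_iff, and_true]
      exact ⟨hpos, one_pos, by positivity, h4⟩
    · simp only [Fin.forall_fin_succ, Fin.sum_univ_succ, Fin.isValue, Matrix.cons_val_zero,
        Matrix.cons_val_succ, IsEmpty.forall_iff, and_true]
      norm_num
      refine ⟨?_, ?_, ?_⟩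
      · ring
      · field_simp
      · field_simp
        linear_combination (ρ - 1) * h0

/-- After six steps the counts dominate the eigenvector divided by its largest entry. A nonnegative
matrix preserves this comparison, and each further step contributes a factor ρ. -/
theorem exists_stepCount_lower_bound (b : ℝ) {ρ : ℝ}
    (hρ : IsGreatest {x : ℝ | x ^ 3 - x ^ 2 - 2 * x - 1 = 0} ρ) (j : Fin 4) :
    ∃ c : ℝ, 0 < c ∧ ∀ n ≥ 6, ∀ k,
      c * ρ ^ n ≤ ((stepCount (transition b))^[n] (Pi.single j 1) k : ℕ) := by
  obtain ⟨v, hv, hev⟩ := exists_eigenvector b hρ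
  have hpos : 0 < ρ := by linarith [two_le_of_isGreatest hρ]
  obtain ⟨kmax, hmax⟩ := Finite.exists_max v
  obtain ⟨kmin, hmin⟩ := Finite.exists_min v
  have key : ∀ n k, v k / v kmax * ρ ^ n ≤
      ((stepCount (transition b))^[n + 6] (Pi.single j 1) k : ℕ) := by
    intro n
    induction n with
    | zero =>
      intro k
      have h1 : (1 : ℝ) ≤ ((stepCount (transition b))^[6] (Pi.single j 1) k : ℕ) := by
        exact_mod_cast stepCount_pos b j k
      rw [pow_zero, mul_one, zero_add]
      exact ((div_le_one (hv kmax)).2 (hmax k)).trans h1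
    | succ n ih =>
      intro k
      rw [add_right_comm, Function.iterate_succ_apply']
      simp only [stepCount]
      push_cast
      calc v k / v kmax * ρ ^ (n + 1) = ρ * v k / v kmax * ρ ^ n := by ring
        _ = ∑ i, (if transition b i k then v i else 0) / v kmax * ρ ^ n := by
          rw [hev, Finset.sum_div, Finset.sum_mul]
        _ ≤ _ := by
          refine Finset.sum_le_sum fun i _ => ?_
          split_ifs
          · exact ih i
          · simp
  refine ⟨v kmin / v kmax / ρ ^ 6, by have := hv kmin; have := hv kmax; positivity,
    fun n hn k => ?_⟩
  obtain ⟨n, rfl⟩ := Nat.exists_eq_add_of_le' hn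
  refine le_trans ?_ (key n k)
  have h1 : v kmin / v kmax / ρ ^ 6 * ρ ^ (n + 6) = v kmin / v kmax * ρ ^ n := by
    rw [pow_add]; field_simp
  rw [h1]
  gcongr
  · exact (hv kmax).le
  · exact hmin k

/-- The indexed arcs are different as sets, because each has points off the Vⱼ while two of them
meet only on the Vⱼ. -/
theorem HasArcs.le_uCount {S : Set (XR b)} {m : Fin 4 → ℕ} (hb : b ≠ 0)
    (h : HasArcs b (Es a) (uType b) S m) (j : Fin 4) : (m j : ℕ∞) ≤ uCount a b j S := by
  classical
  obtain ⟨ι, _, typ, A, hA, hAS, hdisj, hm⟩ := h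
  have hne : ∀ i, ∃ x ∈ A i, x ∉ curvesV b := by
    intro i
    obtain ⟨α, c, h1, h2, h3, h4, -⟩ := hA i
    have hs : (1 / 2 : ℝ) ∈ Ioo (0 : ℝ) 1 := by norm_num
    refine ⟨α (1 / 2), h3 ▸ mem_image_of_mem α (Ioo_subset_Icc_self hs), ?_⟩
    rw [(h4 _ hs).2, incl_mem_curvesV_iff]
    exact (uType_isProper hb _).half_ne _ (h4 _ hs).1
  have hinj : Function.Injective A := by
    intro i i' h
    by_contra hii
    obtain ⟨x, hx, hxV⟩ := hne i
    exact hxV (hdisj i i' hii ⟨hx, h ▸ hx⟩)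
  set F : Finset (Set (XR b)) := (Finset.univ.filter fun i => typ i = j).image A with hF
  have hcard : F.card = (Finset.univ.filter fun i => typ i = j).card :=
    Finset.card_image_of_injective _ hinj
  have hFmem : (F : Set (Set (XR b))) ∈ {𝒜 : Set (Set (XR b)) | (∀ A ∈ 𝒜, IsUArc a b j A ∧ A ⊆ S) ∧
      𝒜.Pairwise fun A B => A ∩ B ⊆ curvesV b} := by
    refine ⟨?_, ?_⟩
    · intro X hX
      obtain ⟨i, hi, rfl⟩ := Finset.mem_image.1 (Finset.mem_coe.1 hX)
      have := (Finset.mem_filter.1 hi).2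
      exact ⟨this ▸ hA i, hAS i⟩
    · intro X hX Y hY hXY
      obtain ⟨i, -, rfl⟩ := Finset.mem_image.1 (Finset.mem_coe.1 hX)
      obtain ⟨i', -, rfl⟩ := Finset.mem_image.1 (Finset.mem_coe.1 hY)
      exact hdisj i i' fun h => hXY (by rw [h])
  calc (m j : ℕ∞) ≤ (F.card : ℕ∞) := by rw [hcard]; exact_mod_cast hm j
    _ = (F : Set (Set (XR b))).encard := (Set.encard_coe_eq_coe_finsetCard F).symm
    _ ≤ uCount a b j S := le_biSup (fun 𝒜 : Set (Set (XR b)) => 𝒜.encard) hFmem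

end

/-! ### Length and intersection numbers from the arcs of type 4. -/

section

variable {a b : ℝ}

/-! ### Length -/

/-- In a metric space, arcs that join two disjoint compact sets and that have disjoint interiors
contribute a fixed amount each to the length of a curve that contains them. -/
theorem exists_length_bound_of_arcs {X : Type*} [MetricSpace X] {K₀ K₁ : Set X}
    (hK₀ : IsCompact K₀) (hK₁ : IsClosed K₁) (hK : Disjoint K₀ K₁) :
    ∃ δ : ℝ, 0 < δ ∧ ∀ {ι : Type} [Fintype ι] (α : ι → ℝ → X),
      (∀ i, ContinuousOn (α i) (Icc 0 1)) → (∀ i, α i 0 ∈ K₀) → (∀ i, α i 1 ∈ K₁) →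
      (∀ i i', i ≠ i' → ∀ s ∈ Ioo (0 : ℝ) 1, ∀ s' ∈ Ioo (0 : ℝ) 1, α i s ≠ α i' s') →
      ∀ (I : Set ℝ) (g : ℝ → X), (∀ i, α i '' Icc 0 1 ⊆ g '' I) →
        ENNReal.ofReal (δ * Fintype.card ι) ≤ eVariationOn g I := by
  classical
  obtain ⟨r, hr, hrK⟩ := Metric.exists_pos_forall_lt_edist hK₀ hK₁ hK
  have hr' : (0 : ℝ) < r := by exact_mod_cast hr
  have hdist : ∀ x ∈ K₀, ∀ y ∈ K₁, (r : ℝ) < dist x y := fun x hx y hy => by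
    have := hrK x hx y hy
    rw [edist_nndist, ENNReal.coe_lt_coe] at this
    exact_mod_cast this
  refine ⟨r / 2, by positivity, fun {ι} _ α hα h0 h1 hdisj I g hsub => ?_⟩
  rcases isEmpty_or_nonempty ι with hι | hι
  · simp
  -- shorten the arcs
  have hshort : ∀ i, ∃ u v : ℝ, 0 < u ∧ u ≤ v ∧ v < 1 ∧ (r : ℝ) / 2 ≤ dist (α i u) (α i v) := by
    intro i
    have hc0 := (Metric.tendsto_nhds.1 (((hα i) 0 (left_mem_Icc.2 zero_le_one)).mono
      Ioo_subset_Icc_self) (r / 4) (by positivity))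
    rw [nhdsWithin_Ioo_eq_nhdsGT one_pos] at hc0
    have hc1 := (Metric.tendsto_nhds.1 (((hα i) 1 (right_mem_Icc.2 zero_le_one)).mono
      Ioo_subset_Icc_self) (r / 4) (by positivity))
    rw [nhdsWithin_Ioo_eq_nhdsLT one_pos] at hc1
    obtain ⟨u, hu, hu'⟩ := (hc0.and (Ioo_mem_nhdsGT (show (0 : ℝ) < 1 / 2 by norm_num))).exists
    obtain ⟨v, hv, hv'⟩ := (hc1.and (Ioo_mem_nhdsLT (show (1 / 2 : ℝ) < 1 by norm_num))).exists
    refine ⟨u, v, hu'.1, (hu'.2.trans hv'.1).le, hv'.2, ?_⟩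
    have h2 := hdist _ (h0 i) _ (h1 i)
    have h3 := dist_triangle4 (α i 0) (α i u) (α i v) (α i 1)
    rw [dist_comm] at hu
    linarith
  choose u v hu huv hv huvd using hshort
  have hsubI : ∀ i, Icc (u i) (v i) ⊆ Ioo 0 1 := fun i s hs =>
    ⟨(hu i).trans_le hs.1, hs.2.trans_lt (hv i)⟩
  have hcont : ∀ i, ContinuousOn (α i) (Icc (u i) (v i)) := fun i =>
    (hα i).mono ((hsubI i).trans Ioo_subset_Icc_self)
  have hcomp : ∀ i, IsCompact (α i '' Icc (u i) (v i)) := fun i =>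
    isCompact_Icc.image_of_continuousOn (hcont i)
  -- The shortened arcs are finitely many disjoint compact sets, hence at least some η apart. No
  -- uniform η is needed: it affects only the number M of points, not the final bound.
  have hsep : ∀ p : ι × ι, ∀ᶠ η in 𝓝[>] (0 : ℝ), p.1 ≠ p.2 →
      ∀ x ∈ α p.1 '' Icc (u p.1) (v p.1), ∀ y ∈ α p.2 '' Icc (u p.2) (v p.2), η ≤ dist x y := by
    rintro ⟨i, i'⟩
    by_cases hii : i = i'
    · exact Eventually.of_forall fun η h => absurd hii h
    obtain ⟨q, hq, hqd⟩ := Metric.exists_pos_forall_lt_edist (hcomp i) (hcomp i').isClosed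
      (disjoint_left.2 (by
        rintro _ ⟨s, hs, rfl⟩ ⟨s', hs', h⟩
        exact hdisj i i' hii s (hsubI i hs) s' (hsubI i' hs') h.symm))
    have hq' : (0 : ℝ) < q := by exact_mod_cast hq
    filter_upwards [Ioo_mem_nhdsGT hq'] with η hη _ x hx y hy
    have := hqd x hx y hy
    rw [edist_nndist, ENNReal.coe_lt_coe] at this
    exact hη.2.le.trans (by exact_mod_cast this.le)
  obtain ⟨η, hη, hη0⟩ := ((eventually_all.2 hsep).and self_mem_nhdsWithin).exists
  have hη0 : 0 < η := hη0
  obtain ⟨M, hM⟩ := exists_nat_gt ((r : ℝ) / 2 / η)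
  have hM0 : (0 : ℝ) < M := lt_trans (by positivity) hM
  set ε : ℝ := r / 2 / M with hε
  have hε0 : 0 < ε := by positivity
  have hεη : ε ≤ η := by
    rw [hε, div_le_iff₀ hM0]
    rw [div_lt_iff₀ hη0] at hM
    linarith
  -- On each arc, points at distances 0, ε, …, Mε = r/2 from its beginning; by ε ≤ η all points on
  -- all arcs are ε-separated.
  have hpts : ∀ x : ι × Fin (M + 1), ∃ s ∈ Icc (u x.1) (v x.1),
      dist (α x.1 (u x.1)) (α x.1 s) = (x.2 : ℕ) * ε := by
    rintro ⟨i, k⟩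
    have hc : ContinuousOn (fun s => dist (α i (u i)) (α i s)) (Icc (u i) (v i)) :=
      (continuous_const.dist continuous_id).comp_continuousOn (hcont i)
    have hk : ((k : ℕ) : ℝ) ≤ M := by exact_mod_cast Nat.lt_succ_iff.1 k.2
    have hle : ((k : ℕ) : ℝ) * ε ≤ dist (α i (u i)) (α i (v i)) := by
      refine le_trans ?_ (huvd i)
      calc ((k : ℕ) : ℝ) * ε ≤ M * ε := by gcongr
        _ = r / 2 := by rw [hε]; field_simp
    exact intermediate_value_Icc (huv i) hc ⟨by simpa using by positivity, hle⟩
  choose s hs hsd using hpts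
  let pt : ι × Fin (M + 1) → X := fun x => α x.1 (s x)
  have hptd : ∀ x y, x ≠ y → ε ≤ dist (pt x) (pt y) := by
    rintro ⟨i, k⟩ ⟨i', k'⟩ hne
    by_cases hii : i = i'
    · subst hii
      have hkk : (k : ℕ) ≠ k' := fun h => hne (by rw [Fin.ext h])
      have h1 := abs_dist_sub_le (pt (i, k)) (pt (i, k')) (α i (u i))
      rw [dist_comm _ (α i (u i)), dist_comm _ (α i (u i))] at h1
      simp only [pt, hsd (i, k), hsd (i, k')] at h1
      refine le_trans ?_ h1
      rw [← sub_mul, abs_mul, abs_of_pos hε0]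
      refine le_mul_of_one_le_left hε0.le ?_
      have h2 : (1 : ℤ) ≤ |((k : ℕ) : ℤ) - ((k' : ℕ) : ℤ)| := by
        refine Int.one_le_abs ?_
        omega
      exact_mod_cast h2
    · exact hεη.trans (hη (i, i') hii _ (mem_image_of_mem _ (hs (i, k))) _
        (mem_image_of_mem _ (hs (i', k'))))
  have hptinj : Function.Injective pt := by
    intro x y h
    by_contra hne
    have := hptd x y hne
    rw [h, dist_self] at this
    linarith
  have hbound := card_sub_one_mul_le_eVariationOn g I (Finset.univ.image pt) (by
      intro x hx
      obtain ⟨y, -, rfl⟩ := Finset.mem_image.1 (Finset.mem_coe.1 hx)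
      exact hsub y.1 (mem_image_of_mem _ (Ioo_subset_Icc_self (hsubI _ (hs y)))))
    (ENNReal.ofReal ε) (by
      intro x hx y hy hxy
      obtain ⟨x', -, rfl⟩ := Finset.mem_image.1 hx
      obtain ⟨y', -, rfl⟩ := Finset.mem_image.1 hy
      rw [edist_dist]
      exact ENNReal.ofReal_le_ofReal (hptd x' y' fun h => hxy (by rw [h])))
  refine le_trans ?_ hbound
  rw [Finset.card_image_of_injective _ hptinj, Finset.card_univ, Fintype.card_prod,
    Fintype.card_fin, ← ENNReal.ofReal_natCast, ← ENNReal.ofReal_mul (Nat.cast_nonneg _)]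
  refine ENNReal.ofReal_le_ofReal ?_
  have hN : 1 ≤ Fintype.card ι := Fintype.card_pos
  -- With N arcs there are N(M+1) points, and N(M+1) − 1 ≥ NM gaps of size ε = r/(2M) make N·r/2.
  have hle : Fintype.card ι * M ≤ Fintype.card ι * (M + 1) - 1 := by
    rw [mul_add, mul_one]; omega
  calc (r : ℝ) / 2 * Fintype.card ι = ((Fintype.card ι * M : ℕ) : ℝ) * ε := by
        rw [hε]; push_cast; field_simp
    _ ≤ _ := by gcongr

instance instCompactSpaceXR : CompactSpace (XR b) := isCompact_iff_compactSpace.1 isClosed_closure.isCompact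

theorem uType_three (b : ℝ) : uType b 3 = ⟨rightHalf, {.V1}, {.V3top}⟩ := by
  unfold uType; split_ifs <;> rfl

/-- For both signs of b, type 4 joins V₁, where x = 0, to V₃, where x = 1; these level sets are
closed and disjoint. -/
theorem exists_length_bound (d : MetricSpace (XR b)) (hd : IsCompatible b d) :
    ∃ δ : ℝ, 0 < δ ∧ ∀ (E : Side → Set EReal) (I : Set ℝ) (g : ℝ → XR b) (m : Fin 4 → ℕ),
      HasArcs b E (uType b) (g '' I) m → ENNReal.ofReal (δ * m 3) ≤ curveLength d I g := by
  classical
  -- The metric is repackaged so that its topology is the subspace topology by definition;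
  -- compactness and continuity proved for the latter then apply.
  have e : d.replaceTopology (Eq.symm hd) = d := MetricSpace.replaceTopology_eq _ _
  let K : ℝ → Set (XR b) := fun t => {P | P.1.1 = ((t : ℝ) : OnePoint ℝ)}
  have hK : ∀ t, IsClosed (K t) := fun t => isClosed_singleton.preimage
    (by fun_prop : Continuous fun P : XR b => P.1.1)
  have hdisj : Disjoint (K 0) (K 1) := disjoint_left.2 fun P (h0 : P.1.1 = _) (h1 : P.1.1 = _) => by
    rw [h0, OnePoint.coe_eq_coe] at h1
    exact zero_ne_one h1
  obtain ⟨δ, hδ, h⟩ := @exists_length_bound_of_arcs (XR b) (d.replaceTopology (Eq.symm hd)) (K 0) (K 1)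
    (hK 0).isCompact (hK 1) hdisj
  refine ⟨δ, hδ, fun E I g m hm => ?_⟩
  obtain ⟨ι, _, typ, A, hA, hAS, hAd, hcard⟩ := hm
  have hA' : ∀ i : {i // typ i = 3}, IsArcOfType b E ⟨rightHalf, {.V1}, {.V3top}⟩ (A i) := fun i => by
    have := hA i
    rwa [i.2, uType_three] at this
  choose α c hα hαA hαc hcc hci hmem h0 h1 using fun i => (hA' i).exists_path
  have key := h α hα (fun i => ?_) (fun i => ?_) (fun i i' hii s hs s' hs' heq => ?_) I g
    (fun i => (hαA i).subset.trans (hAS i))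
  · rw [e] at key
    refine le_trans (ENNReal.ofReal_le_ofReal ?_) key
    rw [Fintype.card_subtype]
    have := hcard 3
    gcongr
  · obtain ⟨v, hv, t, ht, happ⟩ := h0 i
    rw [mem_singleton_iff.1 hv] at happ
    refine mem_sideSet_of_approaches happ (((hα i 0 (left_mem_Icc.2 zero_le_one)).mono
      Ioo_subset_Icc_self).tendsto.mono_left (nhdsWithin_Ioo_eq_nhdsGT one_pos).ge |>.congr' ?_)
    filter_upwards [Ioo_mem_nhdsGT one_pos] with s hs using hαc i s hs
  · obtain ⟨v, hv, t, ht, happ⟩ := h1 i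
    rw [mem_singleton_iff.1 hv] at happ
    refine (mem_sideSet_of_approaches happ (((hα i 1 (right_mem_Icc.2 zero_le_one)).mono
      Ioo_subset_Icc_self).tendsto.mono_left (nhdsWithin_Ioo_eq_nhdsLT one_pos).ge |>.congr' ?_)).1
    filter_upwards [Ioo_mem_nhdsLT one_pos] with s hs using hαc i s hs
  · have hne : (i : ι) ≠ i' := fun h => hii (Subtype.ext h)
    have h2 : α i s ∈ A i ∩ A i' := ⟨hαA i ▸ mem_image_of_mem _ (Ioo_subset_Icc_self hs),
      heq ▸ hαA i' ▸ mem_image_of_mem _ (Ioo_subset_Icc_self hs')⟩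
    have h3 := hAd i i' hne h2
    rw [hαc i s hs, incl_mem_curvesV_iff] at h3
    exact rightHalf_ne _ (hmem i s hs) h3

/-! ### Intersections of u-arcs and s-arcs -/

theorem exists_upper_bound_of_tendsto {h : ℝ → ℝ} (hh : ContinuousOn h (Ioo 0 1))
    (hlim : Tendsto h (𝓝[<] 1) atBot) {t : ℝ} (ht : t ∈ Ioo (0 : ℝ) 1) :
    ∃ Y, ∀ s ∈ Ico t 1, h s ≤ Y := by
  obtain ⟨e, he, hneg⟩ := (mem_nhdsLT_iff_exists_Ico_subset).1 (hlim.eventually_lt_atBot 0)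
  have he : e < 1 := he
  obtain ⟨Y, hY⟩ := isCompact_Icc.bddAbove_image (hh.mono fun s (hs : s ∈ Icc t (max t e)) =>
    ⟨ht.1.trans_le hs.1, hs.2.trans_lt (max_lt ht.2 he)⟩)
  refine ⟨max Y 0, fun s hs => ?_⟩
  rcases le_or_gt s (max t e) with h' | h'
  · exact (hY (mem_image_of_mem h ⟨hs.1, h'⟩)).trans (le_max_left _ _)
  · exact (show h s < 0 from hneg ⟨((le_max_right _ _).trans_lt h').le, hs.2⟩).le.trans
      (le_max_right _ _)

theorem exists_Ioc_of_eventually_right {P : ℝ → Prop} (h : ∀ᶠ s in 𝓝[>] (0 : ℝ), P s) :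
    ∃ t ∈ Ioo (0 : ℝ) 1, ∀ s ∈ Ioc 0 t, P s := by
  obtain ⟨e, he, hP⟩ := (mem_nhdsGT_iff_exists_Ioc_subset).1 h
  refine ⟨min e (1 / 2), ⟨lt_min he (by norm_num), (min_le_right _ _).trans_lt (by norm_num)⟩,
    fun s hs => hP ⟨hs.1, hs.2.trans (min_le_left _ _)⟩⟩

theorem exists_pos_lower_bound {h : ℝ → ℝ} (hh : ContinuousOn h (Ioo 0 1))
    (hpos : ∀ s ∈ Ioo (0 : ℝ) 1, 0 < h s) {p q : ℝ} (hp : 0 < p) (hpq : p ≤ q) (hq : q < 1) :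
    ∃ m > 0, ∀ s ∈ Icc p q, m ≤ h s := by
  have hsub : Icc p q ⊆ Ioo 0 1 := fun s hs => ⟨hp.trans_le hs.1, hs.2.trans_lt hq⟩
  obtain ⟨x, hx, hmin⟩ := isCompact_Icc.exists_isMinOn (nonempty_Icc.2 hpq) (hh.mono hsub)
  exact ⟨h x, hpos x (hsub hx), fun s hs => hmin hs⟩

/-- A u-arc from `V₁` to the top of `V₃` and an s-arc from `V₁` to the bottom of `V₃` cross. -/
theorem exists_crossing {a : ℝ} (ha : a < -1) {c e : ℝ → ℝ × ℝ} (hc : IsHalfPath c rightHalf)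
    (he : IsHalfPath e rightHalf)
    (hc0 : Reaches b (Es a) (𝓝[>] 0) c .V1) (hc1 : Reaches b (Es a) (𝓝[<] 1) c .V3top)
    (he0 : Reaches b (Eu a) (𝓝[>] 0) e .V1) (he1 : Reaches b (Eu a) (𝓝[<] 1) e .V3bot) :
    ∃ s ∈ Ioo (0 : ℝ) 1, ∃ t ∈ Ioo (0 : ℝ) 1, c s = e t := by
  -- A height between the ends on V₁: the u-arc starts at y ≤ a + 1 < η, the s-arc at y ≥ 0 > η.
  obtain ⟨η, hη1, hη2⟩ : ∃ η : ℝ, a + 1 < η ∧ η < 0 := exists_between (by linarith)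
  obtain ⟨t₁, ht₁, hc0⟩ := hc0
  obtain ⟨t₂, ht₂, hc1⟩ := hc1
  obtain ⟨t₃, ht₃, he0⟩ := he0
  obtain ⟨t₄, ht₄, he1⟩ := he1
  have hcx : ContinuousOn (fun s => (c s).1) (Ioo 0 1) := continuous_fst.comp_continuousOn hc.cont
  have hex : ContinuousOn (fun s => (e s).1) (Ioo 0 1) := continuous_fst.comp_continuousOn he.cont
  obtain ⟨s', hs', hsP⟩ := exists_Ioc_of_eventually_right
    ((hc0.1.eventually_lt_const (show (0 : ℝ) < 1 / 2 by norm_num)).and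
      (hc0.2.eventually_lt_const (lt_of_le_of_lt ht₁ (EReal.coe_lt_coe_iff.2 hη1))))
  obtain ⟨t', ht', htP⟩ := exists_Ioc_of_eventually_right
    ((he0.1.eventually_lt_const (show (0 : ℝ) < 1 / 2 by norm_num)).and
      (he0.2.eventually_const_lt (lt_of_lt_of_le (EReal.coe_lt_coe_iff.2 hη2) ht₃)))
  simp only [EReal.coe_lt_coe_iff] at hsP htP
  obtain ⟨Y, hY⟩ := exists_upper_bound_of_tendsto he.contOn_snd he1.1 ht'
  obtain ⟨Z, hZ⟩ := exists_upper_bound_of_tendsto hc.contOn_snd.neg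
    (tendsto_neg_atTop_atBot.comp hc1.1) hs'
  obtain ⟨s₁, hs₁, hs₁x, hs₁y⟩ := exists_mem_of_eventually_left
    ((hc1.2.1.eventually_const_lt (show (1 / 2 : ℝ) < 1 by norm_num)).and
      (hc1.1.eventually_gt_atTop Y)) hs'.2
  obtain ⟨t₁', ht₁', ht₁x, ht₁y⟩ := exists_mem_of_eventually_left
    ((he1.2.1.eventually_const_lt (show (1 / 2 : ℝ) < 1 by norm_num)).and
      (he1.1.eventually_lt_atBot (-Z))) ht'.2
  -- Once away from its start, each path keeps a positive distance from x = 0. The other path is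
  -- then started closer to x = 0 than that, so on the left edge and the bottom edge the paths are
  -- ordered either in x or in y.
  obtain ⟨mc, hmc, hmc'⟩ := exists_pos_lower_bound hcx (fun s hs => hc.mem s hs) hs'.1 hs₁.1.le
    hs₁.2
  obtain ⟨me, hme, hme'⟩ := exists_pos_lower_bound hex (fun s hs => he.mem s hs) ht'.1 ht₁'.1.le
    ht₁'.2
  obtain ⟨s₀, hs₀x, hs₀⟩ := ((hc0.1.eventually_lt_const hme).and (Ioo_mem_nhdsGT hs'.1)).exists
  obtain ⟨t₀, ht₀x, ht₀⟩ := ((he0.1.eventually_lt_const hmc).and (Ioo_mem_nhdsGT ht'.1)).exists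
  have hsubs : Icc s₀ s₁ ⊆ Ioo 0 1 := fun s hs => ⟨hs₀.1.trans_le hs.1, hs.2.trans_lt hs₁.2⟩
  have hsubt : Icc t₀ t₁' ⊆ Ioo 0 1 := fun s hs => ⟨ht₀.1.trans_le hs.1, hs.2.trans_lt ht₁'.2⟩
  have hbot : ∀ s ∈ Icc s₀ s₁, (e t₀).1 < (c s).1 ∨ (c s).2 < (e t₀).2 := by
    intro s hs
    rcases le_or_gt s s' with h | h
    · exact Or.inr ((hsP s ⟨(hsubs hs).1, h⟩).2.trans (htP t₀ ⟨ht₀.1, ht₀.2.le⟩).2)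
    · exact Or.inl (ht₀x.trans_le (hmc' s ⟨h.le, hs.2⟩))
  have hright : ∀ t ∈ Icc t₀ t₁', (e t).1 < (c s₁).1 ∨ (e t).2 < (c s₁).2 := by
    intro t ht
    rcases le_or_gt t t' with h | h
    · exact Or.inl ((htP t ⟨(hsubt ht).1, h⟩).1.trans hs₁x)
    · exact Or.inr ((hY t ⟨h.le, (hsubt ht).2⟩).trans_lt hs₁y)
  have htop : ∀ s ∈ Icc s₀ s₁, (c s).1 < (e t₁').1 ∨ (e t₁').2 < (c s).2 := by
    intro s hs
    rcases le_or_gt s s' with h | h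
    · exact Or.inl ((hsP s ⟨(hsubs hs).1, h⟩).1.trans ht₁x)
    · refine Or.inr ?_
      have : -(c s).2 ≤ Z := hZ s ⟨h.le, (hsubs hs).2⟩
      linarith
  have hleft : ∀ t ∈ Icc t₀ t₁', (c s₀).1 < (e t).1 ∨ (c s₀).2 < (e t).2 := by
    intro t ht
    rcases le_or_gt t t' with h | h
    · exact Or.inr ((hsP s₀ ⟨hs₀.1, hs₀.2.le⟩).2.trans (htP t ⟨(hsubt ht).1, h⟩).2)
    · exact Or.inl (hs₀x.trans_le (hme' t ⟨h.le, ht.2⟩))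
  obtain ⟨s, hs, t, ht, h⟩ := exists_eq_of_winding (hs₀.2.trans hs₁.1).le (ht₀.2.trans ht₁'.1).le
    (hc.cont.mono hsubs) (he.cont.mono hsubt) hbot hright htop hleft
  exact ⟨s, hsubs hs, t, hsubt ht, h⟩

theorem exists_incl_mem_inter (ha : a < -1) {A B : Set (XR b)}
    (hA : IsArcOfType b (Es a) (uType b 3) A) (hB : IsArcOfType b (Eu a) (sType b 3) B) :
    ∃ P ∈ A ∩ B, P ∉ curvesV b := by
  rw [uType_three] at hA
  rw [sType_three] at hB
  obtain ⟨α, c, -, rfl, hαc, hc, hci, hcm, ⟨v, hv, h0⟩, ⟨w, hw, h1⟩⟩ := hA.exists_path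
  obtain ⟨β, e, -, rfl, hβe, he, hei, hem, ⟨v', hv', h0'⟩, ⟨w', hw', h1'⟩⟩ := hB.exists_path
  rw [mem_singleton_iff.1 hv] at h0
  rw [mem_singleton_iff.1 hw] at h1
  rw [mem_singleton_iff.1 hv'] at h0'
  rw [mem_singleton_iff.1 hw'] at h1'
  obtain ⟨s, hs, t, ht, h⟩ := exists_crossing ha ⟨hc, hci, hcm⟩ ⟨he, hei, hem⟩ h0 h1 h0' h1'
  refine ⟨incl b (c s), ⟨?_, ?_⟩, fun h => rightHalf_ne _ (hcm s hs) (incl_mem_curvesV_iff.1 h)⟩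
  · rw [← hαc s hs]; exact mem_image_of_mem _ (Ioo_subset_Icc_self hs)
  · rw [h, ← hβe t ht]; exact mem_image_of_mem _ (Ioo_subset_Icc_self ht)

/-- Different pairs of arcs give different crossing points, since the crossings lie off the Vⱼ,
where distinct arcs do not meet. -/
theorem HasArcs.le_encard_inter (ha : a < -1) {S S' : Set (XR b)} {m m' : Fin 4 → ℕ}
    (h : HasArcs b (Es a) (uType b) S m) (h' : HasArcs b (Eu a) (sType b) S' m') :
    ((m 3 * m' 3 : ℕ) : ℕ∞) ≤ (S ∩ S').encard := by
  classical
  obtain ⟨ι, _, typ, A, hA, hAS, hAd, hm⟩ := h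
  obtain ⟨κ, _, typ', B, hB, hBS, hBd, hm'⟩ := h'
  have hpt : ∀ x : {i // typ i = 3} × {k // typ' k = 3}, ∃ P ∈ A x.1 ∩ B x.2, P ∉ curvesV b :=
    fun x => exists_incl_mem_inter ha (by have := hA x.1; rwa [x.1.2] at this)
      (by have := hB x.2; rwa [x.2.2] at this)
  choose P hP hPV using hpt
  have hinj : Function.Injective P := by
    rintro ⟨i, k⟩ ⟨i', k'⟩ h
    have hi : i = i' := by
      by_contra hne
      exact hPV (i, k) (hAd i i' (fun h => hne (Subtype.ext h)) ⟨(hP (i, k)).1, h ▸ (hP (i', k')).1⟩)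
    have hk : k = k' := by
      by_contra hne
      exact hPV (i, k) (hBd k k' (fun h => hne (Subtype.ext h)) ⟨(hP (i, k)).2, h ▸ (hP (i', k')).2⟩)
    rw [hi, hk]
  have hsub : ((Finset.univ.image P : Finset (XR b)) : Set (XR b)) ⊆ S ∩ S' := by
    intro y hy
    obtain ⟨x, -, rfl⟩ := Finset.mem_image.1 (Finset.mem_coe.1 hy)
    exact ⟨hAS _ (hP x).1, hBS _ (hP x).2⟩
  refine le_trans ?_ (encard_le_encard hsub)
  rw [Set.encard_coe_eq_coe_finsetCard, Finset.card_image_of_injective _ hinj, Finset.card_univ,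
    Fintype.card_prod, Fintype.card_subtype, Fintype.card_subtype]
  exact_mod_cast Nat.mul_le_mul (hm 3) (hm' 3)


end

end PlaneBirational

open PlaneBirational in
theorem theorem4p4 (a b ρ : ℝ) (ha : a < -1) (hb : b ≠ 0)
    (hρ : IsGreatest {x : ℝ | x ^ 3 - x ^ 2 - 2 * x - 1 = 0} ρ)
    (I : Set ℝ) (hI : I.OrdConnected) (γ : ℝ → XR b) (hγ : ContinuousOn γ I)
    (hγI : Disjoint (γ '' I) (⋃ n : ℕ, (f a b)^[n] ⁻¹' indetF a b))
    (hγu : ∃ j A, IsUArc a b j A ∧ A ⊆ γ '' I) :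
    (∃ c : ℝ, 0 < c ∧ ∀ᶠ n : ℕ in atTop, ∀ j : Fin 4,
      ENNReal.ofReal (c * ρ ^ n) ≤ (uCount a b j ((f a b)^[n] '' (γ '' I)) : ℝ≥0∞)) ∧
    (∀ d : MetricSpace (XR b), IsCompatible b d →
      ∃ c : ℝ, 0 < c ∧ ∀ᶠ n : ℕ in atTop,
        ENNReal.ofReal (c * ρ ^ n) ≤ curveLength d I (fun t => (f a b)^[n] (γ t))) ∧
    (∀ (I' : Set ℝ) (γ' : ℝ → XR b), I'.OrdConnected → ContinuousOn γ' I' →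
      Disjoint (γ' '' I') (⋃ n : ℕ, (fInv a b)^[n] ⁻¹' indetFInv a b) →
      (∃ j A, IsSArc a b j A ∧ A ⊆ γ' '' I') →
      ∃ c : ℝ, 0 < c ∧ ∀ᶠ n : ℕ in atTop,
        ENNReal.ofReal (c * ρ ^ (2 * n)) ≤
          ((((f a b)^[n] '' (γ '' I)) ∩ ((fInv a b)^[n] '' (γ' '' I'))).encard : ℝ≥0∞)) := by
  have hρ0 : 0 < ρ := by linarith [two_le_of_isGreatest hρ]
  obtain ⟨j, A, hA, hAγ⟩ := hγu
  have hu : ∀ n, HasArcs b (Es a) (uType b) ((f a b)^[n] '' (γ '' I))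
      ((stepCount (transition b))^[n] (Pi.single j 1)) :=
    (arcSystem_u ha hb).hasArcs_iterate (hasArcs_single hA hAγ) hγI
  obtain ⟨c, hc, hcn⟩ := exists_stepCount_lower_bound b hρ j
  refine ⟨⟨c, hc, ?_⟩, fun d hd => ?_, fun I' γ' _ _ hγI' hγs => ?_⟩
  · filter_upwards [eventually_ge_atTop 6] with n hn k
    calc ENNReal.ofReal (c * ρ ^ n)
        ≤ ENNReal.ofReal ((stepCount (transition b))^[n] (Pi.single j 1) k : ℕ) :=
          ENNReal.ofReal_le_ofReal (hcn n hn k)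
      _ = (((stepCount (transition b))^[n] (Pi.single j 1) k : ℕ∞) : ℝ≥0∞) := by
          rw [ENNReal.ofReal_natCast, ENat.toENNReal_coe]
      _ ≤ _ := ENat.toENNReal_le.2 ((hu n).le_uCount hb k)
  · obtain ⟨δ, hδ, hlen⟩ := exists_length_bound d hd
    refine ⟨δ * c, by positivity, ?_⟩
    filter_upwards [eventually_ge_atTop 6] with n hn
    have h := hu n
    rw [image_image] at h
    refine le_trans (ENNReal.ofReal_le_ofReal ?_) (hlen _ I _ _ h)
    rw [mul_assoc]
    gcongr
    exact hcn n hn 3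
  · obtain ⟨j', A', hA', hAγ'⟩ := hγs
    have hs : ∀ n, HasArcs b (Eu a) (sType b) ((fInv a b)^[n] '' (γ' '' I'))
        ((stepCount (transition b))^[n] (Pi.single j' 1)) :=
      (arcSystem_s ha hb).hasArcs_iterate (hasArcs_single hA' hAγ') hγI'
    obtain ⟨c', hc', hcn'⟩ := exists_stepCount_lower_bound b hρ j'
    refine ⟨c * c', by positivity, ?_⟩
    filter_upwards [eventually_ge_atTop 6] with n hn
    refine le_trans ?_ (ENat.toENNReal_le.2 ((hu n).le_encard_inter ha (hs n)))
    rw [ENat.toENNReal_coe, ← ENNReal.ofReal_natCast]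
    refine ENNReal.ofReal_le_ofReal ?_
    calc c * c' * ρ ^ (2 * n) = c * ρ ^ n * (c' * ρ ^ n) := by ring
      _ ≤ _ := by
        push_cast
        exact mul_le_mul (hcn n hn 3) (hcn' n hn 3) (by positivity) (by positivity)
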